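/- **Theorem 3.1 (Comparison Principle).** Let $1<p<\infty$, let $T>0$, let $\Omega\subset\mathbb R^n$ be a bounded Lipschitz domain, and put $\Omega_T=\Omega\times(0,T)$, $b(z)=|z|^{p-2}z$ with $b(0)=0$, and $\partial_p\Omega_T=(\overline\Omega\times\{0\})\cup(\partial\Omega\times[0,T])$. Let $L^p(0,T;W^{1,p}(\Omega))$ be the space of measurable $u:\Omega_T\to\mathbb R$ such that $u(\cdot,t)\in W^{1,p}(\Omega)$ for almost every $t\in(0,T)$ and $\int_0^T\!\int_\Omega(|u|^p+|\nabla u|^p)\,dx\,dt<\infty$, where $\nabla$ is the spatial gradient; $L^p(0,T;W^{1,p}_0(\Omega))$ is defined analogously, $W^{1,p}_0(\Omega)$ being the closure of $C_0^\infty(\Omega)$ in $W^{1,p}(\Omega)$. For $\psi\in C(\overline{\Omega_T})\cap L^p(0,T;W^{1,p}(\Omega))$, a function $u\in L^p(0,T;W^{1,p}(\Omega))$ is called a weak solution of Trudinger's equation $\partial_t(|u|^{p-2}u)=\operatorname{div}(|\nabla u|^{p-2}\nabla u)$ with boundary values $\psi$ if 1. $u-\psi\in L^p(0,T;W_0^{1,p}(\Omega))$;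 2. for every $\gamma\in C_0^\infty(\Omega_T)$, $$\int_0^T\!\!\int_\Omega\bigl(-b(u)\,\partial_t\gamma+\langle|\nabla u|^{p-2}\nabla u,\nabla\gamma\rangle\bigr)\,dx\,dt=0;$$ 3. $\displaystyle\lim_{t\to0+}\int_\Omega|b(u(x,t))-b(\psi(x,t))|\,dx=0$, where the limit is taken outside a null set of times $t$. Let $u_1,u_2$ be weak solutions with boundary values $\psi_1,\psi_2$, respectively, and suppose that there is a constant $\varepsilon>0$ such that $$\psi_1(x,t)\le\psi_2(x,t)-\varepsilon\qquad\text{for all }(x,t)\in\partial_p\Omega_T.$$ Then $u_1\le u_2$ almost everywhere in $\Omega_T$. -/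

import Mathlib

open MeasureTheory Set Filter Topology
open scoped ContDiff

noncomputable section

namespace Trudinger

/-- Elements of `C_0^∞(U)`: smooth functions whose support is a compact subset of `U`. -/
structure IsTestFunction {F : Type*} [NormedAddCommGroup F] [NormedSpace ℝ F]
    (U : Set F) (φ : F → ℝ) : Prop where
  contDiff : ContDiff ℝ ∞ φ
  hasCompactSupport : HasCompactSupport φ
  tsupport_subset : tsupport φ ⊆ U

variable {n : ℕ}

/-- A bounded Lipschitz domain: a nonempty, bounded, connected open set which, near each of its
boundary points, is the part of space lying strictly on one side of the graph of a Lipschitz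
function. The graph is taken in the direction `ν`, over the hyperplane orthogonal to `ν`. -/
structure IsBoundedLipschitzDomain (Ω : Set (EuclideanSpace ℝ (Fin n))) : Prop where
  isOpen : IsOpen Ω
  isConnected : IsConnected Ω
  isBounded : Bornology.IsBounded Ω
  lipschitz_boundary : ∀ x₀ ∈ frontier Ω,
    ∃ (ν : EuclideanSpace ℝ (Fin n)) (g : (Submodule.span ℝ {ν})ᗮ → ℝ) (K : NNReal) (r : ℝ),
      ‖ν‖ = 1 ∧ LipschitzWith K g ∧ 0 < r ∧
      ∀ y ∈ Metric.ball x₀ r,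
        (y ∈ Ω ↔ g ((Submodule.span ℝ {ν})ᗮ.orthogonalProjectionOnto y) < inner ℝ ν y)

/-- `f ∈ W^{1,p}(Ω)` with weak gradient `g`. -/
structure HasSobolevGradient (Ω : Set (EuclideanSpace ℝ (Fin n))) (p : ℝ)
    (f : EuclideanSpace ℝ (Fin n) → ℝ)
    (g : EuclideanSpace ℝ (Fin n) → EuclideanSpace ℝ (Fin n)) : Prop where
  memLp : MemLp f (ENNReal.ofReal p) (volume.restrict Ω)
  memLp_gradient : MemLp g (ENNReal.ofReal p) (volume.restrict Ω)
  integral_eq : ∀ φ : EuclideanSpace ℝ (Fin n) → ℝ, IsTestFunction Ω φ →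
    ∫ x in Ω, f x • gradient φ x = - ∫ x in Ω, φ x • g x

/-- `f ∈ W_0^{1,p}(Ω)` with weak gradient `g`, where `W_0^{1,p}(Ω)` is the closure of
`C_0^∞(Ω)` in `W^{1,p}(Ω)`. -/
structure HasSobolevGradientZero (Ω : Set (EuclideanSpace ℝ (Fin n))) (p : ℝ)
    (f : EuclideanSpace ℝ (Fin n) → ℝ)
    (g : EuclideanSpace ℝ (Fin n) → EuclideanSpace ℝ (Fin n)) : Prop
    extends HasSobolevGradient Ω p f g where
  exists_approx : ∃ φ : ℕ → EuclideanSpace ℝ (Fin n) → ℝ,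
    (∀ k, IsTestFunction Ω (φ k)) ∧
    Tendsto (fun k => eLpNorm (fun x => f x - φ k x) (ENNReal.ofReal p) (volume.restrict Ω))
      atTop (𝓝 0) ∧
    Tendsto (fun k => eLpNorm (fun x => g x - gradient (φ k) x) (ENNReal.ofReal p)
      (volume.restrict Ω)) atTop (𝓝 0)

/-- The space-time cylinder `Ω_T = Ω × (0,T)`. -/
def spaceTimeCylinder (Ω : Set (EuclideanSpace ℝ (Fin n))) (T : ℝ) :
    Set (EuclideanSpace ℝ (Fin n) × ℝ) :=
  Ω ×ˢ Ioo 0 T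

/-- The parabolic boundary `(closure Ω × {0}) ∪ (∂Ω × [0,T])`. -/
def parabolicBoundary (Ω : Set (EuclideanSpace ℝ (Fin n))) (T : ℝ) :
    Set (EuclideanSpace ℝ (Fin n) × ℝ) :=
  (closure Ω ×ˢ {0}) ∪ (frontier Ω ×ˢ Icc 0 T)

/-- `u ∈ L^p(0,T;W^{1,p}(Ω))` with spatial gradient `Du`. Only the values on the cylinder
matter. -/
structure HasParabolicGradient (Ω : Set (EuclideanSpace ℝ (Fin n))) (T p : ℝ)
    (u : EuclideanSpace ℝ (Fin n) × ℝ → ℝ)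
    (Du : EuclideanSpace ℝ (Fin n) × ℝ → EuclideanSpace ℝ (Fin n)) : Prop where
  memLp : MemLp u (ENNReal.ofReal p) (volume.restrict (spaceTimeCylinder Ω T))
  memLp_gradient : MemLp Du (ENNReal.ofReal p) (volume.restrict (spaceTimeCylinder Ω T))
  slice : ∀ᵐ t ∂(volume.restrict (Ioo 0 T)),
    HasSobolevGradient Ω p (fun x => u (x, t)) (fun x => Du (x, t))

/-- `u ∈ L^p(0,T;W^{1,p}(Ω))`. -/
def MemParabolicSobolev (Ω : Set (EuclideanSpace ℝ (Fin n))) (T p : ℝ)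
    (u : EuclideanSpace ℝ (Fin n) × ℝ → ℝ) : Prop :=
  ∃ Du : EuclideanSpace ℝ (Fin n) × ℝ → EuclideanSpace ℝ (Fin n),
    HasParabolicGradient Ω T p u Du

/-- `u ∈ L^p(0,T;W_0^{1,p}(Ω))`. -/
def MemParabolicSobolevZero (Ω : Set (EuclideanSpace ℝ (Fin n))) (T p : ℝ)
    (u : EuclideanSpace ℝ (Fin n) × ℝ → ℝ) : Prop :=
  ∃ Du : EuclideanSpace ℝ (Fin n) × ℝ → EuclideanSpace ℝ (Fin n),
    HasParabolicGradient Ω T p u Du ∧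
    ∀ᵐ t ∂(volume.restrict (Ioo 0 T)),
      HasSobolevGradientZero Ω p (fun x => u (x, t)) (fun x => Du (x, t))

/-- The function `b(z) = |z|^{p-2} z`, which vanishes at `0`. -/
def b (p z : ℝ) : ℝ := |z| ^ (p - 2) * z

/-- The vector field `|ξ|^{p-2} ξ`, which vanishes at `0`. -/
def flux (p : ℝ) (ξ : EuclideanSpace ℝ (Fin n)) : EuclideanSpace ℝ (Fin n) :=
  ‖ξ‖ ^ (p - 2) • ξ

/-- Admissible boundary data: `ψ ∈ C(closure Ω_T) ∩ L^p(0,T;W^{1,p}(Ω))`. -/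
structure IsBoundaryDatum (Ω : Set (EuclideanSpace ℝ (Fin n))) (T p : ℝ)
    (ψ : EuclideanSpace ℝ (Fin n) × ℝ → ℝ) : Prop where
  continuousOn : ContinuousOn ψ (closure (spaceTimeCylinder Ω T))
  memParabolicSobolev : MemParabolicSobolev Ω T p ψ

/-- `u` is a weak solution of `∂ₜ(|u|^{p-2} u) = div(|∇u|^{p-2} ∇u)` in `Ω_T` with Dirichlet
boundary values `ψ`. Since `u` is an element of a space of functions defined almost everywhere,
its time slices make sense for almost every `t` only, and accordingly the limit `t → 0+` in the
initial condition is taken after discarding a null set of times. -/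
structure IsWeakSolution (Ω : Set (EuclideanSpace ℝ (Fin n))) (T p : ℝ)
    (ψ u : EuclideanSpace ℝ (Fin n) × ℝ → ℝ) : Prop where
  boundaryDatum : IsBoundaryDatum Ω T p ψ
  lateral : MemParabolicSobolevZero Ω T p (fun z => u z - ψ z)
  equation : ∃ Du : EuclideanSpace ℝ (Fin n) × ℝ → EuclideanSpace ℝ (Fin n),
    HasParabolicGradient Ω T p u Du ∧
    ∀ γ : EuclideanSpace ℝ (Fin n) × ℝ → ℝ, IsTestFunction (spaceTimeCylinder Ω T) γ →
      ∫ z in spaceTimeCylinder Ω T,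
        (-(b p (u z)) * deriv (fun t => γ (z.1, t)) z.2
          + inner ℝ (flux p (Du z)) (gradient (fun x => γ (x, z.2)) z.1)) = 0
  initial : Tendsto (fun t : ℝ => ∫⁻ x in Ω, ‖b p (u (x, t)) - b p (ψ (x, t))‖ₑ)
    (𝓝[>] 0 ⊓ ae volume) (𝓝 0)

end Trudinger

end

/-! The argument is an `L¹` contraction obtained by doubling the time variable. Formally one tests
the difference of the two equations with a smooth step `H_δ(u₁ - u₂)`: the flux terms have a sign
because `|ξ|^{p-2} ξ` is monotone. Since `b` is increasing, `u₁ - u₂` and `b(u₁) - b(u₂)` have the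
same sign, so `δ → 0` says that `F(t) = ∫ (b(u₁) - b(u₂))⁺ dx` is nonincreasing. The initial
condition forces `F(0+) = 0`, hence `F = 0`, and strict monotonicity of `b` gives `u₁ ≤ u₂`.

The obstacle is that a weak solution has no usable time derivative and no chain rule in time. Each
solution is therefore compared with a time-independent function `w`, namely a slice of the other
solution. The equation is first rewritten for increments `b(u(t)) - b(u(t-s))`, valid for almost
every `t` against all of `W_0^{1,p}(Ω)` at once (`IsRepresentative.ae_increment`). The entropy, a
primitive of `H_δ(· - w)` with respect to `db`, is convex as a function of `b(z)`. Its increment is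
thus at most the increment of `b(u)` times `H_δ(u(t) - w)` (`entropy_sub_le`). Division by `s` and
`s → 0` give `IsIncremental.entropy_inequality`.

This inequality is applied to `u₁` at time `t` against `u₂(·,s)`, and, `b` and the flux being odd,
to `-u₂` at time `s` against `-u₁(·,t)`. The sum over both times has a nonnegative flux part
(`IsIncremental.doubled_entropy_inequality`). As `δ → 0` both entropies tend to `(b(u₁(t)) -
b(u₂(s)))⁺`. With the weight `χ(t) ϖ(t-s)` the derivatives of `ϖ` cancel and only `χ'(t) ϖ(t-s)`
survives (`IsIncremental.doubled_inequality`). Concentrating `ϖ` at `0` yields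
`IsIncremental.integral_max_nonneg`, and `ae_eq_zero_of_tendsto_zero` concludes.

The gap `ε` makes `H_δ(u₁(t) - u₂(s))` admissible: by uniform continuity `ψ₁(x,t) ≤ ψ₂(x,s)` for `x`
near `∂Ω` and `|t-s|` small (`exists_order_near_boundary`). A step that vanishes on nonpositive
arguments then removes the boundary data outside a compact subset of `Ω`
(`HasSobolevGradientZero.comp_add`). -/

noncomputable section

namespace Trudinger

section

/-! ### Continuity of translations and mollification in `L^q`. -/

section Translation

variable {G F : Type*} [NormedAddCommGroup G] [NormedSpace ℝ G] [FiniteDimensional ℝ G]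
  [MeasurableSpace G] [BorelSpace G] [NormedAddCommGroup F]

/-- Translations are continuous in `L^q`. -/
theorem tendsto_eLpNorm_sub_translate (μ : Measure G) [μ.IsAddHaarMeasure] {f : G → F}
    {q : ENNReal} (hq1 : 1 ≤ q) (hq : q ≠ ⊤) (hf : MemLp f q μ) :
    Tendsto (fun y => eLpNorm (fun x => f (x - y) - f x) q μ) (𝓝 0) (𝓝 0) := by
  have : Fact (1 ≤ q) := ⟨hq1⟩
  have : ProperSpace G := FiniteDimensional.proper ℝ G
  let c : G → C(G, G) := fun y => ⟨fun x => x - y, by fun_prop⟩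
  have hmp : ∀ y, MeasurePreserving (c y) μ μ := fun y => measurePreserving_sub_right μ y
  have hc : Continuous c :=
    ContinuousMap.continuous_of_continuous_uncurry c
      (by simpa [c, Function.uncurry_def] using! continuous_snd.sub continuous_fst)
  have h := (continuous_const (y := hf.toLp f)).compMeasurePreservingLp hc hmp hq
  have h0 := h.tendsto 0
  rw [tendsto_iff_edist_tendsto_0] at h0
  refine h0.congr fun y => ?_
  rw [Lp.edist_def]
  refine eLpNorm_congr_ae ?_
  have h1 := (Lp.coeFn_compMeasurePreserving (hf.toLp f) (hmp y)).trans
    ((hmp y).quasiMeasurePreserving.ae_eq_comp hf.coeFn_toLp)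
  have h2 := (Lp.coeFn_compMeasurePreserving (hf.toLp f) (hmp 0)).trans
    ((hmp 0).quasiMeasurePreserving.ae_eq_comp hf.coeFn_toLp)
  filter_upwards [h1, h2] with x h1 h2
  rw [Pi.sub_apply, h1, h2]
  simp [c]

end Translation

section Mollification

variable {G F : Type*} [NormedAddCommGroup G] [NormedSpace ℝ G] [FiniteDimensional ℝ G]
  [MeasurableSpace G] [BorelSpace G] [NormedAddCommGroup F] [NormedSpace ℝ F] [CompleteSpace F]

open Convolution ContinuousLinearMap

/-- A normalised bump is a probability density, so the mollification error at `x` is at most the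
`L^q` norm in `y`, under that probability, of the translation error. Raising to the power `q` and
exchanging integrals bounds the whole error by the worst translation in the support of the bump. -/
theorem eLpNorm_convolution_sub_le (μ : Measure G) [μ.IsAddHaarMeasure] {f : G → F} {q : ENNReal}
    (hq1 : 1 ≤ q) (hq : q ≠ ⊤) (hf : StronglyMeasurable f) (hfq : MemLp f q μ)
    (φ : ContDiffBump (0 : G)) (C : ENNReal)
    (hC : ∀ y ∈ Metric.ball (0 : G) φ.rOut, eLpNorm (fun x => f (x - y) - f x) q μ ≤ C) :
    eLpNorm (fun x => (φ.normed μ ⋆[lsmul ℝ ℝ, μ] f) x - f x) q μ ≤ C := by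
  set P : Measure G := μ.withDensity (fun y => ENNReal.ofReal (φ.normed μ y)) with hP
  have hmeasρ : Measurable (fun y => ENNReal.ofReal (φ.normed μ y)) :=
    (φ.continuous_normed.measurable).ennreal_ofReal
  have : ProperSpace G := FiniteDimensional.proper ℝ G
  have : IsProbabilityMeasure P := by
    constructor
    rw [hP, withDensity_apply _ MeasurableSet.univ, Measure.restrict_univ,
      ← ofReal_integral_eq_lintegral_ofReal φ.integrable_normed
        (Eventually.of_forall fun y => φ.nonneg_normed y), φ.integral_normed, ENNReal.ofReal_one]
  have hq0 : q ≠ 0 := (zero_lt_one.trans_le hq1).ne'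
  have hqr : 0 < q.toReal := ENNReal.toReal_pos hq0 hq
  have hloc : LocallyIntegrable f μ := hfq.locallyIntegrable hq1
  have hjoint : StronglyMeasurable (fun z : G × G => f (z.1 - z.2) - f z.1) :=
    (hf.comp_measurable (measurable_fst.sub measurable_snd)).sub (hf.comp_measurable measurable_fst)
  have hpt : ∀ x, ‖(φ.normed μ ⋆[lsmul ℝ ℝ, μ] f) x - f x‖ₑ
      ≤ eLpNorm (fun y => f (x - y) - f x) q P := by
    intro x
    have hex : ConvolutionExistsAt (φ.normed μ) f x (lsmul ℝ ℝ) μ :=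
      φ.hasCompactSupport_normed.convolutionExists_left _ φ.continuous_normed hloc x
    have e1 : (φ.normed μ ⋆[lsmul ℝ ℝ, μ] f) x - f x
        = ∫ y, φ.normed μ y • (f (x - y) - f x) ∂μ := by
      rw [convolution_def]
      conv_lhs => rw [← φ.integral_normed_smul μ (f x)]
      rw [← integral_sub]
      · simp [smul_sub]
      · exact hex
      · exact φ.integrable_normed.smul_const _
    have e2 : (∫⁻ y, ‖φ.normed μ y • (f (x - y) - f x)‖ₑ ∂μ) = ∫⁻ y, ‖f (x - y) - f x‖ₑ ∂P := by
      rw [hP, lintegral_withDensity_eq_lintegral_mul₀ hmeasρ.aemeasurable]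
      · refine lintegral_congr fun y => ?_
        simp only [Pi.mul_apply, enorm_smul]
        rw [Real.enorm_of_nonneg (φ.nonneg_normed y)]
      · exact ((hjoint.comp_measurable measurable_prodMk_left).enorm).aemeasurable
    calc ‖(φ.normed μ ⋆[lsmul ℝ ℝ, μ] f) x - f x‖ₑ
        ≤ ∫⁻ y, ‖φ.normed μ y • (f (x - y) - f x)‖ₑ ∂μ := by
          rw [e1]; exact enorm_integral_le_lintegral_enorm _
      _ = eLpNorm (fun y => f (x - y) - f x) 1 P := by rw [e2, eLpNorm_one_eq_lintegral_enorm]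
      _ ≤ eLpNorm (fun y => f (x - y) - f x) q P :=
          eLpNorm_le_eLpNorm_of_exponent_le hq1
            (hjoint.comp_measurable measurable_prodMk_left).aestronglyMeasurable
  have key : ∫⁻ x, ‖(φ.normed μ ⋆[lsmul ℝ ℝ, μ] f) x - f x‖ₑ ^ q.toReal ∂μ ≤ C ^ q.toReal := by
    calc ∫⁻ x, ‖(φ.normed μ ⋆[lsmul ℝ ℝ, μ] f) x - f x‖ₑ ^ q.toReal ∂μ
        ≤ ∫⁻ x, ∫⁻ y, ‖f (x - y) - f x‖ₑ ^ q.toReal ∂P ∂μ := by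
          refine lintegral_mono fun x => ?_
          have := ENNReal.rpow_le_rpow (hpt x) hqr.le
          rwa [eLpNorm_eq_lintegral_rpow_enorm_toReal hq0 hq, ← ENNReal.rpow_mul,
            one_div, inv_mul_cancel₀ hqr.ne', ENNReal.rpow_one] at this
      _ = ∫⁻ y, ∫⁻ x, ‖f (x - y) - f x‖ₑ ^ q.toReal ∂μ ∂P := by
          rw [lintegral_lintegral_swap]
          exact (hjoint.enorm.pow_const _).aemeasurable
      _ ≤ ∫⁻ y, C ^ q.toReal ∂P := by
          refine lintegral_mono_ae ?_
          have hae : ∀ᵐ y ∂P, y ∈ Metric.ball (0 : G) φ.rOut := by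
            rw [hP, ae_withDensity_iff hmeasρ]
            refine Eventually.of_forall fun y hy => ?_
            rw [← φ.support_normed_eq (μ := μ)]
            intro h
            simp [h] at hy
          filter_upwards [hae] with y hy
          have := ENNReal.rpow_le_rpow (hC y hy) hqr.le
          rwa [eLpNorm_eq_lintegral_rpow_enorm_toReal hq0 hq, ← ENNReal.rpow_mul,
            one_div, inv_mul_cancel₀ hqr.ne', ENNReal.rpow_one] at this
      _ = C ^ q.toReal := by simp
  rw [eLpNorm_eq_lintegral_rpow_enorm_toReal hq0 hq]
  have := ENNReal.rpow_le_rpow key (one_div_nonneg.2 hqr.le)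
  rwa [← ENNReal.rpow_mul, mul_one_div_cancel hqr.ne', ENNReal.rpow_one] at this

/-- Mollifications converge in `L^q`. -/
theorem tendsto_eLpNorm_convolution_sub (μ : Measure G) [μ.IsAddHaarMeasure] {f : G → F}
    {q : ENNReal} (hq1 : 1 ≤ q) (hq : q ≠ ⊤) (hfq : MemLp f q μ)
    {φ : ℕ → ContDiffBump (0 : G)} (hφ : Tendsto (fun k => (φ k).rOut) atTop (𝓝 0)) :
    Tendsto (fun k => eLpNorm (fun x => ((φ k).normed μ ⋆[lsmul ℝ ℝ, μ] f) x - f x) q μ)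
      atTop (𝓝 0) := by
  have : ProperSpace G := FiniteDimensional.proper ℝ G
  -- The exchange of integrals needs joint measurability of `f(x - y)`, hence a strongly measurable
  -- version.
  obtain ⟨g, hg, hfg⟩ := hfq.1
  have hgq : MemLp g q μ := hfq.ae_eq hfg
  have hcongr : ∀ k, eLpNorm (fun x => ((φ k).normed μ ⋆[lsmul ℝ ℝ, μ] f) x - f x) q μ
      = eLpNorm (fun x => ((φ k).normed μ ⋆[lsmul ℝ ℝ, μ] g) x - g x) q μ := by
    intro k
    refine eLpNorm_congr_ae ?_
    have := convolution_congr (lsmul ℝ ℝ) (EventuallyEq.refl (ae μ) ((φ k).normed μ)) hfg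
    rw [this]
    filter_upwards [hfg] with x hx
    rw [hx]
  simp_rw [hcongr]
  rw [ENNReal.tendsto_nhds_zero]
  intro C hC
  have ht := (ENNReal.tendsto_nhds_zero.1 (tendsto_eLpNorm_sub_translate μ hq1 hq hgq)) C hC
  obtain ⟨r, hr, hrC⟩ := Metric.eventually_nhds_iff_ball.1 ht
  filter_upwards [hφ.eventually (gt_mem_nhds hr)] with k hk
  exact eLpNorm_convolution_sub_le μ hq1 hq hg hgq (φ k) C
    fun y hy => hrC y (Metric.ball_subset_ball hk.le hy)

end Mollification

end

/-! ### Convergence in `L^p`: subsequences, pairings and products. -/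

section

variable {n : ℕ}

/-- Convergence in `L^p` yields almost everywhere convergence of a subsequence. -/
theorem exists_subseq_tendsto_ae_of_eLpNorm {α F₁ : Type*} [MeasurableSpace α]
    {μ : Measure α} [NormedAddCommGroup F₁] {P : ENNReal} (hP : P ≠ 0) {f : ℕ → α → F₁}
    {f₀ : α → F₁} (hf : ∀ k, AEStronglyMeasurable (f k) μ) (hf₀ : AEStronglyMeasurable f₀ μ)
    (hlim : Tendsto (fun k => eLpNorm (fun x => f₀ x - f k x) P μ) atTop (𝓝 0)) :
    ∃ ns : ℕ → ℕ, StrictMono ns ∧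
      ∀ᵐ x ∂μ, Tendsto (fun k => f (ns k) x) atTop (𝓝 (f₀ x)) := by
  refine (tendstoInMeasure_of_tendsto_eLpNorm hP hf hf₀ ?_).exists_seq_tendsto_ae
  refine hlim.congr fun k => ?_
  rw [← eLpNorm_neg]
  congr 1
  ext x
  simp

section LpTools

variable {α F₁ F₂ F₃ : Type*} [MeasurableSpace α] {μ : Measure α}
  [NormedAddCommGroup F₁] [NormedSpace ℝ F₁] [NormedAddCommGroup F₂] [NormedSpace ℝ F₂]
  [NormedAddCommGroup F₃] [NormedSpace ℝ F₃]

theorem memLp_bilin {P Q : ENNReal} [P.HolderConjugate Q] (L : F₁ →L[ℝ] F₂ →L[ℝ] F₃)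
    {f : α → F₁} {h : α → F₂} (hf : MemLp f P μ) (hh : MemLp h Q μ) :
    Integrable (fun x => L (f x) (h x)) μ := by
  rw [← memLp_one_iff_integrable]
  exact MemLp.of_bilin (fun a b => L a b) ‖L‖₊ hf hh (L.aestronglyMeasurable_comp₂ hf.1 hh.1)
    (Eventually.of_forall fun x => L.le_opNorm₂ (f x) (h x))

/-- Pairing with a fixed element of `L^q` is continuous on `L^p`. -/
theorem tendsto_integral_bilin {ι : Type*} {l : Filter ι} {P Q : ENNReal} [P.HolderConjugate Q]
    (L : F₁ →L[ℝ] F₂ →L[ℝ] F₃) {f : ι → α → F₁} {f₀ : α → F₁} {h : α → F₂}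
    (hf : ∀ k, MemLp (f k) P μ) (hf₀ : MemLp f₀ P μ) (hh : MemLp h Q μ)
    (hlim : Tendsto (fun k => eLpNorm (fun x => f₀ x - f k x) P μ) l (𝓝 0)) :
    Tendsto (fun k => ∫ x, L (f k x) (h x) ∂μ) l (𝓝 (∫ x, L (f₀ x) (h x) ∂μ)) := by
  refine tendsto_integral_of_L1' _ (memLp_bilin L hf₀ hh).1
    (Eventually.of_forall fun k => memLp_bilin L (hf k) hh) ?_
  have hb : ∀ k, eLpNorm ((fun x => L (f k x) (h x)) - fun x => L (f₀ x) (h x)) 1 μ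
      ≤ ‖L‖₊ * eLpNorm (fun x => f₀ x - f k x) P μ * eLpNorm h Q μ := by
    intro k
    have h1 := eLpNorm_le_eLpNorm_mul_eLpNorm_of_nnnorm (p := P) (q := Q) (r := 1)
      (hf₀.1.sub (hf k).1) hh.1
      (fun a b => L a b) ‖L‖₊ (Eventually.of_forall fun x => L.le_opNorm₂ _ (h x))
    rw [← eLpNorm_neg]
    refine le_trans (le_of_eq (congrArg (fun g => eLpNorm g 1 μ) ?_)) h1
    ext x
    simp
  have h0 : Tendsto (fun k => ‖L‖₊ * eLpNorm (fun x => f₀ x - f k x) P μ * eLpNorm h Q μ) l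
      (𝓝 (‖L‖₊ * 0 * eLpNorm h Q μ)) :=
    ENNReal.Tendsto.mul_const (ENNReal.Tendsto.const_mul hlim (Or.inr ENNReal.coe_ne_top))
      (Or.inr hh.2.ne)
  rw [mul_zero, zero_mul] at h0
  exact tendsto_of_tendsto_of_tendsto_of_le_of_le tendsto_const_nhds h0 (fun _ => zero_le) hb

theorem tendsto_eLpNorm_smul_of_ae {P : ENNReal} (hP0 : P ≠ 0) (hP : P ≠ ⊤)
    {c : ℕ → α → ℝ} {g : α → F₁} {C : ℝ} (hc : ∀ k, AEStronglyMeasurable (c k) μ)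
    (hC : ∀ k x, |c k x| ≤ C) (hg : MemLp g P μ)
    (hlim : ∀ᵐ x ∂μ, Tendsto (fun k => c k x) atTop (𝓝 0)) :
    Tendsto (fun k => eLpNorm (fun x => c k x • g x) P μ) atTop (𝓝 0) := by
  have hr : 0 < P.toReal := ENNReal.toReal_pos hP0 hP
  have key : Tendsto (fun k => ∫⁻ x, ‖c k x • g x‖ₑ ^ P.toReal ∂μ) atTop
      (𝓝 (∫⁻ _, 0 ∂μ)) := by
    refine tendsto_lintegral_of_dominated_convergence' (fun x => ‖C • g x‖ₑ ^ P.toReal)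
      (fun k => (((hc k).smul hg.1).enorm.pow_const _)) (fun k => ?_) ?_ ?_
    · refine Eventually.of_forall fun x => ENNReal.rpow_le_rpow ?_ hr.le
      rw [enorm_smul, enorm_smul]
      gcongr
      rw [enorm_le_iff_norm_le, Real.norm_eq_abs, Real.norm_eq_abs]
      exact (hC k x).trans (le_abs_self C)
    · exact (lintegral_rpow_enorm_lt_top_of_eLpNorm_lt_top hP0 hP (hg.const_smul C).2).ne
    · filter_upwards [hlim] with x hx
      have h1 : Tendsto (fun k => ‖c k x • g x‖ₑ) atTop (𝓝 ‖(0 : ℝ) • g x‖ₑ) :=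
        (hx.smul_const (g x)).enorm
      rw [zero_smul, enorm_zero] at h1
      have := h1.ennrpow_const P.toReal
      rwa [ENNReal.zero_rpow_of_pos hr] at this
  rw [lintegral_zero] at key
  have h2 := key.ennrpow_const (1 / P.toReal)
  rw [ENNReal.zero_rpow_of_pos (by positivity)] at h2
  exact h2.congr fun k => (eLpNorm_eq_lintegral_rpow_enorm_toReal hP0 hP).symm

/-- If `f k → f` and `g k → g` in `L^p` and `f k → f` almost everywhere, then
`a(f k) g k → a(f) g` in `L^p` for every bounded continuous `a`. -/
theorem tendsto_eLpNorm_comp_smul {P : ENNReal} (hP1 : 1 ≤ P) (hP : P ≠ ⊤)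
    {f : ℕ → α → ℝ} {f₀ : α → ℝ} {g : ℕ → α → F₁} {g₀ : α → F₁} {a : ℝ → ℝ} {C : ℝ}
    (ha : Continuous a) (hC : ∀ z, |a z| ≤ C)
    (hf : ∀ k, AEStronglyMeasurable (f k) μ) (hf₀ : AEStronglyMeasurable f₀ μ)
    (hg : ∀ k, MemLp (g k) P μ) (hg₀ : MemLp g₀ P μ)
    (hae : ∀ᵐ x ∂μ, Tendsto (fun k => f k x) atTop (𝓝 (f₀ x)))
    (hlim : Tendsto (fun k => eLpNorm (fun x => g₀ x - g k x) P μ) atTop (𝓝 0)) :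
    Tendsto (fun k => eLpNorm (fun x => a (f₀ x) • g₀ x - a (f k x) • g k x) P μ) atTop (𝓝 0) := by
  have hC0 : 0 ≤ C := (abs_nonneg _).trans (hC 0)
  have h1 : Tendsto (fun k => eLpNorm (fun x => (a (f₀ x) - a (f k x)) • g₀ x) P μ)
      atTop (𝓝 0) := by
    refine tendsto_eLpNorm_smul_of_ae (zero_lt_one.trans_le hP1).ne' hP (C := C + C)
      (fun k => (ha.comp_aestronglyMeasurable hf₀).sub (ha.comp_aestronglyMeasurable (hf k)))
      (fun k x => (abs_sub _ _).trans (add_le_add (hC _) (hC _))) hg₀ ?_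
    filter_upwards [hae] with x hx
    have := (tendsto_const_nhds (x := a (f₀ x))).sub ((ha.tendsto _).comp hx)
    simpa using this
  have h2 : Tendsto (fun k => ENNReal.ofReal C * eLpNorm (fun x => g₀ x - g k x) P μ)
      atTop (𝓝 0) := by
    have := ENNReal.Tendsto.const_mul hlim (Or.inr (ENNReal.ofReal_ne_top (r := C)))
    rwa [mul_zero] at this
  have h3 := h1.add h2
  rw [add_zero] at h3
  refine tendsto_of_tendsto_of_tendsto_of_le_of_le tendsto_const_nhds h3 (fun _ => zero_le)
    fun k => ?_
  -- The first term tends to zero by dominated convergence, the second because `a` is bounded.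
  have e : (fun x => a (f₀ x) • g₀ x - a (f k x) • g k x)
      = (fun x => (a (f₀ x) - a (f k x)) • g₀ x) + fun x => a (f k x) • (g₀ x - g k x) := by
    ext x
    simp only [Pi.add_apply, sub_smul, smul_sub]
    abel
  have hak := ha.comp_aestronglyMeasurable (hf k)
  simp only [e]
  refine (eLpNorm_add_le ?_ ?_ hP1).trans (add_le_add le_rfl ?_)
  · exact ((ha.comp_aestronglyMeasurable hf₀).sub hak).smul hg₀.1
  · exact hak.smul (hg₀.1.sub (hg k).1)
  · refine eLpNorm_le_mul_eLpNorm_of_ae_le_mul (Eventually.of_forall fun x => ?_) P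
    rw [norm_smul]
    exact mul_le_mul_of_nonneg_right (hC _) (norm_nonneg _)

end LpTools

/-! ### Gradients, test functions and cutoffs. -/

section Gradient

variable {F : Type*} [NormedAddCommGroup F] [InnerProductSpace ℝ F] [CompleteSpace F]

theorem gradient_mul {f g : F → ℝ} {x : F} (hf : DifferentiableAt ℝ f x)
    (hg : DifferentiableAt ℝ g x) :
    gradient (fun y => f y * g y) x = f x • gradient g x + g x • gradient f x := by
  simp only [gradient, fderiv_fun_mul hf hg, map_add, map_smul]

theorem gradient_sub {f g : F → ℝ} {x : F} (hf : DifferentiableAt ℝ f x)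
    (hg : DifferentiableAt ℝ g x) :
    gradient (fun y => f y - g y) x = gradient f x - gradient g x := by
  simp only [gradient, fderiv_fun_sub hf hg, map_sub]

theorem gradient_comp {H : ℝ → ℝ} {f : F → ℝ} {x : F} (hH : DifferentiableAt ℝ H (f x))
    (hf : DifferentiableAt ℝ f x) :
    gradient (fun y => H (f y)) x = deriv H (f x) • gradient f x := by
  have h := hH.hasDerivAt.comp_hasFDerivAt x hf.hasFDerivAt
  have h' : fderiv ℝ (fun y => H (f y)) x = deriv H (f x) • fderiv ℝ f x := h.fderiv
  simp only [gradient, h', map_smul]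

theorem continuous_gradient {f : F → ℝ} (hf : ContDiff ℝ ∞ f) : Continuous (gradient f) :=
  ((InnerProductSpace.toDual ℝ F).symm.continuous).comp (hf.continuous_fderiv (by simp))

theorem hasCompactSupport_gradient {f : F → ℝ} (hf : HasCompactSupport f) :
    HasCompactSupport (gradient f) :=
  (hf.fderiv ℝ).comp_left (map_zero _)

theorem tsupport_gradient_subset (f : F → ℝ) : tsupport (gradient f) ⊆ tsupport f := by
  refine (closure_mono ?_).trans (tsupport_fderiv_subset ℝ (f := f))
  intro x hx h
  exact hx (by simp [gradient, h])

theorem gradient_eq_zero_of_notMem_tsupport {f : F → ℝ} {x : F} (hx : x ∉ tsupport f) :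
    gradient f x = 0 :=
  image_eq_zero_of_notMem_tsupport fun h => hx (tsupport_gradient_subset f h)

end Gradient

section TestFunction

variable {F : Type*} [NormedAddCommGroup F] [NormedSpace ℝ F] {U : Set F} {φ ψ : F → ℝ}

theorem IsTestFunction.differentiableAt (hφ : IsTestFunction U φ) (x : F) :
    DifferentiableAt ℝ φ x :=
  (hφ.contDiff.differentiable (by simp)) x

theorem IsTestFunction.add (hφ : IsTestFunction U φ) (hψ : IsTestFunction U ψ) :
    IsTestFunction U fun x => φ x + ψ x :=
  ⟨hφ.contDiff.add hψ.contDiff, hφ.hasCompactSupport.add hψ.hasCompactSupport,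
    (tsupport_add φ ψ).trans (union_subset hφ.tsupport_subset hψ.tsupport_subset)⟩

theorem IsTestFunction.neg (hφ : IsTestFunction U φ) : IsTestFunction U fun x => -φ x :=
  ⟨hφ.contDiff.neg, hφ.hasCompactSupport.neg, by
    have : tsupport (fun x => -φ x) = tsupport φ := by
      simp [tsupport, Function.support_fun_neg]
    rw [this]; exact hφ.tsupport_subset⟩

theorem IsTestFunction.sub (hφ : IsTestFunction U φ) (hψ : IsTestFunction U ψ) :
    IsTestFunction U fun x => φ x - ψ x := by
  simpa only [sub_eq_add_neg] using hφ.add hψ.neg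

theorem IsTestFunction.mul_left (hφ : IsTestFunction U φ) {a : F → ℝ} (ha : ContDiff ℝ ∞ a) :
    IsTestFunction U fun x => a x * φ x :=
  ⟨ha.mul hφ.contDiff, hφ.hasCompactSupport.mul_left,
    (tsupport_mul_subset_right).trans hφ.tsupport_subset⟩

theorem IsTestFunction.comp_left (hφ : IsTestFunction U φ) {H : ℝ → ℝ} (hH : ContDiff ℝ ∞ H)
    (hH0 : H 0 = 0) : IsTestFunction U fun x => H (φ x) :=
  ⟨hH.comp hφ.contDiff, hφ.hasCompactSupport.comp_left hH0,
    (closure_mono (Function.support_comp_subset hH0 φ)).trans hφ.tsupport_subset⟩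

/-- The cutoff equals one on a neighbourhood of each point of `K`, not only on `K`, so that its
gradient vanishes on `K` as well. -/
theorem exists_cutoff {F : Type*} [NormedAddCommGroup F] [NormedSpace ℝ F] [FiniteDimensional ℝ F]
    {K U : Set F} (hK : IsCompact K) (hU : IsOpen U) (hKU : K ⊆ U) :
    ∃ θ : F → ℝ, IsTestFunction U θ ∧ (∀ x ∈ K, ∀ᶠ y in 𝓝 x, θ y = 1) ∧ (∀ x, 0 ≤ θ x) := by
  have : ProperSpace F := FiniteDimensional.proper ℝ F
  obtain ⟨L, hL, hKL, hLU⟩ := exists_compact_between hK hU hKU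
  obtain ⟨f, h1, h0, hf⟩ := exists_contMDiffMap_one_nhds_of_subset_interior (n := ⊤)
    (modelWithCornersSelf ℝ F) hK.isClosed hKL
  have hts : tsupport f ⊆ L := closure_minimal
    (fun x hx => by_contra fun h => hx (h0 x h)) hL.isClosed
  refine ⟨f, ⟨f.contMDiff.contDiff, hL.of_isClosed_subset (isClosed_tsupport _) hts,
    hts.trans hLU⟩, fun x hx => ?_, fun x => (hf x).1⟩
  exact (eventually_nhdsSet_iff_forall.1 h1) x hx

end TestFunction

end

/-! ### The spaces `W^{1,p}(Ω)` and `W_0^{1,p}(Ω)`. -/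

section

variable {n : ℕ} {Ω : Set (EuclideanSpace ℝ (Fin n))} {p : ℝ}
  {f f₁ f₂ φ ψ : EuclideanSpace ℝ (Fin n) → ℝ}
  {g g₁ g₂ : EuclideanSpace ℝ (Fin n) → EuclideanSpace ℝ (Fin n)}

theorem holderConjugate_ofReal (hp : 1 < p) :
    (ENNReal.ofReal p).HolderConjugate (ENNReal.ofReal (p / (p - 1))) :=
  (Real.HolderConjugate.conjExponent hp).ennrealOfReal

theorem one_le_ofReal (hp : 1 < p) : 1 ≤ ENNReal.ofReal p :=
  ENNReal.one_le_ofReal.2 hp.le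

theorem IsTestFunction.memLp (hφ : IsTestFunction Ω φ) (P : ENNReal) :
    MemLp φ P (volume.restrict Ω) :=
  (hφ.contDiff.continuous.memLp_of_hasCompactSupport hφ.hasCompactSupport).restrict Ω

theorem IsTestFunction.memLp_gradient (hφ : IsTestFunction Ω φ) (P : ENNReal) :
    MemLp (gradient φ) P (volume.restrict Ω) :=
  ((continuous_gradient hφ.contDiff).memLp_of_hasCompactSupport
    (hasCompactSupport_gradient hφ.hasCompactSupport)).restrict Ω

theorem IsTestFunction.eq_zero_of_notMem (hφ : IsTestFunction Ω φ)
    {x : EuclideanSpace ℝ (Fin n)} (hx : x ∉ Ω) : φ x = 0 :=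
  image_eq_zero_of_notMem_tsupport fun h => hx (hφ.tsupport_subset h)

theorem IsTestFunction.gradient_eq_zero_of_notMem (hφ : IsTestFunction Ω φ)
    {x : EuclideanSpace ℝ (Fin n)} (hx : x ∉ Ω) : gradient φ x = 0 :=
  gradient_eq_zero_of_notMem_tsupport fun h => hx (hφ.tsupport_subset h)

theorem IsTestFunction.hasSobolevGradient (hφ : IsTestFunction Ω φ) :
    HasSobolevGradient Ω p φ (gradient φ) where
  memLp := hφ.memLp _
  memLp_gradient := hφ.memLp_gradient _
  integral_eq ψ hψ := by
    rw [setIntegral_eq_integral_of_forall_compl_eq_zero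
        (fun x hx => by rw [hφ.eq_zero_of_notMem hx, zero_smul]),
      setIntegral_eq_integral_of_forall_compl_eq_zero
        (fun x hx => by rw [hψ.eq_zero_of_notMem hx, zero_smul])]
    have hgφ := continuous_gradient hφ.contDiff
    have hgψ := continuous_gradient hψ.contDiff
    have i1 : Integrable (fun x => φ x • gradient ψ x) :=
      (hφ.contDiff.continuous.smul hgψ).integrable_of_hasCompactSupport
        hφ.hasCompactSupport.smul_right
    have i2 : Integrable (fun x => ψ x • gradient φ x) :=
      (hψ.contDiff.continuous.smul hgφ).integrable_of_hasCompactSupport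
        hψ.hasCompactSupport.smul_right
    refine ext_inner_left ℝ fun v => ?_
    rw [inner_neg_right, ← integral_inner i1, ← integral_inner i2]
    have e1 : ∀ x, inner ℝ v (φ x • gradient ψ x) = φ x * fderiv ℝ ψ x v := fun x => by
      rw [inner_smul_right, real_inner_comm, inner_gradient_left]
    have e2 : ∀ x, inner ℝ v (ψ x • gradient φ x) = fderiv ℝ φ x v * ψ x := fun x => by
      rw [inner_smul_right, real_inner_comm, inner_gradient_left, mul_comm]
    simp_rw [e1, e2]
    refine integral_mul_fderiv_eq_neg_fderiv_mul_of_integrable ?_ ?_ ?_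
      (fun x _ => hφ.differentiableAt x) (fun x _ => hψ.differentiableAt x)
    · exact (i2.const_inner v).congr (Eventually.of_forall e2)
    · exact (i1.const_inner v).congr (Eventually.of_forall e1)
    · exact (hφ.contDiff.continuous.mul hψ.contDiff.continuous).integrable_of_hasCompactSupport
        hφ.hasCompactSupport.mul_right

theorem IsTestFunction.hasSobolevGradientZero (hφ : IsTestFunction Ω φ) :
    HasSobolevGradientZero Ω p φ (gradient φ) := by
  refine ⟨hφ.hasSobolevGradient, fun _ => φ, fun _ => hφ, ?_, ?_⟩ <;> simp

theorem HasSobolevGradient.congr_ae (h : HasSobolevGradient Ω p f₁ g₁)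
    (hf : f₁ =ᵐ[volume.restrict Ω] f₂) (hg : g₁ =ᵐ[volume.restrict Ω] g₂) :
    HasSobolevGradient Ω p f₂ g₂ where
  memLp := h.memLp.ae_eq hf
  memLp_gradient := h.memLp_gradient.ae_eq hg
  integral_eq φ hφ := by
    have := h.integral_eq φ hφ
    have e1 : ∫ x in Ω, f₁ x • gradient φ x = ∫ x in Ω, f₂ x • gradient φ x :=
      integral_congr_ae (hf.mono fun x hx => by simp only [hx])
    have e2 : ∫ x in Ω, φ x • g₁ x = ∫ x in Ω, φ x • g₂ x :=
      integral_congr_ae (hg.mono fun x hx => by simp only [hx])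
    rw [← e1, this, e2]

theorem HasSobolevGradientZero.congr_ae (h : HasSobolevGradientZero Ω p f₁ g₁)
    (hf : f₁ =ᵐ[volume.restrict Ω] f₂) (hg : g₁ =ᵐ[volume.restrict Ω] g₂) :
    HasSobolevGradientZero Ω p f₂ g₂ := by
  obtain ⟨φ, h1, h2, h3⟩ := h.exists_approx
  refine ⟨h.toHasSobolevGradient.congr_ae hf hg, φ, h1, h2.congr fun k => ?_, h3.congr fun k => ?_⟩
  · exact eLpNorm_congr_ae (hf.mono fun x hx => by simp only [hx])
  · exact eLpNorm_congr_ae (hg.mono fun x hx => by simp only [hx])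

theorem HasSobolevGradient.integrable_smul_gradient (hp : 1 < p)
    (h : HasSobolevGradient Ω p f g) (hφ : IsTestFunction Ω φ) :
    Integrable (fun x => f x • gradient φ x) (volume.restrict Ω) := by
  have := holderConjugate_ofReal hp
  exact memLp_bilin (ContinuousLinearMap.lsmul ℝ ℝ) h.memLp
    (hφ.memLp_gradient (ENNReal.ofReal (p / (p - 1))))

theorem HasSobolevGradient.integrable_test_smul (hp : 1 < p)
    (h : HasSobolevGradient Ω p f g) (hφ : IsTestFunction Ω φ) :
    Integrable (fun x => φ x • g x) (volume.restrict Ω) := by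
  have := holderConjugate_ofReal hp
  exact memLp_bilin (ContinuousLinearMap.lsmul ℝ ℝ).flip h.memLp_gradient
    (hφ.memLp (ENNReal.ofReal (p / (p - 1))))

theorem HasSobolevGradient.sub (hp : 1 < p) (h₁ : HasSobolevGradient Ω p f₁ g₁)
    (h₂ : HasSobolevGradient Ω p f₂ g₂) :
    HasSobolevGradient Ω p (fun x => f₁ x - f₂ x) (fun x => g₁ x - g₂ x) where
  memLp := h₁.memLp.sub h₂.memLp
  memLp_gradient := h₁.memLp_gradient.sub h₂.memLp_gradient
  integral_eq φ hφ := by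
    simp_rw [sub_smul, smul_sub]
    rw [integral_sub (h₁.integrable_smul_gradient hp hφ) (h₂.integrable_smul_gradient hp hφ),
      integral_sub (h₁.integrable_test_smul hp hφ) (h₂.integrable_test_smul hp hφ),
      h₁.integral_eq φ hφ, h₂.integral_eq φ hφ]
    abel

theorem tendsto_eLpNorm_sub_sub {α F₁ : Type*} [MeasurableSpace α] {μ : Measure α}
    [NormedAddCommGroup F₁] {P : ENNReal} (hP : 1 ≤ P) {a b : α → F₁} {u v : ℕ → α → F₁}
    (hu : ∀ k, AEStronglyMeasurable (fun x => a x - u k x) μ)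
    (hv : ∀ k, AEStronglyMeasurable (fun x => b x - v k x) μ)
    (h₁ : Tendsto (fun k => eLpNorm (fun x => a x - u k x) P μ) atTop (𝓝 0))
    (h₂ : Tendsto (fun k => eLpNorm (fun x => b x - v k x) P μ) atTop (𝓝 0)) :
    Tendsto (fun k => eLpNorm (fun x => (a x - b x) - (u k x - v k x)) P μ) atTop (𝓝 0) := by
  have h3 := h₁.add h₂
  rw [add_zero] at h3
  refine tendsto_of_tendsto_of_tendsto_of_le_of_le tendsto_const_nhds h3 (fun _ => zero_le)
    fun k => ?_
  have e : (fun x => (a x - b x) - (u k x - v k x))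
      = (fun x => a x - u k x) - fun x => b x - v k x := by
    ext x; simp only [Pi.sub_apply]; abel
  simp only [e]
  exact eLpNorm_sub_le (hu k) (hv k) hP

theorem HasSobolevGradientZero.sub (hp : 1 < p) (h₁ : HasSobolevGradientZero Ω p f₁ g₁)
    (h₂ : HasSobolevGradientZero Ω p f₂ g₂) :
    HasSobolevGradientZero Ω p (fun x => f₁ x - f₂ x) (fun x => g₁ x - g₂ x) := by
  obtain ⟨φ, a1, a2, a3⟩ := h₁.exists_approx
  obtain ⟨ψ, b1, b2, b3⟩ := h₂.exists_approx
  refine ⟨h₁.toHasSobolevGradient.sub hp h₂.toHasSobolevGradient,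
    fun k x => φ k x - ψ k x, fun k => (a1 k).sub (b1 k), ?_, ?_⟩
  · exact tendsto_eLpNorm_sub_sub (one_le_ofReal hp)
      (fun k => (h₁.memLp.sub ((a1 k).memLp _)).1) (fun k => (h₂.memLp.sub ((b1 k).memLp _)).1)
      a2 b2
  · have := tendsto_eLpNorm_sub_sub (one_le_ofReal hp)
      (fun k => (h₁.memLp_gradient.sub ((a1 k).memLp_gradient _)).1)
      (fun k => (h₂.memLp_gradient.sub ((b1 k).memLp_gradient _)).1) a3 b3
    refine this.congr fun k => ?_
    congr 1
    ext1 x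
    rw [gradient_sub ((a1 k).differentiableAt x) ((b1 k).differentiableAt x)]

/-- Limits of test functions in the Sobolev norm. -/
theorem HasSobolevGradientZero.of_tendsto_test (hp : 1 < p)
    (hf : MemLp f (ENNReal.ofReal p) (volume.restrict Ω))
    (hg : MemLp g (ENNReal.ofReal p) (volume.restrict Ω))
    {φ : ℕ → EuclideanSpace ℝ (Fin n) → ℝ} (hφ : ∀ k, IsTestFunction Ω (φ k))
    (h₁ : Tendsto (fun k => eLpNorm (fun x => f x - φ k x) (ENNReal.ofReal p)
      (volume.restrict Ω)) atTop (𝓝 0))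
    (h₂ : Tendsto (fun k => eLpNorm (fun x => g x - gradient (φ k) x) (ENNReal.ofReal p)
      (volume.restrict Ω)) atTop (𝓝 0)) :
    HasSobolevGradientZero Ω p f g := by
  refine ⟨⟨hf, hg, fun ψ hψ => ?_⟩, φ, hφ, h₁, h₂⟩
  have := holderConjugate_ofReal hp
  have t1 := tendsto_integral_bilin (ContinuousLinearMap.lsmul ℝ ℝ) (fun k => (hφ k).memLp _) hf
    (hψ.memLp_gradient (ENNReal.ofReal (p / (p - 1)))) h₁
  have t2 := tendsto_integral_bilin (ContinuousLinearMap.lsmul ℝ ℝ).flip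
    (fun k => (hφ k).memLp_gradient _) hg (hψ.memLp (ENNReal.ofReal (p / (p - 1)))) h₂
  refine tendsto_nhds_unique t1 (t2.neg.congr fun k => ?_)
  exact ((hφ k).hasSobolevGradient (p := p).integral_eq ψ hψ).symm

/-- `W_0^{1,p}` is closed. -/
theorem HasSobolevGradientZero.of_tendsto (hp : 1 < p)
    (hf : MemLp f (ENNReal.ofReal p) (volume.restrict Ω))
    (hg : MemLp g (ENNReal.ofReal p) (volume.restrict Ω))
    {F : ℕ → EuclideanSpace ℝ (Fin n) → ℝ}
    {G : ℕ → EuclideanSpace ℝ (Fin n) → EuclideanSpace ℝ (Fin n)}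
    (hF : ∀ k, HasSobolevGradientZero Ω p (F k) (G k))
    (h₁ : Tendsto (fun k => eLpNorm (fun x => f x - F k x) (ENNReal.ofReal p)
      (volume.restrict Ω)) atTop (𝓝 0))
    (h₂ : Tendsto (fun k => eLpNorm (fun x => g x - G k x) (ENNReal.ofReal p)
      (volume.restrict Ω)) atTop (𝓝 0)) :
    HasSobolevGradientZero Ω p f g := by
  -- Diagonal choice: a test function within `1/(k+1)` of the `k`-th term, both in value and in
  -- gradient.
  have hex : ∀ k : ℕ, ∃ φ, IsTestFunction Ω φ ∧
      eLpNorm (fun x => F k x - φ x) (ENNReal.ofReal p) (volume.restrict Ω)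
        ≤ ((k : ENNReal) + 1)⁻¹ ∧
      eLpNorm (fun x => G k x - gradient φ x) (ENNReal.ofReal p) (volume.restrict Ω)
        ≤ ((k : ENNReal) + 1)⁻¹ := by
    intro k
    obtain ⟨φ, a1, a2, a3⟩ := (hF k).exists_approx
    have hpos : (0 : ENNReal) < ((k : ENNReal) + 1)⁻¹ :=
      ENNReal.inv_pos.2 (by finiteness)
    obtain ⟨j, hj1, hj2⟩ := ((ENNReal.tendsto_nhds_zero.1 a2 _ hpos).and
      (ENNReal.tendsto_nhds_zero.1 a3 _ hpos)).exists
    exact ⟨φ j, a1 j, hj1, hj2⟩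
  choose φ hφ hφ1 hφ2 using hex
  have hinv : Tendsto (fun k : ℕ => ((k : ENNReal) + 1)⁻¹) atTop (𝓝 0) := by
    have := ENNReal.tendsto_inv_nat_nhds_zero.comp (tendsto_add_atTop_nat 1)
    refine this.congr fun k => ?_
    simp
  refine HasSobolevGradientZero.of_tendsto_test hp hf hg hφ ?_ ?_
  · have h3 := h₁.add hinv
    rw [add_zero] at h3
    refine tendsto_of_tendsto_of_tendsto_of_le_of_le tendsto_const_nhds h3 (fun _ => zero_le)
      fun k => ?_
    have e : (fun x => f x - φ k x) = (fun x => f x - F k x) + fun x => F k x - φ k x := by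
      ext x; simp
    simp only [e]
    exact (eLpNorm_add_le (hf.sub (hF k).memLp).1 ((hF k).memLp.sub ((hφ k).memLp _)).1
      (one_le_ofReal hp)).trans (add_le_add le_rfl (hφ1 k))
  · have h3 := h₂.add hinv
    rw [add_zero] at h3
    refine tendsto_of_tendsto_of_tendsto_of_le_of_le tendsto_const_nhds h3 (fun _ => zero_le)
      fun k => ?_
    have e : (fun x => g x - gradient (φ k) x)
        = (fun x => g x - G k x) + fun x => G k x - gradient (φ k) x := by
      ext x; simp
    simp only [e]
    exact (eLpNorm_add_le (hg.sub (hF k).memLp_gradient).1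
      ((hF k).memLp_gradient.sub ((hφ k).memLp_gradient _)).1
      (one_le_ofReal hp)).trans (add_le_add le_rfl (hφ2 k))

/-- Weak gradients are unique. -/
theorem HasSobolevGradient.ae_unique (hΩ : IsOpen Ω) (hp : 1 < p)
    (h₁ : HasSobolevGradient Ω p f g₁) (h₂ : HasSobolevGradient Ω p f g₂) :
    g₁ =ᵐ[volume.restrict Ω] g₂ := by
  have hd : MemLp (g₁ - g₂) (ENNReal.ofReal p) (volume.restrict Ω) :=
    h₁.memLp_gradient.sub h₂.memLp_gradient
  have hind : MemLp (Ω.indicator (g₁ - g₂)) (ENNReal.ofReal p) volume :=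
    (memLp_indicator_iff_restrict hΩ.measurableSet).2 hd
  have hloc : LocallyIntegrable (Ω.indicator (g₁ - g₂)) volume :=
    hind.locallyIntegrable (one_le_ofReal hp)
  have := hΩ.ae_eq_zero_of_integral_contDiff_smul_eq_zero (hloc.locallyIntegrableOn Ω)
    fun φ hφ1 hφ2 hφ3 => by
      have hφ : IsTestFunction Ω φ := ⟨hφ1, hφ2, hφ3⟩
      rw [← setIntegral_eq_integral_of_forall_compl_eq_zero (s := Ω)
        (fun x hx => by rw [hφ.eq_zero_of_notMem hx, zero_smul])]
      have e : ∫ x in Ω, φ x • Ω.indicator (g₁ - g₂) x = ∫ x in Ω, (φ x • g₁ x - φ x • g₂ x) :=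
        setIntegral_congr_fun hΩ.measurableSet fun x hx => by
          simp only [indicator_of_mem hx, Pi.sub_apply, smul_sub]
      rw [e, integral_sub (h₁.integrable_test_smul hp hφ) (h₂.integrable_test_smul hp hφ),
        sub_eq_zero]
      exact neg_injective ((h₁.integral_eq φ hφ).symm.trans (h₂.integral_eq φ hφ))
  filter_upwards [ae_restrict_of_ae this, ae_restrict_mem hΩ.measurableSet] with x h hx
  have := h hx
  rwa [indicator_of_mem hx, Pi.sub_apply, sub_eq_zero] at this

/-- Product of a Sobolev function with a test function. -/
theorem HasSobolevGradient.test_mul (hp : 1 < p) (hφ : IsTestFunction Ω φ)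
    (h : HasSobolevGradient Ω p f g) :
    HasSobolevGradient Ω p (fun x => φ x * f x) (fun x => φ x • g x + f x • gradient φ x) := by
  obtain ⟨C, hC⟩ := hφ.hasCompactSupport.exists_bound_of_continuous hφ.contDiff.continuous
  obtain ⟨D, hD⟩ := (hasCompactSupport_gradient hφ.hasCompactSupport).exists_bound_of_continuous
    (continuous_gradient hφ.contDiff)
  have m1 : MemLp (fun x => φ x • g x) (ENNReal.ofReal p) (volume.restrict Ω) :=
    h.memLp_gradient.of_le_mul (c := C)
      (hφ.contDiff.continuous.aestronglyMeasurable.smul h.memLp_gradient.1)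
      (Eventually.of_forall fun x => by
        rw [norm_smul]; exact mul_le_mul_of_nonneg_right (hC x) (norm_nonneg _))
  have m2 : MemLp (fun x => f x • gradient φ x) (ENNReal.ofReal p) (volume.restrict Ω) :=
    h.memLp.of_le_mul (c := D)
      (h.memLp.1.smul (continuous_gradient hφ.contDiff).aestronglyMeasurable)
      (Eventually.of_forall fun x => by
        rw [norm_smul, mul_comm]; exact mul_le_mul_of_nonneg_right (hD x) (norm_nonneg _))
  have m0 : MemLp (fun x => φ x * f x) (ENNReal.ofReal p) (volume.restrict Ω) :=
    h.memLp.of_le_mul (c := C)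
      (hφ.contDiff.continuous.aestronglyMeasurable.mul h.memLp.1)
      (Eventually.of_forall fun x => by
        rw [norm_mul]; exact mul_le_mul_of_nonneg_right (hC x) (norm_nonneg _))
  refine ⟨m0, m1.add m2, fun ψ hψ => ?_⟩
  have hprod : IsTestFunction Ω (fun x => φ x * ψ x) := hψ.mul_left hφ.contDiff
  have e1 : ∀ x, (φ x * f x) • gradient ψ x
      = f x • gradient (fun y => φ y * ψ y) x - ψ x • (f x • gradient φ x) := by
    intro x
    rw [gradient_mul (hφ.differentiableAt x) (hψ.differentiableAt x), smul_add, smul_smul,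
      smul_smul, smul_smul, mul_comm (f x) (φ x), mul_comm (f x) (ψ x), add_sub_cancel_right]
  have := holderConjugate_ofReal hp
  have i1 : Integrable (fun x => ψ x • (f x • gradient φ x)) (volume.restrict Ω) :=
    memLp_bilin (ContinuousLinearMap.lsmul ℝ ℝ).flip m2
      (hψ.memLp (ENNReal.ofReal (p / (p - 1))))
  have i2 : Integrable (fun x => ψ x • (φ x • g x)) (volume.restrict Ω) :=
    memLp_bilin (ContinuousLinearMap.lsmul ℝ ℝ).flip m1
      (hψ.memLp (ENNReal.ofReal (p / (p - 1))))
  simp_rw [e1, smul_add]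
  rw [integral_sub (h.integrable_smul_gradient hp hprod) i1, integral_add i2 i1,
    h.integral_eq _ hprod]
  have e2 : ∀ x, (φ x * ψ x) • g x = ψ x • (φ x • g x) := fun x => by
    rw [smul_smul, mul_comm]
  simp_rw [e2]
  abel

end

/-! ### Compactly supported Sobolev functions and the chain rule in `W_0^{1,p}(Ω)`. -/

section

variable {n : ℕ} {Ω : Set (EuclideanSpace ℝ (Fin n))} {p : ℝ}
  {f f₁ f₂ φ ψ : EuclideanSpace ℝ (Fin n) → ℝ}
  {g g₁ g₂ : EuclideanSpace ℝ (Fin n) → EuclideanSpace ℝ (Fin n)}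

section Mollify

open Convolution ContinuousLinearMap

/-- The weak gradient is tested with `y ↦ ρ(x - y)`, whose support may leave `Ω`. Multiplying by a
cutoff equal to one near `K` makes it a test function and changes nothing, because `f` and `g`
vanish off `K`. The sign from differentiating in `y` cancels the sign in the definition of the weak
gradient. -/
theorem gradient_convolution_eq (hΩ : IsOpen Ω) (hp : 1 < p) (h : HasSobolevGradient Ω p f g)
    {K : Set (EuclideanSpace ℝ (Fin n))} (hK : IsCompact K) (hKΩ : K ⊆ Ω)
    (hf : ∀ x ∉ K, f x = 0) (hg : ∀ x ∉ K, g x = 0) (hloc : LocallyIntegrable f volume)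
    {ρ : EuclideanSpace ℝ (Fin n) → ℝ} (hρ : ContDiff ℝ ∞ ρ) (hρc : HasCompactSupport ρ)
    (x : EuclideanSpace ℝ (Fin n)) :
    gradient (ρ ⋆[lsmul ℝ ℝ, volume] f) x = (ρ ⋆[lsmul ℝ ℝ, volume] g) x := by
  have hD := hρc.hasFDerivAt_convolution_left (lsmul ℝ ℝ) (hρ.of_le (by simp)) hloc x
  obtain ⟨θ, hθ, hθ1, -⟩ := exists_cutoff hK hΩ hKΩ
  have hρx : ContDiff ℝ ∞ (fun y => ρ (x - y)) := hρ.comp (contDiff_const.sub contDiff_id)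
  have hψ : IsTestFunction Ω (fun y => ρ (x - y) * θ y) := hθ.mul_left hρx
  have hgrad : ∀ y ∈ K, gradient (fun y => ρ (x - y) * θ y) y = - gradient ρ (x - y) := by
    intro y hy
    have e1 : (fun y => ρ (x - y) * θ y) =ᶠ[𝓝 y] fun y => ρ (x - y) := by
      filter_upwards [hθ1 y hy] with z hz
      rw [hz, mul_one]
    rw [e1.gradient_eq]
    have hd : HasFDerivAt (fun y => ρ (x - y)) (-(fderiv ℝ ρ (x - y))) y := by
      have h1 := ((hρ.differentiable (by simp)) (x - y)).hasFDerivAt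
      have h2 := h1.comp y ((hasFDerivAt_id y).const_sub x)
      refine h2.congr_fderiv ?_
      ext v; simp
    simp only [gradient, hd.fderiv, map_neg]
  have heq := h.integral_eq _ hψ
  have hexg : Integrable (fun y => (ρ (x - y) * θ y) • g y) (volume.restrict Ω) :=
    h.integrable_test_smul hp hψ
  rw [convolution_lsmul_swap]
  have e2 : ∫ y, ρ (x - y) • g y = ∫ y in Ω, (ρ (x - y) * θ y) • g y := by
    rw [setIntegral_eq_integral_of_forall_compl_eq_zero
      (fun y hy => by rw [hg y (fun h => hy (hKΩ h)), smul_zero])]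
    refine integral_congr_ae (Eventually.of_forall fun y => ?_)
    by_cases hy : y ∈ K
    · simp only [(hθ1 y hy).self_of_nhds, mul_one]
    · simp only [hg y hy, smul_zero]
  have e3 : ∫ y in Ω, f y • gradient (fun y => ρ (x - y) * θ y) y
      = - ∫ y, f y • gradient ρ (x - y) := by
    rw [setIntegral_eq_integral_of_forall_compl_eq_zero
      (fun y hy => by rw [hf y (fun h => hy (hKΩ h)), zero_smul]), ← integral_neg]
    refine integral_congr_ae (Eventually.of_forall fun y => ?_)
    by_cases hy : y ∈ K
    · simp only [hgrad y hy, smul_neg]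
    · simp only [hf y hy, zero_smul, neg_zero]
  rw [e2, ← neg_eq_iff_eq_neg.2 heq, e3, neg_neg]
  refine ext_inner_right ℝ fun v => ?_
  rw [inner_gradient_left, hD.fderiv]
  have hgi : Integrable (fun y => f y • gradient ρ (x - y)) := by
    have hc : HasCompactSupport (fun y => gradient ρ (x - y)) :=
      (hasCompactSupport_gradient hρc).comp_homeomorph (Homeomorph.subLeft x)
    exact hloc.integrable_smul_right_of_hasCompactSupport
      ((continuous_gradient hρ).comp (continuous_const.sub continuous_id)) hc
  have e4 : inner ℝ (∫ y, f y • gradient ρ (x - y)) v = ∫ y, f y * fderiv ℝ ρ (x - y) v := by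
    rw [real_inner_comm, ← integral_inner hgi]
    refine integral_congr_ae (Eventually.of_forall fun y => ?_)
    simp only [inner_smul_right]
    rw [real_inner_comm, inner_gradient_left]
  rw [e4, convolution_eq_swap]
  have hci : Integrable (fun t => ((lsmul ℝ ℝ).precompL (EuclideanSpace ℝ (Fin n)))
      (fderiv ℝ ρ (x - t)) (f t)) := by
    have hex := (hρc.fderiv ℝ).convolutionExists_left
      ((lsmul ℝ ℝ).precompL (EuclideanSpace ℝ (Fin n)) : _ →L[ℝ] ℝ →L[ℝ] _)
      (hρ.continuous_fderiv (by simp)) hloc x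
    exact hex.integrable_swap
  rw [ContinuousLinearMap.integral_apply hci]
  refine integral_congr_ae (Eventually.of_forall fun y => ?_)
  simp [mul_comm]

/-- A Sobolev function with compact support in `Ω` belongs to `W_0^{1,p}(Ω)`. -/
theorem HasSobolevGradient.zero_of_compact (hΩ : IsOpen Ω) (hp : 1 < p)
    (h : HasSobolevGradient Ω p f g) {K : Set (EuclideanSpace ℝ (Fin n))} (hK : IsCompact K)
    (hKΩ : K ⊆ Ω) (hf : ∀ x ∉ K, f x = 0) (hg : ∀ x ∉ K, g x = 0) :
    HasSobolevGradientZero Ω p f g := by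
  have hfE : MemLp f (ENNReal.ofReal p) volume := by
    have := (memLp_indicator_iff_restrict hΩ.measurableSet).2 h.memLp
    rwa [indicator_eq_self.2 (Function.support_subset_iff'.2
      fun x hx => hf x fun h => hx (hKΩ h))] at this
  have hgE : MemLp g (ENNReal.ofReal p) volume := by
    have := (memLp_indicator_iff_restrict hΩ.measurableSet).2 h.memLp_gradient
    rwa [indicator_eq_self.2 (Function.support_subset_iff'.2
      fun x hx => hg x fun h => hx (hKΩ h))] at this
  have hloc : LocallyIntegrable f volume := hfE.locallyIntegrable (one_le_ofReal hp)
  -- Mollifying at radius at most `δ` keeps the supports inside the closed `δ`-thickening of `K`, a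
  -- compact subset of `Ω`.
  obtain ⟨δ, hδ, hδΩ⟩ := hK.exists_cthickening_subset_open hΩ hKΩ
  let r : ℕ → ℝ := fun k => δ / (k + 1)
  have hr : ∀ k, 0 < r k := fun k => by positivity
  have hrδ : ∀ k, r k ≤ δ := fun k => div_le_self hδ.le (by simp)
  let ρ : ℕ → ContDiffBump (0 : EuclideanSpace ℝ (Fin n)) := fun k =>
    ⟨r k / 2, r k, half_pos (hr k), half_lt_self (hr k)⟩
  have hρ0 : Tendsto (fun k => (ρ k).rOut) atTop (𝓝 0) :=
    tendsto_const_div_atTop_nhds_zero_nat δ |>.comp (tendsto_add_atTop_nat 1) |>.congr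
      fun k => by simp [ρ, r]
  have hsub : ∀ k, tsupport ((ρ k).normed volume ⋆[lsmul ℝ ℝ, volume] f)
      ⊆ Metric.cthickening δ K := by
    intro k
    refine closure_minimal (fun x hx => ?_) Metric.isClosed_cthickening
    have := (support_convolution_subset (lsmul ℝ ℝ) hx)
    obtain ⟨a, ha, y, hy, rfl⟩ := this
    rw [(ρ k).support_normed_eq, mem_ball_zero_iff] at ha
    have hyK : y ∈ K := by_contra fun h => hy (hf y h)
    refine Metric.mem_cthickening_of_dist_le _ y _ _ hyK ?_
    simpa using ha.le.trans (hrδ k)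
  have htest : ∀ k, IsTestFunction Ω ((ρ k).normed volume ⋆[lsmul ℝ ℝ, volume] f) := fun k =>
    ⟨(ρ k).hasCompactSupport_normed.contDiff_convolution_left _ (ρ k).contDiff_normed hloc,
      hK.cthickening.of_isClosed_subset (isClosed_tsupport _) (hsub k), (hsub k).trans hδΩ⟩
  have hle : volume.restrict Ω ≤ (volume : Measure (EuclideanSpace ℝ (Fin n))) :=
    Measure.restrict_le_self
  refine HasSobolevGradientZero.of_tendsto_test hp h.memLp h.memLp_gradient htest ?_ ?_
  · have := tendsto_eLpNorm_convolution_sub volume (one_le_ofReal hp) ENNReal.ofReal_ne_top hfE hρ0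
    refine tendsto_of_tendsto_of_tendsto_of_le_of_le tendsto_const_nhds this (fun _ => zero_le)
      fun k => ?_
    refine le_trans (le_of_eq ?_) (eLpNorm_mono_measure _ hle)
    rw [← eLpNorm_neg]
    congr 1
    ext x
    simp
  · have := tendsto_eLpNorm_convolution_sub volume (one_le_ofReal hp) ENNReal.ofReal_ne_top hgE hρ0
    refine tendsto_of_tendsto_of_tendsto_of_le_of_le tendsto_const_nhds this (fun _ => zero_le)
      fun k => ?_
    refine le_trans (le_of_eq ?_) (eLpNorm_mono_measure _ hle)
    rw [← eLpNorm_neg]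
    congr 1
    ext1 x
    have hgr := gradient_convolution_eq hΩ hp h hK hKΩ hf hg hloc
      ((ρ k).contDiff_normed (μ := volume)) (ρ k).hasCompactSupport_normed x
    simp only [Pi.neg_apply, hgr, neg_sub]

end Mollify

theorem abs_sub_le_of_abs_deriv_le {H : ℝ → ℝ} (hH : ContDiff ℝ ∞ H) {M : ℝ}
    (hM : ∀ z, |deriv H z| ≤ M) (y z : ℝ) : |H y - H z| ≤ M * |y - z| :=
  convex_univ.norm_image_sub_le_of_norm_deriv_le
    (fun x _ => (hH.differentiable (by simp)) x) (fun x _ => hM x) (mem_univ z) (mem_univ y)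

theorem tendsto_eLpNorm_comp_sub {α : Type*} [MeasurableSpace α] {μ : Measure α} {P : ENNReal}
    {H : ℝ → ℝ} (hH : ContDiff ℝ ∞ H) {M : ℝ} (hM : ∀ z, |deriv H z| ≤ M)
    {f : ℕ → α → ℝ} {f₀ : α → ℝ}
    (hlim : Tendsto (fun k => eLpNorm (fun x => f₀ x - f k x) P μ) atTop (𝓝 0)) :
    Tendsto (fun k => eLpNorm (fun x => H (f₀ x) - H (f k x)) P μ) atTop (𝓝 0) := by
  have h2 : Tendsto (fun k => ENNReal.ofReal M * eLpNorm (fun x => f₀ x - f k x) P μ)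
      atTop (𝓝 0) := by
    have := ENNReal.Tendsto.const_mul hlim (Or.inr (ENNReal.ofReal_ne_top (r := M)))
    rwa [mul_zero] at this
  exact tendsto_of_tendsto_of_tendsto_of_le_of_le tendsto_const_nhds h2 (fun _ => zero_le)
    fun k => eLpNorm_le_mul_eLpNorm_of_ae_le_mul
      (Eventually.of_forall fun x => abs_sub_le_of_abs_deriv_le hH hM _ _) P

theorem memLp_comp_of_abs_deriv_le {α : Type*} [MeasurableSpace α] {μ : Measure α} {P : ENNReal}
    {H : ℝ → ℝ} (hH : ContDiff ℝ ∞ H) (hH0 : H 0 = 0) {M : ℝ} (hM : ∀ z, |deriv H z| ≤ M)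
    {f : α → ℝ} (hf : MemLp f P μ) : MemLp (fun x => H (f x)) P μ :=
  hf.of_le_mul (c := M) (hH.continuous.comp_aestronglyMeasurable hf.1)
    (Eventually.of_forall fun x => by
      have := abs_sub_le_of_abs_deriv_le hH hM (f x) 0
      simpa [hH0] using this)

theorem memLp_deriv_comp_smul {α F : Type*} [MeasurableSpace α] {μ : Measure α} {P : ENNReal}
    [NormedAddCommGroup F] [NormedSpace ℝ F] {a : ℝ → ℝ} (ha : Continuous a) {M : ℝ}
    (hM : ∀ z, |a z| ≤ M) {f : α → ℝ} (hf : AEStronglyMeasurable f μ) {g : α → F}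
    (hg : MemLp g P μ) : MemLp (fun x => a (f x) • g x) P μ :=
  hg.of_le_mul (c := M) ((ha.comp_aestronglyMeasurable hf).smul hg.1)
    (Eventually.of_forall fun x => by
      rw [norm_smul]; exact mul_le_mul_of_nonneg_right (hM _) (norm_nonneg _))

/-- The values converge because `H` is Lipschitz. The gradients contain the factor `H'(F_k)`, which
only needs to converge almost everywhere since it is bounded; a subsequence provides this, and
`W_0^{1,p}(Ω)` is closed. -/
theorem HasSobolevGradientZero.comp_of_tendsto (hp : 1 < p) {H : ℝ → ℝ} (hH : ContDiff ℝ ∞ H)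
    (hH0 : H 0 = 0) {M : ℝ} (hM : ∀ z, |deriv H z| ≤ M)
    (hf : MemLp f (ENNReal.ofReal p) (volume.restrict Ω))
    (hg : MemLp g (ENNReal.ofReal p) (volume.restrict Ω))
    {F : ℕ → EuclideanSpace ℝ (Fin n) → ℝ}
    {G : ℕ → EuclideanSpace ℝ (Fin n) → EuclideanSpace ℝ (Fin n)}
    (hF : ∀ k, MemLp (F k) (ENNReal.ofReal p) (volume.restrict Ω))
    (hG : ∀ k, MemLp (G k) (ENNReal.ofReal p) (volume.restrict Ω))
    (hFG : ∀ k, HasSobolevGradientZero Ω p (fun x => H (F k x)) (fun x => deriv H (F k x) • G k x))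
    (h₁ : Tendsto (fun k => eLpNorm (fun x => f x - F k x) (ENNReal.ofReal p)
      (volume.restrict Ω)) atTop (𝓝 0))
    (h₂ : Tendsto (fun k => eLpNorm (fun x => g x - G k x) (ENNReal.ofReal p)
      (volume.restrict Ω)) atTop (𝓝 0)) :
    HasSobolevGradientZero Ω p (fun x => H (f x)) (fun x => deriv H (f x) • g x) := by
  have hP1 := one_le_ofReal hp
  have hdc : Continuous (deriv H) := hH.continuous_deriv (by simp)
  obtain ⟨ns, hns, hae⟩ := exists_subseq_tendsto_ae_of_eLpNorm (zero_lt_one.trans_le hP1).ne'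
    (fun k => (hF k).1) hf.1 h₁
  exact HasSobolevGradientZero.of_tendsto hp (memLp_comp_of_abs_deriv_le hH hH0 hM hf)
    (memLp_deriv_comp_smul hdc hM hf.1 hg)
    (fun k => hFG (ns k))
    (tendsto_eLpNorm_comp_sub hH hM (h₁.comp hns.tendsto_atTop))
    (tendsto_eLpNorm_comp_smul hP1 ENNReal.ofReal_ne_top hdc hM (fun k => (hF (ns k)).1)
      hf.1 (fun k => hG (ns k)) hg hae (h₂.comp hns.tendsto_atTop))

/-- Chain rule in `W_0^{1,p}`. -/
theorem HasSobolevGradientZero.comp (hp : 1 < p) {H : ℝ → ℝ} (hH : ContDiff ℝ ∞ H)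
    (hH0 : H 0 = 0) {M : ℝ} (hM : ∀ z, |deriv H z| ≤ M) (h : HasSobolevGradientZero Ω p f g) :
    HasSobolevGradientZero Ω p (fun x => H (f x)) (fun x => deriv H (f x) • g x) := by
  obtain ⟨φ, h0, h1, h2⟩ := h.exists_approx
  refine HasSobolevGradientZero.comp_of_tendsto hp hH hH0 hM h.memLp h.memLp_gradient
    (fun k => (h0 k).memLp _) (fun k => (h0 k).memLp_gradient _) (fun k => ?_) h1 h2
  have := ((h0 k).comp_left hH hH0).hasSobolevGradientZero (p := p)
  refine this.congr_ae (ae_eq_refl _) (Eventually.of_forall fun x => ?_)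
  exact gradient_comp ((hH.differentiable (by simp)) _) ((h0 k).differentiableAt x)

/-- If `f ∈ W_0^{1,p}(Ω)`, `h ∈ W^{1,p}(Ω)` is nonpositive off a compact subset of `Ω` and `H`
vanishes on `(-∞, 0]`, then `H(f + h) ∈ W_0^{1,p}(Ω)`. -/
theorem HasSobolevGradientZero.comp_add (hΩ : IsOpen Ω) (hp : 1 < p) {H : ℝ → ℝ}
    (hH : ContDiff ℝ ∞ H) (hH0 : ∀ z ≤ 0, H z = 0) (hH0' : ∀ z ≤ 0, deriv H z = 0)
    {M : ℝ} (hM : ∀ z, |deriv H z| ≤ M)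
    (hf : HasSobolevGradientZero Ω p f₁ g₁) (hh : HasSobolevGradient Ω p f₂ g₂)
    {K : Set (EuclideanSpace ℝ (Fin n))} (hK : IsCompact K) (hKΩ : K ⊆ Ω)
    (hneg : ∀ x ∈ Ω \ K, f₂ x ≤ 0) :
    HasSobolevGradientZero Ω p (fun x => H (f₁ x + f₂ x))
      (fun x => deriv H (f₁ x + f₂ x) • (g₁ x + g₂ x)) := by
  obtain ⟨φ, h0, h1, h2⟩ := hf.exists_approx
  refine HasSobolevGradientZero.comp_of_tendsto (F := fun k x => φ k x + f₂ x)
    (G := fun k x => gradient (φ k) x + g₂ x) hp hH (hH0 0 le_rfl) hM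
    (hf.memLp.add hh.memLp) (hf.memLp_gradient.add hh.memLp_gradient)
    (fun k => ((h0 k).memLp _).add hh.memLp)
    (fun k => ((h0 k).memLp_gradient _).add hh.memLp_gradient) (fun k => ?_)
    (by simpa using h1) (by simpa using h2)
  -- With `θ = 1` near `K ∪ supp φ_k`, the function `θ f₂` lies in `W_0^{1,p}(Ω)`. Replacing `f₂` by
  -- `θ f₂` is invisible to `H`: off `K ∪ supp φ_k` one has `φ_k = 0` and `f₂ ≤ 0`, so both
  -- arguments are nonpositive, where `H` and `H'` vanish.
  obtain ⟨θ, hθ, hθ1, hθ0⟩ := exists_cutoff (hK.union (h0 k).hasCompactSupport) hΩ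
    (union_subset hKΩ (h0 k).tsupport_subset)
  have hcut := (hh.test_mul hp hθ).zero_of_compact hΩ hp hθ.hasCompactSupport hθ.tsupport_subset
    (fun x hx => by rw [image_eq_zero_of_notMem_tsupport hx, zero_mul])
    (fun x hx => by rw [image_eq_zero_of_notMem_tsupport hx,
      gradient_eq_zero_of_notMem_tsupport hx, zero_smul, smul_zero, add_zero])
  have hsum := hcut.sub hp (h0 k).neg.hasSobolevGradientZero
  have hcomp := hsum.comp hp hH (hH0 0 le_rfl) hM
  have hgn : ∀ x, gradient (fun x => -φ k x) x = - gradient (φ k) x := fun x => by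
    simp only [gradient, fderiv_fun_neg, map_neg]
  have key : ∀ x ∈ Ω, (θ x * f₂ x - -φ k x = φ k x + f₂ x ∧
        θ x • g₂ x + f₂ x • gradient θ x - gradient (fun x => -φ k x) x
          = gradient (φ k) x + g₂ x) ∨
      (θ x * f₂ x - -φ k x ≤ 0 ∧ φ k x + f₂ x ≤ 0) := by
    intro x hx
    by_cases hxK : x ∈ K ∪ tsupport (φ k)
    · left
      have e1 := hθ1 x hxK
      have e2 : gradient θ x = 0 := by
        have : θ =ᶠ[𝓝 x] fun _ => 1 := e1
        rw [this.gradient_eq, gradient_fun_const]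
      rw [e1.self_of_nhds, e2, hgn]
      refine ⟨by ring, ?_⟩
      rw [one_smul, smul_zero, add_zero, sub_neg_eq_add, add_comm]
    · right
      rw [mem_union, not_or] at hxK
      have e1 : φ k x = 0 := image_eq_zero_of_notMem_tsupport hxK.2
      have e2 := hneg x ⟨hx, hxK.1⟩
      rw [e1]
      refine ⟨?_, by simpa using e2⟩
      have := mul_nonpos_of_nonneg_of_nonpos (hθ0 x) e2
      linarith
  refine hcomp.congr_ae ?_ ?_
  · filter_upwards [ae_restrict_mem hΩ.measurableSet] with x hx
    rcases key x hx with ⟨e, -⟩ | ⟨e1, e2⟩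
    · rw [e]
    · rw [hH0 _ e1, hH0 _ e2]
  · filter_upwards [ae_restrict_mem hΩ.measurableSet] with x hx
    rcases key x hx with ⟨e, e'⟩ | ⟨e1, e2⟩
    · rw [e, e']
    · rw [hH0' _ e1, hH0' _ e2, zero_smul, zero_smul]

end

section

variable {n : ℕ} {p : ℝ}

/-! ### The nonlinearities `b` and `flux`: oddness, monotonicity, integrability. -/

section Nonlinearity

theorem b_of_nonneg (hp : 1 < p) {z : ℝ} (hz : 0 ≤ z) : b p z = z ^ (p - 1) := by
  rcases hz.eq_or_lt with rfl | hz
  · rw [b, mul_zero, Real.zero_rpow (by linarith)]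
  · rw [b, abs_of_pos hz]
    nth_rewrite 2 [← Real.rpow_one z]
    rw [← Real.rpow_add hz]
    congr 1
    ring

theorem b_neg (z : ℝ) : b p (-z) = -b p z := by
  simp [b]

theorem b_zero : b p 0 = 0 := by simp [b]

theorem b_strictMono (hp : 1 < p) : StrictMono (b p) := by
  have h : StrictMonoOn (b p) (Ici 0) := fun x hx y hy hxy => by
    rw [b_of_nonneg hp hx, b_of_nonneg hp hy]
    exact Real.rpow_lt_rpow hx hxy (by linarith)
  exact strictMono_of_odd_strictMonoOn_nonneg b_neg h

theorem continuous_b (hp : 1 < p) : Continuous (b p) := by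
  have e : b p = fun z => if 0 ≤ z then z ^ (p - 1) else -((-z) ^ (p - 1)) := by
    ext z
    split_ifs with hz
    · exact b_of_nonneg hp hz
    · rw [← neg_neg z, b_neg, b_of_nonneg hp (by linarith), neg_neg]
  rw [e]
  refine Continuous.if_le ?_ ?_ continuous_const continuous_id ?_
  · exact Real.continuous_rpow_const (by linarith)
  · exact ((Real.continuous_rpow_const (by linarith)).comp continuous_neg).neg
  · rintro x rfl
    simp [Real.zero_rpow (by linarith : p - 1 ≠ 0)]

theorem abs_b (hp : 1 < p) (z : ℝ) : |b p z| = |z| ^ (p - 1) := by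
  rw [b, abs_mul, abs_of_nonneg (Real.rpow_nonneg (abs_nonneg z) _)]
  have := b_of_nonneg hp (abs_nonneg z)
  rwa [b, abs_abs] at this

theorem norm_flux (hp : 1 < p) (ξ : EuclideanSpace ℝ (Fin n)) : ‖flux p ξ‖ = ‖ξ‖ ^ (p - 1) := by
  rw [flux, norm_smul, Real.norm_of_nonneg (Real.rpow_nonneg (norm_nonneg ξ) _)]
  have := b_of_nonneg hp (norm_nonneg ξ)
  rwa [b, abs_norm] at this

theorem flux_neg (ξ : EuclideanSpace ℝ (Fin n)) : flux p (-ξ) = -flux p ξ := by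
  simp [flux]

theorem flux_zero : flux p (0 : EuclideanSpace ℝ (Fin n)) = 0 := by
  simp [flux]

theorem measurable_flux : Measurable (flux p : EuclideanSpace ℝ (Fin n) → _) :=
  (measurable_norm.pow_const _).smul measurable_id

/-- The vector field `|ξ|^{p-2} ξ` is monotone. -/
theorem inner_flux_sub_nonneg (hp : 1 < p) (ξ η : EuclideanSpace ℝ (Fin n)) :
    0 ≤ inner ℝ (flux p ξ - flux p η) (ξ - η) := by
  have e1 : inner ℝ (flux p ξ) ξ = b p ‖ξ‖ * ‖ξ‖ := by
    rw [flux, real_inner_smul_left, real_inner_self_eq_norm_mul_norm, b, abs_norm]; ring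
  have e2 : inner ℝ (flux p η) η = b p ‖η‖ * ‖η‖ := by
    rw [flux, real_inner_smul_left, real_inner_self_eq_norm_mul_norm, b, abs_norm]; ring
  -- Cauchy–Schwarz on the two cross terms reduces monotonicity of the field to monotonicity of `b`
  -- on the norms.
  have e3 : inner ℝ (flux p ξ) η ≤ b p ‖ξ‖ * ‖η‖ := by
    refine (real_inner_le_norm _ _).trans (le_of_eq ?_)
    rw [norm_flux hp, b_of_nonneg hp (norm_nonneg ξ)]
  have e4 : inner ℝ (flux p η) ξ ≤ b p ‖η‖ * ‖ξ‖ := by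
    refine (real_inner_le_norm _ _).trans (le_of_eq ?_)
    rw [norm_flux hp, b_of_nonneg hp (norm_nonneg η)]
  rw [inner_sub_left, inner_sub_right, inner_sub_right, e1, e2]
  have key : 0 ≤ (b p ‖ξ‖ - b p ‖η‖) * (‖ξ‖ - ‖η‖) := by
    rcases le_total ‖ξ‖ ‖η‖ with h | h
    · exact mul_nonneg_of_nonpos_of_nonpos
        (sub_nonpos.2 ((b_strictMono hp).monotone h)) (sub_nonpos.2 h)
    · exact mul_nonneg (sub_nonneg.2 ((b_strictMono hp).monotone h)) (sub_nonneg.2 h)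
  nlinarith

/-- The exponent `p / (p - 1)` is conjugate to `p`: both `b(u)` and the flux can be paired with
elements of `L^p`. -/
theorem memLp_of_norm_eq_rpow {α F₁ F₂ : Type*} [MeasurableSpace α] {μ : Measure α}
    [NormedAddCommGroup F₁] [NormedAddCommGroup F₂] (hp : 1 < p) {f : α → F₁} {g : α → F₂}
    (hf : MemLp f (ENNReal.ofReal p) μ) (hg : AEStronglyMeasurable g μ)
    (h : ∀ x, ‖g x‖ = ‖f x‖ ^ (p - 1)) : MemLp g (ENNReal.ofReal (p / (p - 1))) μ := by
  have h1 := hf.norm_rpow_div (ENNReal.ofReal (p - 1))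
  rw [ENNReal.toReal_ofReal (by linarith), ← ENNReal.ofReal_div_of_pos (by linarith)] at h1
  exact h1.mono hg (Eventually.of_forall fun x => by
    rw [h, Real.norm_of_nonneg (Real.rpow_nonneg (norm_nonneg _) _)])

theorem memLp_flux {α : Type*} [MeasurableSpace α] {μ : Measure α} (hp : 1 < p)
    {f : α → EuclideanSpace ℝ (Fin n)} (hf : MemLp f (ENNReal.ofReal p) μ) :
    MemLp (fun x => flux p (f x)) (ENNReal.ofReal (p / (p - 1))) μ :=
  memLp_of_norm_eq_rpow hp hf
    (measurable_flux.comp_aemeasurable hf.1.aemeasurable).aestronglyMeasurable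
    fun x => norm_flux hp (f x)

theorem memLp_b {α : Type*} [MeasurableSpace α] {μ : Measure α} (hp : 1 < p)
    {f : α → ℝ} (hf : MemLp f (ENNReal.ofReal p) μ) :
    MemLp (fun x => b p (f x)) (ENNReal.ofReal (p / (p - 1))) μ :=
  memLp_of_norm_eq_rpow hp hf ((continuous_b hp).comp_aestronglyMeasurable hf.1)
    fun x => abs_b hp (f x)

end Nonlinearity

/-! ### The smooth step. -/

section Heaviside

/-- A smooth nondecreasing approximation of the Heaviside function, living on `(0, δ)`. -/
def smoothStep (δ z : ℝ) : ℝ := Real.smoothTransition (z / δ)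

theorem contDiff_smoothTransition : ContDiff ℝ ∞ Real.smoothTransition :=
  Real.smoothTransition.contDiff

theorem continuous_deriv_smoothTransition : Continuous (deriv Real.smoothTransition) :=
  contDiff_smoothTransition.continuous_deriv (by simp)

theorem deriv_smoothTransition_nonneg (r : ℝ) : 0 ≤ deriv Real.smoothTransition r :=
  Real.smoothTransition.monotone.deriv_nonneg

/-- Such a point is a global minimum, since the transition is nonnegative and vanishes there; this
covers the endpoint `0` too. -/
theorem deriv_smoothTransition_of_nonpos {r : ℝ} (hr : r ≤ 0) :
    deriv Real.smoothTransition r = 0 := by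
  refine IsLocalMin.deriv_eq_zero (Eventually.of_forall fun y => ?_)
  rw [Real.smoothTransition.zero_of_nonpos hr]
  exact Real.smoothTransition.nonneg y

theorem deriv_smoothTransition_of_one_le {r : ℝ} (hr : 1 ≤ r) :
    deriv Real.smoothTransition r = 0 := by
  refine IsLocalMax.deriv_eq_zero (Eventually.of_forall fun y => ?_)
  rw [Real.smoothTransition.one_of_one_le hr]
  exact Real.smoothTransition.le_one y

theorem exists_deriv_smoothTransition_le : ∃ M, ∀ r, |deriv Real.smoothTransition r| ≤ M := by
  have hc : HasCompactSupport (deriv Real.smoothTransition) := by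
    refine HasCompactSupport.intro (isCompact_Icc (a := (0 : ℝ)) (b := 1)) fun x hx => ?_
    rw [mem_Icc, not_and_or, not_le, not_le] at hx
    rcases hx with h | h
    · exact deriv_smoothTransition_of_nonpos h.le
    · exact deriv_smoothTransition_of_one_le h.le
  exact hc.exists_bound_of_continuous continuous_deriv_smoothTransition

theorem integral_deriv_smoothTransition (a c : ℝ) :
    ∫ r in a..c, deriv Real.smoothTransition r
      = Real.smoothTransition c - Real.smoothTransition a :=
  intervalIntegral.integral_deriv_eq_sub
    (fun x _ => (contDiff_smoothTransition.differentiable (by simp)) x)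
    (continuous_deriv_smoothTransition.intervalIntegrable _ _)

theorem contDiff_smoothStep (δ : ℝ) : ContDiff ℝ ∞ (smoothStep δ) :=
  contDiff_smoothTransition.comp (contDiff_id.div_const δ)

theorem smoothStep_nonneg (δ z : ℝ) : 0 ≤ smoothStep δ z := Real.smoothTransition.nonneg _

theorem smoothStep_le_one (δ z : ℝ) : smoothStep δ z ≤ 1 := Real.smoothTransition.le_one _

theorem smoothStep_of_nonpos {δ : ℝ} (hδ : 0 < δ) {z : ℝ} (hz : z ≤ 0) : smoothStep δ z = 0 :=
  Real.smoothTransition.zero_of_nonpos (div_nonpos_of_nonpos_of_nonneg hz hδ.le)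

theorem deriv_smoothStep (δ z : ℝ) :
    deriv (smoothStep δ) z = deriv Real.smoothTransition (z / δ) / δ := by
  have h := ((contDiff_smoothTransition.differentiable (by simp)) (z / δ)).hasDerivAt
  exact (h.comp z ((hasDerivAt_id z).div_const δ)).deriv.trans (by ring)

theorem deriv_smoothStep_nonneg {δ : ℝ} (hδ : 0 < δ) (z : ℝ) : 0 ≤ deriv (smoothStep δ) z := by
  rw [deriv_smoothStep]
  exact div_nonneg (deriv_smoothTransition_nonneg _) hδ.le

theorem deriv_smoothStep_of_nonpos {δ : ℝ} (hδ : 0 < δ) {z : ℝ} (hz : z ≤ 0) :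
    deriv (smoothStep δ) z = 0 := by
  rw [deriv_smoothStep, deriv_smoothTransition_of_nonpos
    (div_nonpos_of_nonpos_of_nonneg hz hδ.le), zero_div]

theorem exists_deriv_smoothStep_le (δ : ℝ) : ∃ M, ∀ z, |deriv (smoothStep δ) z| ≤ M := by
  obtain ⟨M, hM⟩ := exists_deriv_smoothTransition_le
  refine ⟨M / |δ|, fun z => ?_⟩
  rw [deriv_smoothStep, abs_div]
  exact div_le_div_of_nonneg_right (hM _) (abs_nonneg _)

end Heaviside

/-! ### The entropy and its convexity. -/

section Entropy

/-- The primitive `∫_w^z H_δ(ζ - w) db(ζ)` written as an average of `(b(z) - b(w + δ r))⁺`. -/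
def entropy (p δ w z : ℝ) : ℝ :=
  ∫ r in (0 : ℝ)..1, max (b p z - b p (w + δ * r)) 0 * deriv Real.smoothTransition r

theorem continuous_entropy (hp : 1 < p) :
    Continuous fun a : ℝ × ℝ × ℝ => entropy p a.1 a.2.1 a.2.2 := by
  unfold entropy
  refine intervalIntegral.continuous_parametric_intervalIntegral_of_continuous' ?_ 0 1
  have hb := continuous_b hp
  have hd := continuous_deriv_smoothTransition
  simp only [Function.uncurry_def]
  fun_prop

theorem intervalIntegrable_entropy (hp : 1 < p) (δ w z s t : ℝ) :
    IntervalIntegrable (fun r => max (b p z - b p (w + δ * r)) 0 * deriv Real.smoothTransition r)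
      volume s t := by
  have hb := continuous_b hp
  have hd := continuous_deriv_smoothTransition
  exact Continuous.intervalIntegrable (by fun_prop) _ _

/-- The weight `deriv Real.smoothTransition` has mass one on `[0,1]`. Together with
`continuous_entropy` this turns the limit `δ → 0` into evaluation at `δ = 0`. -/
theorem entropy_zero_left (w z : ℝ) : entropy p 0 w z = max (b p z - b p w) 0 := by
  simp [entropy, integral_deriv_smoothTransition]

theorem entropy_nonneg (δ w z : ℝ) : 0 ≤ entropy p δ w z :=
  intervalIntegral.integral_nonneg zero_le_one fun r _ =>
    mul_nonneg (le_max_right _ _) (deriv_smoothTransition_nonneg r)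

theorem entropy_le (hp : 1 < p) {δ : ℝ} (hδ : 0 ≤ δ) (w z : ℝ) :
    entropy p δ w z ≤ max (b p z - b p w) 0 := by
  rw [← entropy_zero_left]
  refine intervalIntegral.integral_mono_on zero_le_one (intervalIntegrable_entropy hp _ _ _ _ _)
    (intervalIntegrable_entropy hp _ _ _ _ _) fun r hr => ?_
  refine mul_le_mul_of_nonneg_right ?_ (deriv_smoothTransition_nonneg r)
  have : b p (w + 0 * r) ≤ b p (w + δ * r) := (b_strictMono hp).monotone (by
    have := mul_nonneg hδ hr.1
    linarith)
  exact max_le_max (by linarith) le_rfl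

theorem abs_entropy_le (hp : 1 < p) {δ : ℝ} (hδ : 0 ≤ δ) (w z : ℝ) :
    |entropy p δ w z| ≤ |b p z| + |b p w| := by
  rw [abs_of_nonneg (entropy_nonneg δ w z)]
  refine (entropy_le hp hδ w z).trans (max_le ?_ (by positivity))
  exact (le_abs_self _).trans (abs_sub _ _)

/-- Convexity of the entropy as a function of `b(z)`. -/
theorem entropy_sub_le (hp : 1 < p) {δ : ℝ} (hδ : 0 < δ) (w y z : ℝ) :
    entropy p δ w z - entropy p δ w y ≤ (b p z - b p y) * smoothStep δ (z - w) := by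
  have hmono := (b_strictMono hp).monotone
  -- The integral is split where the threshold `w + δ r` passes `z`. For `r` below `c` the positive
  -- part belonging to `z` is active and the one belonging to `y` is at least its argument, so the
  -- difference is at most `b(z) - b(y)`; the weight on `[0,c]` has mass `H_δ(z - w)`. Above `c` the
  -- part belonging to `z` vanishes.
  set c : ℝ := max 0 (min 1 ((z - w) / δ)) with hc
  have hc0 : 0 ≤ c := le_max_left _ _
  have hc1 : c ≤ 1 := max_le zero_le_one (min_le_left _ _)
  have hstep : smoothStep δ (z - w) = ∫ r in (0 : ℝ)..c, deriv Real.smoothTransition r := by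
    rw [integral_deriv_smoothTransition, Real.smoothTransition.zero, sub_zero, smoothStep, hc]
    rcases le_total ((z - w) / δ) 0 with h | h
    · rw [max_eq_left ((min_le_right _ _).trans h), Real.smoothTransition.zero,
        Real.smoothTransition.zero_of_nonpos h]
    · rw [max_eq_right (le_min zero_le_one h)]
      rcases le_total 1 ((z - w) / δ) with h1 | h1
      · rw [min_eq_left h1, Real.smoothTransition.one, Real.smoothTransition.one_of_one_le h1]
      · rw [min_eq_right h1]
  have hi := fun v s t => intervalIntegrable_entropy hp δ w v s t
  have hid : IntervalIntegrable (deriv Real.smoothTransition) volume 0 c :=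
    continuous_deriv_smoothTransition.intervalIntegrable _ _
  have hsplit : ∀ v, entropy p δ w v
      = (∫ r in (0 : ℝ)..c, max (b p v - b p (w + δ * r)) 0 * deriv Real.smoothTransition r)
        + ∫ r in c..1, max (b p v - b p (w + δ * r)) 0 * deriv Real.smoothTransition r :=
    fun v => (intervalIntegral.integral_add_adjacent_intervals (hi v 0 c) (hi v c 1)).symm
  have h2 : ∫ r in c..1, max (b p z - b p (w + δ * r)) 0 * deriv Real.smoothTransition r
      ≤ ∫ r in c..1, max (b p y - b p (w + δ * r)) 0 * deriv Real.smoothTransition r := by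
    refine intervalIntegral.integral_mono_on hc1 (hi z c 1) (hi y c 1) fun r hr => ?_
    -- At `r = 1` the truncation at `1` gives no information about `(z - w) / δ`, but the weight is
    -- zero there. The endpoint `r = 0` below is similar.
    rcases hr.2.eq_or_lt with rfl | hr1
    · simp [deriv_smoothTransition_of_one_le]
    · have h3 : (z - w) / δ ≤ r := by
        have : min 1 ((z - w) / δ) ≤ r := (le_max_right _ _).trans hr.1
        exact (min_le_iff.1 this).resolve_left (not_le.2 hr1)
      rw [div_le_iff₀ hδ] at h3
      refine mul_le_mul_of_nonneg_right ?_ (deriv_smoothTransition_nonneg r)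
      rw [max_eq_right (sub_nonpos.2 (hmono (by linarith)))]
      exact le_max_right _ _
  have h1 : (∫ r in (0 : ℝ)..c, max (b p z - b p (w + δ * r)) 0 * deriv Real.smoothTransition r)
      - (∫ r in (0 : ℝ)..c, max (b p y - b p (w + δ * r)) 0 * deriv Real.smoothTransition r)
      ≤ (b p z - b p y) * smoothStep δ (z - w) := by
    rw [hstep, ← intervalIntegral.integral_const_mul,
      ← intervalIntegral.integral_sub (hi z 0 c) (hi y 0 c)]
    refine intervalIntegral.integral_mono_on hc0 ((hi z 0 c).sub (hi y 0 c))
      (hid.const_mul _) fun r hr => ?_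
    rw [← sub_mul]
    rcases hr.1.eq_or_lt with rfl | hr0
    · simp [deriv_smoothTransition_of_nonpos]
    · have h3 : r ≤ (z - w) / δ := by
        have : r ≤ max 0 (min 1 ((z - w) / δ)) := hr.2
        exact ((le_max_iff.1 this).resolve_left (not_le.2 hr0)).trans (min_le_right _ _)
      rw [le_div_iff₀ hδ] at h3
      refine mul_le_mul_of_nonneg_right ?_ (deriv_smoothTransition_nonneg r)
      rw [max_eq_left (sub_nonneg.2 (hmono (by linarith)))]
      linarith [le_max_left (b p y - b p (w + δ * r)) 0]
  rw [hsplit z, hsplit y]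
  linarith

end Entropy

end

section

/-! ### Distributional derivatives on an interval. -/

section OneDim

theorem IsTestFunction.exists_Icc {T : ℝ} (hT : 0 < T) {θ : ℝ → ℝ}
    (hθ : IsTestFunction (Ioo 0 T) θ) :
    ∃ a c, 0 < a ∧ a < c ∧ c < T ∧ ∀ t ∉ Icc a c, θ t = 0 := by
  obtain ⟨δ, hδ, hsub⟩ := hθ.hasCompactSupport.isCompact.exists_cthickening_subset_open isOpen_Ioo
    hθ.tsupport_subset
  -- The cap `T / 4` keeps the two endpoints in order when `δ` is large.
  refine ⟨min δ (T / 4), T - min δ (T / 4), by positivity, ?_, ?_, fun t ht => ?_⟩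
  · linarith [min_le_right δ (T / 4)]
  · have : 0 < min δ (T / 4) := by positivity
    linarith
  · refine image_eq_zero_of_notMem_tsupport fun hmem => ht ?_
    have h1 : t - δ ∈ Ioo 0 T := hsub (Metric.mem_cthickening_of_dist_le _ t _ _ hmem
      (by simp [abs_of_pos hδ]))
    have h2 : t + δ ∈ Ioo 0 T := hsub (Metric.mem_cthickening_of_dist_le _ t _ _ hmem
      (by simp [abs_of_pos hδ]))
    exact ⟨by linarith [min_le_left δ (T / 4), h1.1], by linarith [min_le_left δ (T / 4), h2.2]⟩

theorem hasDerivAt_primitive {φ : ℝ → ℝ} (hφ : Continuous φ) (a t : ℝ) :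
    HasDerivAt (fun t => ∫ s in a..t, φ s) (φ t) t :=
  intervalIntegral.integral_hasDerivAt_right (hφ.intervalIntegrable _ _)
    (hφ.stronglyMeasurableAtFilter _ _) hφ.continuousAt

/-- A smooth function with vanishing integral that is supported in a compact interval has a
compactly supported primitive. -/
theorem isTestFunction_primitive {U : Set ℝ} {a c : ℝ} (hac : a ≤ c) (hU : Icc a c ⊆ U)
    {φ : ℝ → ℝ} (hφ : ContDiff ℝ ∞ φ) (hsupp : ∀ t ∉ Icc a c, φ t = 0)
    (hint : ∫ s in a..c, φ s = 0) :
    IsTestFunction U fun t => ∫ s in a..t, φ s := by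
  have hzero : ∀ t ∉ Icc a c, ∫ s in a..t, φ s = 0 := by
    intro t ht
    rw [mem_Icc, not_and_or, not_le, not_le] at ht
    rcases ht with h | h
    · rw [intervalIntegral.integral_symm, neg_eq_zero]
      refine intervalIntegral.integral_zero_ae (Eventually.of_forall fun s hs => ?_)
      rw [uIoc_of_le h.le] at hs
      rcases hs.2.eq_or_lt with rfl | hlt
      -- At the left endpoint the value is obtained by continuity from outside the interval.
      · have hcl : Tendsto φ (𝓝[<] s) (𝓝 (φ s)) := hφ.continuous.continuousAt.mono_left inf_le_left
        refine tendsto_nhds_unique hcl (tendsto_const_nhds.congr' ?_)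
        filter_upwards [self_mem_nhdsWithin] with r hr
        exact (hsupp r fun h => not_lt.2 h.1 hr).symm
      · exact hsupp s fun h => not_lt.2 h.1 hlt
    · rw [← intervalIntegral.integral_add_adjacent_intervals
        (hφ.continuous.intervalIntegrable a c) (hφ.continuous.intervalIntegrable c t), hint, zero_add]
      refine intervalIntegral.integral_zero_ae (Eventually.of_forall fun s hs => ?_)
      rw [uIoc_of_le h.le] at hs
      exact hsupp s fun h => not_lt.2 h.2 hs.1
  have hts : tsupport (fun t => ∫ s in a..t, φ s) ⊆ Icc a c :=
    closure_minimal (fun t ht => by_contra fun h => ht (hzero t h)) isClosed_Icc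
  refine ⟨?_, isCompact_Icc.of_isClosed_subset (isClosed_tsupport _) hts, hts.trans hU⟩
  rw [contDiff_infty_iff_deriv]
  refine ⟨fun t => (hasDerivAt_primitive hφ.continuous a t).differentiableAt, ?_⟩
  have : deriv (fun t => ∫ s in a..t, φ s) = φ :=
    funext fun t => (hasDerivAt_primitive hφ.continuous a t).deriv
  rwa [this]

/-- The lemma of du Bois-Reymond. -/
theorem ae_eq_const_of_integral_mul_deriv_eq_zero {T : ℝ} (hT : 0 < T) {G : ℝ → ℝ}
    (hG : LocallyIntegrable G volume)
    (h : ∀ θ : ℝ → ℝ, IsTestFunction (Ioo 0 T) θ → ∫ t, G t * deriv θ t = 0) :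
    ∃ C, ∀ᵐ t, t ∈ Ioo 0 T → G t = C := by
  -- A reference bump of mass one. Subtracting the mass of `φ` times this bump leaves a function of
  -- mean zero, the derivative of an admissible test function. This identifies the constant as the
  -- integral of `G` against the bump.
  let B : ContDiffBump (T / 2) := ⟨T / 8, T / 4, by positivity, by linarith⟩
  set φ₀ : ℝ → ℝ := B.normed volume with hφ₀
  have hφ₀c : ContDiff ℝ ∞ φ₀ := B.contDiff_normed
  have hφ₀s : ∀ t ∉ Icc (T / 4) (3 * T / 4), φ₀ t = 0 := fun t ht => by
    have : t ∉ Function.support φ₀ := fun hs => ht <| by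
      rw [hφ₀, B.support_normed_eq, Real.ball_eq_Ioo] at hs
      simp only [B] at hs
      exact ⟨by linarith [hs.1], by linarith [hs.2]⟩
    exact Function.notMem_support.1 this
  have hφ₀i : Integrable φ₀ := B.integrable_normed
  have hφ₀cs : HasCompactSupport φ₀ := B.hasCompactSupport_normed
  refine ⟨∫ t, G t * φ₀ t, ?_⟩
  set C : ℝ := ∫ t, G t * φ₀ t with hC
  have hGC : LocallyIntegrable (fun t => G t - C) volume := hG.sub (locallyIntegrable_const C)
  have := isOpen_Ioo.ae_eq_zero_of_integral_contDiff_smul_eq_zero (U := Ioo 0 T)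
    (hGC.locallyIntegrableOn _) fun φ h1 h2 h3 => by
      obtain ⟨a, c, ha, hac, hcT, hsupp⟩ := IsTestFunction.exists_Icc hT ⟨h1, h2, h3⟩
      set m : ℝ := ∫ t, φ t with hm
      have hφi : Integrable φ := h1.continuous.integrable_of_hasCompactSupport h2
      -- A common compact interval containing the supports of `φ` and of the bump.
      set a' := min a (T / 4)
      set c' := max c (3 * T / 4)
      have ha' : a' ≤ a := min_le_left _ _
      have ha'' : a' ≤ T / 4 := min_le_right _ _
      have hc' : c ≤ c' := le_max_left _ _
      have hc'' : 3 * T / 4 ≤ c' := le_max_right _ _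
      have hψs : ∀ t ∉ Icc a' c', φ t - m * φ₀ t = 0 := fun t ht => by
        rw [hsupp t fun h => ht ⟨ha'.trans h.1, h.2.trans hc'⟩,
          hφ₀s t fun h => ht ⟨ha''.trans h.1, h.2.trans hc''⟩, mul_zero, sub_zero]
      have hψi : Integrable (fun t => φ t - m * φ₀ t) := hφi.sub (hφ₀i.const_mul m)
      have hψ0 : ∫ s in a'..c', (φ s - m * φ₀ s) = 0 := by
        rw [intervalIntegral.integral_of_le (by linarith), ← integral_Icc_eq_integral_Ioc,
          setIntegral_eq_integral_of_forall_compl_eq_zero hψs,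
          integral_sub hφi (hφ₀i.const_mul m), integral_const_mul, B.integral_normed, mul_one,
          sub_self]
      have hθ := isTestFunction_primitive (U := Ioo 0 T) (by linarith)
        (fun t ht => ⟨(show 0 < a' by positivity).trans_le ht.1,
          ht.2.trans_lt (max_lt hcT (by linarith))⟩)
        (h1.sub (contDiff_const.mul hφ₀c)) hψs hψ0
      have h4 := h _ hθ
      have hd : ∀ t, deriv (fun t => ∫ s in a'..t, (φ s - m * φ₀ s)) t = φ t - m * φ₀ t :=
        fun t => (hasDerivAt_primitive
          (h1.continuous.sub (continuous_const.mul hφ₀c.continuous)) a' t).deriv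
      simp_rw [hd] at h4
      have i1 : Integrable (fun t => φ t * G t) := by
        simpa using hG.integrable_smul_left_of_hasCompactSupport h1.continuous h2
      have i2 : Integrable (fun t => φ₀ t * G t) := by
        simpa using hG.integrable_smul_left_of_hasCompactSupport hφ₀c.continuous hφ₀cs
      have e1 : ∀ t, G t * (φ t - m * φ₀ t) = φ t * G t - m * (φ₀ t * G t) := fun t => by ring
      have e2 : ∀ t, φ t • (G t - C) = φ t * G t - C * φ t := fun t => by
        simp only [smul_eq_mul]; ring
      simp_rw [e1] at h4
      rw [integral_sub i1 (i2.const_mul m), integral_const_mul] at h4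
      simp_rw [e2]
      rw [integral_sub i1 (hφi.const_mul C), integral_const_mul, ← hm]
      have e3 : ∫ t, φ₀ t * G t = C := by
        rw [hC]; exact integral_congr_ae (Eventually.of_forall fun t => mul_comm _ _)
      rw [e3] at h4
      linarith
  filter_upwards [this] with t ht hmem
  exact sub_eq_zero.1 (ht hmem)

/-- The primitive of an integrable function is only absolutely continuous; integration by parts
still holds, and the boundary terms vanish with `θ` at `0` and `T`. -/
theorem integral_primitive_mul_deriv {T : ℝ} (hT : 0 < T) {a : ℝ → ℝ} (ha : Integrable a)
    {θ : ℝ → ℝ} (hθ : IsTestFunction (Ioo 0 T) θ) :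
    ∫ t, (∫ s in (0 : ℝ)..t, a s) * deriv θ t = - ∫ t, a t * θ t := by
  have hAC := (ha.intervalIntegrable (a := 0) (b := T)).absolutelyContinuousOnInterval_intervalIntegral
    (c := 0) left_mem_uIcc
  have hθAC : AbsolutelyContinuousOnInterval θ 0 T :=
    (hθ.contDiff.of_le (by simp)).contDiffOn.absolutelyContinuousOnInterval
  have hθ0 : ∀ t ∉ Ioo 0 T, θ t = 0 := fun t ht =>
    image_eq_zero_of_notMem_tsupport fun h => ht (hθ.tsupport_subset h)
  have hθ'0 : ∀ t ∉ Ioo 0 T, deriv θ t = 0 := fun t ht => by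
    by_contra hne
    exact ht (hθ.tsupport_subset (support_deriv_subset hne))
  have h := hAC.integral_mul_deriv_eq_deriv_mul hθAC
  rw [hθ0 T (by simp), hθ0 0 (by simp), mul_zero, mul_zero, sub_zero, zero_sub] at h
  have hconv : ∀ f : ℝ → ℝ, (∀ t ∉ Ioo 0 T, f t = 0) → ∫ t in (0 : ℝ)..T, f t = ∫ t, f t :=
    fun f hf => by
      rw [intervalIntegral.integral_of_le hT.le]
      exact setIntegral_eq_integral_of_forall_compl_eq_zero
        fun t ht => hf t fun h => ht (Ioo_subset_Ioc_self h)
  rw [hconv _ fun t ht => by rw [hθ'0 t ht, mul_zero],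
    hconv _ fun t ht => by rw [hθ0 t ht, mul_zero]] at h
  rw [h]
  congr 1
  refine integral_congr_ae ?_
  filter_upwards [LocallyIntegrable.ae_hasDerivAt_integral ha.locallyIntegrable] with t ht
  rw [(ht 0).deriv]

/-- The hypothesis says `g' = -a` in the sense of distributions, so `g` plus a primitive of `a` has
zero derivative and `ae_eq_const_of_integral_mul_deriv_eq_zero` applies. -/
theorem exists_const_of_weak_deriv {T : ℝ} (hT : 0 < T) {g a : ℝ → ℝ} (hg : Integrable g)
    (ha : Integrable a)
    (h : ∀ θ : ℝ → ℝ, IsTestFunction (Ioo 0 T) θ →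
      ∫ t, g t * deriv θ t = ∫ t, a t * θ t) :
    ∃ C, ∀ᵐ t, t ∈ Ioo 0 T → g t + ∫ s in (0 : ℝ)..t, a s = C := by
  have hc : Continuous fun t => ∫ s in (0 : ℝ)..t, a s :=
    intervalIntegral.continuous_primitive (fun _ _ => ha.intervalIntegrable) 0
  refine ae_eq_const_of_integral_mul_deriv_eq_zero hT
    (hg.locallyIntegrable.add hc.locallyIntegrable) fun θ hθ => ?_
  have hd : Continuous (deriv θ) := hθ.contDiff.continuous_deriv (by simp)
  have hdc : HasCompactSupport (deriv θ) := hθ.hasCompactSupport.deriv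
  have i1 : Integrable fun t => g t * deriv θ t := by
    have := hg.locallyIntegrable.integrable_smul_right_of_hasCompactSupport hd hdc
    simpa using this
  have i2 : Integrable fun t => (∫ s in (0 : ℝ)..t, a s) * deriv θ t :=
    (hc.mul hd).integrable_of_hasCompactSupport hdc.mul_left
  simp only [add_mul]
  rw [integral_add i1 i2, h θ hθ, integral_primitive_mul_deriv hT ha hθ, add_neg_cancel]

end OneDim

end

section

variable {n : ℕ} {Ω : Set (EuclideanSpace ℝ (Fin n))} {T p : ℝ}

/-! ### A countable dense family of test functions. -/

section Separability

/-- A countable family of test functions is dense in `W_0^{1,p}(Ω)`. -/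
theorem exists_countable_dense_test (Ω : Set (EuclideanSpace ℝ (Fin n))) (hp : 1 < p) :
    ∃ ζ : ℕ → EuclideanSpace ℝ (Fin n) → ℝ, (∀ j, IsTestFunction Ω (ζ j)) ∧
      ∀ f g, HasSobolevGradientZero Ω p f g → ∃ j : ℕ → ℕ,
        Tendsto (fun k => eLpNorm (fun x => f x - ζ (j k) x) (ENNReal.ofReal p)
          (volume.restrict Ω)) atTop (𝓝 0) ∧
        Tendsto (fun k => eLpNorm (fun x => g x - gradient (ζ (j k)) x) (ENNReal.ofReal p)
          (volume.restrict Ω)) atTop (𝓝 0) := by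
  have hP1 := one_le_ofReal hp
  have : Fact (1 ≤ ENNReal.ofReal p) := ⟨hP1⟩
  have : Fact (ENNReal.ofReal p ≠ ⊤) := ⟨ENNReal.ofReal_ne_top⟩
  -- Sending a test function to the pair (value, gradient) places the test functions in the
  -- separable space `L^p × L^p`. Its subsets are separable, so a dense sequence can be taken within
  -- the test functions themselves.
  let ι : {φ : EuclideanSpace ℝ (Fin n) → ℝ // IsTestFunction Ω φ} →
      Lp ℝ (ENNReal.ofReal p) (volume.restrict Ω) ×
      Lp (EuclideanSpace ℝ (Fin n)) (ENNReal.ofReal p) (volume.restrict Ω) :=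
    fun φ => ((φ.2.memLp _).toLp, (φ.2.memLp_gradient _).toLp)
  have : Nonempty {φ : EuclideanSpace ℝ (Fin n) → ℝ // IsTestFunction Ω φ} :=
    ⟨⟨fun _ => 0, contDiff_const, HasCompactSupport.zero, by simp [tsupport]⟩⟩
  have : Nonempty (range ι) := (range_nonempty ι).to_subtype
  have : SecondCountableTopology (Lp ℝ (ENNReal.ofReal p) (volume.restrict Ω)) := inferInstance
  have : SecondCountableTopology (Lp (EuclideanSpace ℝ (Fin n)) (ENNReal.ofReal p)
    (volume.restrict Ω)) := inferInstance
  have : TopologicalSpace.SeparableSpace (range ι) := inferInstance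
  choose ζ hζ using fun j => (TopologicalSpace.denseSeq (range ι) j).2
  refine ⟨fun j => (ζ j).1, fun j => (ζ j).2, fun f g hfg => ?_⟩
  obtain ⟨φ, h0, h1, h2⟩ := hfg.exists_approx
  have hpos : ∀ k : ℕ, (0 : ENNReal) < ((k : ENNReal) + 1)⁻¹ := fun k =>
    ENNReal.inv_pos.2 (by finiteness)
  have hex : ∀ k : ℕ, ∃ j, edist (ι ⟨φ k, h0 k⟩) (ι (ζ j)) < ((k : ENNReal) + 1)⁻¹ := by
    intro k
    have hd := TopologicalSpace.denseRange_denseSeq (range ι) ⟨ι ⟨φ k, h0 k⟩, mem_range_self _⟩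
    obtain ⟨_, ⟨j, rfl⟩, hj⟩ := EMetric.mem_closure_iff.1 hd _ (hpos k)
    refine ⟨j, ?_⟩
    rw [hζ j]
    exact hj
  choose j hj using hex
  refine ⟨j, ?_⟩
  have hinv : Tendsto (fun k : ℕ => ((k : ENNReal) + 1)⁻¹) atTop (𝓝 0) := by
    have := ENNReal.tendsto_inv_nat_nhds_zero.comp (tendsto_add_atTop_nat 1)
    refine this.congr fun k => ?_
    simp
  constructor
  · have h3 := h1.add hinv
    rw [add_zero] at h3
    refine tendsto_of_tendsto_of_tendsto_of_le_of_le tendsto_const_nhds h3 (fun _ => zero_le)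
      fun k => ?_
    have e : (fun x => f x - (ζ (j k)).1 x) = (fun x => f x - φ k x)
        + fun x => φ k x - (ζ (j k)).1 x := by
      ext x; simp
    simp only [e]
    refine (eLpNorm_add_le (hfg.memLp.sub ((h0 k).memLp _)).1
      (((h0 k).memLp (ENNReal.ofReal p)).sub ((ζ (j k)).2.memLp _)).1 hP1).trans (add_le_add le_rfl ?_)
    rw [← Lp.edist_toLp_toLp _ _ ((h0 k).memLp _) ((ζ (j k)).2.memLp _)]
    exact (le_max_left _ _).trans (hj k).le
  · have h3 := h2.add hinv
    rw [add_zero] at h3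
    refine tendsto_of_tendsto_of_tendsto_of_le_of_le tendsto_const_nhds h3 (fun _ => zero_le)
      fun k => ?_
    have e : (fun x => g x - gradient (ζ (j k)).1 x) = (fun x => g x - gradient (φ k) x)
        + fun x => gradient (φ k) x - gradient (ζ (j k)).1 x := by
      ext x; simp
    simp only [e]
    refine (eLpNorm_add_le (hfg.memLp_gradient.sub ((h0 k).memLp_gradient _)).1
      (((h0 k).memLp_gradient (ENNReal.ofReal p)).sub ((ζ (j k)).2.memLp_gradient _)).1 hP1).trans
      (add_le_add le_rfl ?_)
    rw [← Lp.edist_toLp_toLp _ _ ((h0 k).memLp_gradient _) ((ζ (j k)).2.memLp_gradient _)]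
    exact (le_max_right _ _).trans (hj k).le

end Separability

/-! ### Slices and cylindrical extensions in `L^q`. -/

section ProductMeasure

variable {X Y F : Type*} [MeasurableSpace X] [MeasurableSpace Y] [NormedAddCommGroup F]

theorem ae_memLp_slice {μ : Measure X} {ν : Measure Y} [SFinite μ] [SFinite ν] {f : X × Y → F}
    {q : ENNReal} (hq0 : q ≠ 0) (hq : q ≠ ⊤) (hf : StronglyMeasurable f)
    (hfq : MemLp f q (μ.prod ν)) : ∀ᵐ y ∂ν, MemLp (fun x => f (x, y)) q μ := by
  have h1 := lintegral_rpow_enorm_lt_top_of_eLpNorm_lt_top hq0 hq hfq.2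
  rw [lintegral_prod_symm _ (hf.enorm.pow_const _).aemeasurable] at h1
  have hm : Measurable fun y => ∫⁻ x, ‖f (x, y)‖ₑ ^ q.toReal ∂μ :=
    (hf.enorm.pow_const _).lintegral_prod_left'
  filter_upwards [ae_lt_top hm h1.ne] with y hy
  refine ⟨(hf.comp_measurable measurable_prodMk_right).aestronglyMeasurable, ?_⟩
  rw [eLpNorm_lt_top_iff_lintegral_rpow_enorm_lt_top hq0 hq]
  exact hy

/-- Extension by a constant in the second variable multiplies the norm by a fixed power of the mass
of `ν`, which is finite. -/
theorem tendsto_eLpNorm_comp_fst {μ : Measure X} {ν : Measure Y} [SFinite μ] [IsFiniteMeasure ν]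
    {f : X → F} {g : ℕ → X → F} {q : ENNReal} (hq : q ≠ ⊤)
    (hf : ∀ k, AEStronglyMeasurable (fun x => f x - g k x) μ)
    (h : Tendsto (fun k => eLpNorm (fun x => f x - g k x) q μ) atTop (𝓝 0)) :
    Tendsto (fun k => eLpNorm (fun z : X × Y => f z.1 - g k z.1) q (μ.prod ν)) atTop (𝓝 0) := by
  have e : ∀ k, eLpNorm (fun z : X × Y => f z.1 - g k z.1) q (μ.prod ν)
      = (ν univ) ^ (1 / q).toReal * eLpNorm (fun x => f x - g k x) q μ := by
    intro k
    have hm : AEStronglyMeasurable (fun x => f x - g k x) ((μ.prod ν).map Prod.fst) := by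
      rw [Measure.map_fst_prod]
      exact (hf k).smul_measure _
    have := eLpNorm_map_measure (p := q) hm measurable_fst.aemeasurable
    rw [Measure.map_fst_prod, eLpNorm_smul_measure_of_ne_top hq] at this
    rw [smul_eq_mul] at this
    exact this.symm
  simp_rw [e]
  have := ENNReal.Tendsto.const_mul h
    (Or.inr (ENNReal.rpow_ne_top_of_nonneg (ENNReal.toReal_nonneg (a := 1 / q))
      (measure_ne_top ν univ)))
  rwa [mul_zero] at this

end ProductMeasure

end

/-! ### From the weak formulation to time increments. -/

section

variable {n : ℕ} {Ω : Set (EuclideanSpace ℝ (Fin n))} {T p : ℝ}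
  {u : EuclideanSpace ℝ (Fin n) × ℝ → ℝ}
  {Du : EuclideanSpace ℝ (Fin n) × ℝ → EuclideanSpace ℝ (Fin n)}

/-- Everywhere defined measurable functions `u`, `Du` in `L^p` that vanish off the cylinder. -/
structure IsRepresentative (Ω : Set (EuclideanSpace ℝ (Fin n))) (T p : ℝ)
    (u : EuclideanSpace ℝ (Fin n) × ℝ → ℝ)
    (Du : EuclideanSpace ℝ (Fin n) × ℝ → EuclideanSpace ℝ (Fin n)) : Prop where
  measurable : Measurable u
  measurable_gradient : Measurable Du
  memLp : MemLp u (ENNReal.ofReal p) volume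
  memLp_gradient : MemLp Du (ENNReal.ofReal p) volume
  eq_zero : ∀ z ∉ spaceTimeCylinder Ω T, u z = 0
  gradient_eq_zero : ∀ z ∉ spaceTimeCylinder Ω T, Du z = 0

theorem measurableSet_cylinder (hΩ : IsOpen Ω) : MeasurableSet (spaceTimeCylinder Ω T) :=
  hΩ.measurableSet.prod measurableSet_Ioo

theorem volume_cylinder_ne_top (hvol : volume Ω ≠ ⊤) : volume (spaceTimeCylinder Ω T) ≠ ⊤ := by
  rw [spaceTimeCylinder, Measure.volume_eq_prod, Measure.prod_prod]
  exact ENNReal.mul_ne_top hvol (by simp)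

theorem one_le_conj (hp : 1 < p) : 1 ≤ ENNReal.ofReal (p / (p - 1)) := by
  rw [ENNReal.one_le_ofReal, one_le_div (by linarith)]
  linarith

theorem IsRepresentative.neg (h : IsRepresentative Ω T p u Du) :
    IsRepresentative Ω T p (fun z => -u z) (fun z => -Du z) :=
  ⟨h.measurable.neg, h.measurable_gradient.neg, h.memLp.neg, h.memLp_gradient.neg,
    fun z hz => by rw [h.eq_zero z hz, neg_zero],
    fun z hz => by rw [h.gradient_eq_zero z hz, neg_zero]⟩

theorem IsRepresentative.measurable_b (hp : 1 < p) (h : IsRepresentative Ω T p u Du) :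
    Measurable fun z => b p (u z) := (continuous_b hp).measurable.comp h.measurable

/-- The function `b(u)` lies in `L^{p/(p-1)}` and is supported in a cylinder of finite volume, on
which higher integrability implies integrability. -/
theorem IsRepresentative.integrable_b (hp : 1 < p) (hvol : volume Ω ≠ ⊤)
    (h : IsRepresentative Ω T p u Du) : Integrable fun z => b p (u z) :=
  memLp_one_iff_integrable.1 ((memLp_b hp h.memLp).mono_exponent_of_measure_support_ne_top
    (fun z hz => by rw [h.eq_zero z hz, b_zero]) (volume_cylinder_ne_top hvol) (one_le_conj hp))

theorem IsRepresentative.integrable_flux (hp : 1 < p) (hvol : volume Ω ≠ ⊤)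
    (h : IsRepresentative Ω T p u Du) : Integrable fun z => flux p (Du z) :=
  memLp_one_iff_integrable.1 ((memLp_flux hp h.memLp_gradient).mono_exponent_of_measure_support_ne_top
    (fun z hz => by rw [h.gradient_eq_zero z hz, flux_zero]) (volume_cylinder_ne_top hvol)
    (one_le_conj hp))

theorem isTestFunction_mul_cylinder {ζ : EuclideanSpace ℝ (Fin n) → ℝ} {θ : ℝ → ℝ}
    (hζ : IsTestFunction Ω ζ) (hθ : IsTestFunction (Ioo 0 T) θ) :
    IsTestFunction (spaceTimeCylinder Ω T) fun z => ζ z.1 * θ z.2 := by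
  have hsub : tsupport (fun z : EuclideanSpace ℝ (Fin n) × ℝ => ζ z.1 * θ z.2)
      ⊆ tsupport ζ ×ˢ tsupport θ := by
    refine closure_minimal (fun z hz => ?_)
      ((isClosed_tsupport _).prod (isClosed_tsupport _))
    exact ⟨subset_tsupport _ (left_ne_zero_of_mul hz), subset_tsupport _ (right_ne_zero_of_mul hz)⟩
  exact ⟨(hζ.contDiff.comp contDiff_fst).mul (hθ.contDiff.comp contDiff_snd),
    (hζ.hasCompactSupport.isCompact.prod hθ.hasCompactSupport.isCompact).of_isClosed_subset
      (isClosed_tsupport _) hsub,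
    hsub.trans (prod_mono hζ.tsupport_subset hθ.tsupport_subset)⟩

theorem integrable_bdd_comp_fst_mul {F : EuclideanSpace ℝ (Fin n) × ℝ → ℝ} (hF : Integrable F)
    {ζ : EuclideanSpace ℝ (Fin n) → ℝ} (hζ : Continuous ζ) (hζc : HasCompactSupport ζ) :
    Integrable fun z => F z * ζ z.1 := by
  obtain ⟨C, hC⟩ := hζc.exists_bound_of_continuous hζ
  exact hF.mul_bdd (c := C) (hζ.comp continuous_fst).aestronglyMeasurable
    (Eventually.of_forall fun z => hC z.1)

theorem integrable_inner_bdd_comp_fst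
    {F : EuclideanSpace ℝ (Fin n) × ℝ → EuclideanSpace ℝ (Fin n)} (hF : Integrable F)
    {ζ : EuclideanSpace ℝ (Fin n) → EuclideanSpace ℝ (Fin n)} (hζ : Continuous ζ)
    (hζc : HasCompactSupport ζ) :
    Integrable fun z => inner ℝ (F z) (ζ z.1) := by
  obtain ⟨C, hC⟩ := hζc.exists_bound_of_continuous hζ
  refine (hF.norm.mul_const C).mono'
    (hF.1.inner (hζ.comp continuous_fst).aestronglyMeasurable)
    (Eventually.of_forall fun z => ?_)
  exact (norm_inner_le_norm _ _).trans (mul_le_mul_of_nonneg_left (hC z.1) (norm_nonneg _))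

/-- The equation tested with a product, integrated in space. -/
theorem IsRepresentative.weak_deriv (hp : 1 < p) (hvol : volume Ω ≠ ⊤)
    (h : IsRepresentative Ω T p u Du)
    (heq : ∀ γ : EuclideanSpace ℝ (Fin n) × ℝ → ℝ, IsTestFunction (spaceTimeCylinder Ω T) γ →
      ∫ z in spaceTimeCylinder Ω T,
        (-(b p (u z)) * deriv (fun t => γ (z.1, t)) z.2
          + inner ℝ (flux p (Du z)) (gradient (fun x => γ (x, z.2)) z.1)) = 0)
    {ζ : EuclideanSpace ℝ (Fin n) → ℝ} (hζ : IsTestFunction Ω ζ)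
    {θ : ℝ → ℝ} (hθ : IsTestFunction (Ioo 0 T) θ) :
    ∫ t, (∫ x, b p (u (x, t)) * ζ x) * deriv θ t
      = ∫ t, (∫ x, inner ℝ (flux p (Du (x, t))) (gradient ζ x)) * θ t := by
  have h1 := heq _ (isTestFunction_mul_cylinder hζ hθ)
  have e1 : ∀ z : EuclideanSpace ℝ (Fin n) × ℝ,
      (-(b p (u z)) * deriv (fun t => ζ z.1 * θ t) z.2
          + inner ℝ (flux p (Du z)) (gradient (fun x => ζ x * θ z.2) z.1))
        = inner ℝ (flux p (Du z)) (gradient ζ z.1) * θ z.2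
          - b p (u z) * ζ z.1 * deriv θ z.2 := by
    intro z
    have e2 : gradient (fun x => ζ x * θ z.2) z.1 = θ z.2 • gradient ζ z.1 := by
      rw [gradient_mul (hζ.differentiableAt _) (differentiableAt_const _), gradient_fun_const,
        smul_zero, zero_add]
    rw [deriv_const_mul _ (hθ.differentiableAt _), e2, inner_smul_right]
    ring
  simp only [e1] at h1
  rw [setIntegral_eq_integral_of_forall_compl_eq_zero (fun z hz => by
    rw [h.eq_zero z hz, h.gradient_eq_zero z hz, b_zero, flux_zero, inner_zero_left]; ring)] at h1
  have hd : Continuous (deriv θ) := hθ.contDiff.continuous_deriv (by simp)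
  obtain ⟨C, hC⟩ := hθ.hasCompactSupport.exists_bound_of_continuous hθ.contDiff.continuous
  obtain ⟨C', hC'⟩ := hθ.hasCompactSupport.deriv.exists_bound_of_continuous hd
  have i1 : Integrable fun z : EuclideanSpace ℝ (Fin n) × ℝ =>
      inner ℝ (flux p (Du z)) (gradient ζ z.1) * θ z.2 :=
    (integrable_inner_bdd_comp_fst (h.integrable_flux hp hvol) (continuous_gradient hζ.contDiff)
      (hasCompactSupport_gradient hζ.hasCompactSupport)).mul_bdd (c := C)
      (hθ.contDiff.continuous.comp continuous_snd).aestronglyMeasurable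
      (Eventually.of_forall fun z => hC z.2)
  have i2 : Integrable fun z : EuclideanSpace ℝ (Fin n) × ℝ =>
      b p (u z) * ζ z.1 * deriv θ z.2 :=
    (integrable_bdd_comp_fst_mul (h.integrable_b hp hvol) hζ.contDiff.continuous
      hζ.hasCompactSupport).mul_bdd (c := C') (hd.comp continuous_snd).aestronglyMeasurable
      (Eventually.of_forall fun z => hC' z.2)
  rw [integral_sub i1 i2, sub_eq_zero] at h1
  rw [Measure.volume_eq_prod] at h1 i1 i2
  rw [integral_prod_symm _ i1, integral_prod_symm _ i2] at h1
  simp only [integral_mul_const] at h1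
  exact h1.symm

/-- Time increments of a solution tested with a fixed test function. -/
theorem IsRepresentative.ae_increment_test (hT : 0 < T) (hp : 1 < p)
    (hvol : volume Ω ≠ ⊤) (h : IsRepresentative Ω T p u Du)
    (heq : ∀ γ : EuclideanSpace ℝ (Fin n) × ℝ → ℝ, IsTestFunction (spaceTimeCylinder Ω T) γ →
      ∫ z in spaceTimeCylinder Ω T,
        (-(b p (u z)) * deriv (fun t => γ (z.1, t)) z.2
          + inner ℝ (flux p (Du z)) (gradient (fun x => γ (x, z.2)) z.1)) = 0)
    {ζ : EuclideanSpace ℝ (Fin n) → ℝ} (hζ : IsTestFunction Ω ζ) (s : ℝ) :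
    ∀ᵐ t, t ∈ Ioo 0 T → t - s ∈ Ioo 0 T →
      (∫ x, b p (u (x, t)) * ζ x) - (∫ x, b p (u (x, t - s)) * ζ x)
        + ∫ r in (0 : ℝ)..s, ∫ x, inner ℝ (flux p (Du (x, t - r))) (gradient ζ x) = 0 := by
  have i1 := integrable_bdd_comp_fst_mul (h.integrable_b hp hvol) hζ.contDiff.continuous
    hζ.hasCompactSupport
  have i2 := integrable_inner_bdd_comp_fst (h.integrable_flux hp hvol)
    (continuous_gradient hζ.contDiff) (hasCompactSupport_gradient hζ.hasCompactSupport)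
  rw [Measure.volume_eq_prod] at i1 i2
  have i3 := i2.integral_prod_right
  obtain ⟨C, hC⟩ := exists_const_of_weak_deriv hT i1.integral_prod_right i3
    fun θ hθ => h.weak_deriv hp hvol heq hζ hθ
  have hC' := (measurePreserving_sub_right volume s).quasiMeasurePreserving.ae hC
  filter_upwards [hC, hC'] with t h1 h2 ht hts
  -- The constant is the same at `t` and at `t - s`, so subtraction leaves the integral over `(t -
  -- s, t)`, which the substitution below writes over `(0, s)`.
  have e1 := h1 ht
  have e2 := h2 hts
  have e3 := intervalIntegral.integral_comp_sub_left (a := 0) (b := s)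
    (fun r => ∫ x, inner ℝ (flux p (Du (x, r))) (gradient ζ x)) t
  rw [sub_zero] at e3
  rw [e3]
  have e4 := intervalIntegral.integral_add_adjacent_intervals (μ := volume)
    (i3.intervalIntegrable (a := 0) (b := t - s)) (i3.intervalIntegrable (a := t - s) (b := t))
  simp only at e1 e2 e4
  linarith

/-- Time increments of a solution tested with all of `W_0^{1,p}(Ω)`. -/
theorem IsRepresentative.ae_increment (hT : 0 < T) (hp : 1 < p)
    (hvol : volume Ω ≠ ⊤) (h : IsRepresentative Ω T p u Du)
    (heq : ∀ γ : EuclideanSpace ℝ (Fin n) × ℝ → ℝ, IsTestFunction (spaceTimeCylinder Ω T) γ →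
      ∫ z in spaceTimeCylinder Ω T,
        (-(b p (u z)) * deriv (fun t => γ (z.1, t)) z.2
          + inner ℝ (flux p (Du z)) (gradient (fun x => γ (x, z.2)) z.1)) = 0)
    {s : ℝ} (hs : 0 < s) :
    ∀ᵐ t, t ∈ Ioo 0 T → t - s ∈ Ioo 0 T → ∀ f g, HasSobolevGradientZero Ω p f g →
      (∫ x in Ω, (b p (u (x, t)) - b p (u (x, t - s))) * f x)
        + ∫ r in (0 : ℝ)..s, ∫ x in Ω, inner ℝ (flux p (Du (x, t - r))) (g x) = 0 := by
  have := holderConjugate_ofReal hp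
  have hQ0 : ENNReal.ofReal (p / (p - 1)) ≠ 0 := (zero_lt_one.trans_le (one_le_conj hp)).ne'
  obtain ⟨ζ, hζ, hdense⟩ := exists_countable_dense_test Ω hp
  -- A single null set of times serves the whole dense sequence. Later the test function depends on
  -- `t` itself, so the exceptional set must not depend on it.
  have h1 := ae_all_iff.2 fun j => h.ae_increment_test hT hp hvol heq (hζ j) s
  have hslice : ∀ᵐ t : ℝ, MemLp (fun x => b p (u (x, t))) (ENNReal.ofReal (p / (p - 1))) volume :=
    ae_memLp_slice hQ0 ENNReal.ofReal_ne_top (h.measurable_b hp).stronglyMeasurable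
      (memLp_b hp h.memLp)
  have hslice' := (measurePreserving_sub_right volume s).quasiMeasurePreserving.ae hslice
  filter_upwards [h1, hslice, hslice'] with t h1 h2 h2' ht hts f g hfg
  obtain ⟨j, hj1, hj2⟩ := hdense f g hfg
  have hbt : MemLp (fun x => b p (u (x, t)) - b p (u (x, t - s))) (ENNReal.ofReal (p / (p - 1)))
      (volume.restrict Ω) := (h2.sub h2').restrict Ω
  have t1 := tendsto_integral_bilin (ContinuousLinearMap.mul ℝ ℝ).flip
    (fun k => (hζ (j k)).memLp _) hfg.memLp hbt hj1
  -- The double integral of the flux is treated as one pairing on `Ω × (0, s)`, so that convergence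
  -- of the gradients in `L^p(Ω)` passes to the limit at once.
  set ν : Measure ℝ := volume.restrict (Ioc 0 s) with hν
  have hA : MemLp (fun z : EuclideanSpace ℝ (Fin n) × ℝ => flux p (Du (z.1, t - z.2)))
      (ENNReal.ofReal (p / (p - 1))) ((volume.restrict Ω).prod ν) := by
    have hmp : MeasurePreserving (fun z : EuclideanSpace ℝ (Fin n) × ℝ => (z.1, t - z.2))
        (volume.prod volume) (volume.prod volume) :=
      (MeasurePreserving.id volume).prod (Measure.measurePreserving_sub_left volume t)
    have := (memLp_flux hp h.memLp_gradient).comp_measurePreserving hmp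
    rw [hν, Measure.prod_restrict]
    exact this.restrict _
  have t2 := tendsto_integral_bilin (innerSL ℝ).flip (μ := (volume.restrict Ω).prod ν)
    (f := fun k (z : EuclideanSpace ℝ (Fin n) × ℝ) => gradient (ζ (j k)) z.1)
    (f₀ := fun z => g z.1) (fun k => ((hζ (j k)).memLp_gradient _).comp_fst ν)
    (hfg.memLp_gradient.comp_fst ν) hA
    (tendsto_eLpNorm_comp_fst ENNReal.ofReal_ne_top
      (fun k => (hfg.memLp_gradient.sub ((hζ (j k)).memLp_gradient _)).1) hj2)
  have hiter : ∀ G : EuclideanSpace ℝ (Fin n) → EuclideanSpace ℝ (Fin n),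
      MemLp G (ENNReal.ofReal p) (volume.restrict Ω) →
      ∫ z, inner ℝ (flux p (Du (z.1, t - z.2))) (G z.1) ∂((volume.restrict Ω).prod ν)
        = ∫ r in (0 : ℝ)..s, ∫ x in Ω, inner ℝ (flux p (Du (x, t - r))) (G x) := by
    intro G hG
    rw [intervalIntegral.integral_of_le hs.le, integral_prod_symm]
    exact memLp_bilin (innerSL ℝ).flip (hG.comp_fst ν) hA
  simp only [ContinuousLinearMap.flip_apply, innerSL_apply_apply, ContinuousLinearMap.mul_apply'] at t1 t2
  rw [hiter g hfg.memLp_gradient] at t2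
  refine tendsto_nhds_unique (t1.add t2) (tendsto_const_nhds.congr fun k => ?_)
  rw [hiter _ ((hζ (j k)).memLp_gradient _)]
  have e1 := h1 (j k) ht hts
  have e2 : ∀ r, ∫ x in Ω, inner ℝ (flux p (Du (x, t - r))) (gradient (ζ (j k)) x)
      = ∫ x, inner ℝ (flux p (Du (x, t - r))) (gradient (ζ (j k)) x) := fun r =>
    setIntegral_eq_integral_of_forall_compl_eq_zero fun x hx => by
      rw [(hζ (j k)).gradient_eq_zero_of_notMem hx, inner_zero_right]
  have e3 : ∫ x in Ω, (b p (u (x, t)) - b p (u (x, t - s))) * ζ (j k) x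
      = (∫ x, b p (u (x, t)) * ζ (j k) x) - ∫ x, b p (u (x, t - s)) * ζ (j k) x := by
    have hζE : MemLp (ζ (j k)) (ENNReal.ofReal p) volume :=
      (hζ (j k)).contDiff.continuous.memLp_of_hasCompactSupport (hζ (j k)).hasCompactSupport
    rw [setIntegral_eq_integral_of_forall_compl_eq_zero fun x hx => by
      rw [(hζ (j k)).eq_zero_of_notMem hx, mul_zero]]
    have i1 : Integrable fun x => b p (u (x, t)) * ζ (j k) x :=
      memLp_bilin (ContinuousLinearMap.mul ℝ ℝ).flip hζE h2
    have i2 : Integrable fun x => b p (u (x, t - s)) * ζ (j k) x :=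
      memLp_bilin (ContinuousLinearMap.mul ℝ ℝ).flip hζE h2'
    rw [← integral_sub i1 i2]
    simp only [sub_mul]
  simp_rw [e2, e3]
  exact e1.symm

end

section

/-! ### Time shifts, averages and difference quotients. -/

section Shift

variable {n : ℕ} {F : Type*} [NormedAddCommGroup F] [InnerProductSpace ℝ F] {P Q : ENNReal}
  {A V : EuclideanSpace ℝ (Fin n) × ℝ → F}

theorem measurePreserving_time_shift (r : ℝ) :
    MeasurePreserving (fun z : EuclideanSpace ℝ (Fin n) × ℝ => (z.1, z.2 - r)) volume volume :=
  (MeasurePreserving.id volume).prod (measurePreserving_sub_right volume r)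

/-- A shear in the plane of shift and time; it gives joint integrability in the shift `r`, needed to
exchange the integrals over `r` and `t`. -/
theorem measurePreserving_time_shift_prod (ν : Measure ℝ) [SFinite ν] :
    MeasurePreserving (fun q : ℝ × (EuclideanSpace ℝ (Fin n) × ℝ) => (q.1, (q.2.1, q.2.2 - q.1)))
      (ν.prod volume) (ν.prod volume) :=
  (MeasurePreserving.id ν).skew_product (g := fun r (z : EuclideanSpace ℝ (Fin n) × ℝ) => (z.1, z.2 - r))
    (by fun_prop) (Eventually.of_forall fun r => (measurePreserving_time_shift r).map_eq)

theorem integrable_shift_pairing [P.HolderConjugate Q] (hA : MemLp A Q volume)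
    (hV : MemLp V P volume) (ν : Measure ℝ) [IsFiniteMeasure ν] :
    Integrable (fun q : ℝ × (EuclideanSpace ℝ (Fin n) × ℝ) => inner ℝ (A (q.2.1, q.2.2 - q.1)) (V q.2))
      (ν.prod volume) :=
  memLp_bilin (innerSL ℝ).flip (hV.comp_snd ν)
    ((hA.comp_snd ν).comp_measurePreserving (measurePreserving_time_shift_prod ν))

theorem integrable_shift_pairing_space [P.HolderConjugate Q] (hA : MemLp A Q volume)
    (hV : MemLp V P volume) (ν : Measure ℝ) [IsFiniteMeasure ν] :
    Integrable (fun q : ℝ × ℝ => ∫ x, inner ℝ (A (x, q.2 - q.1)) (V (x, q.2)))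
      (ν.prod volume) := by
  have hmp : MeasurePreserving (fun q : (ℝ × ℝ) × EuclideanSpace ℝ (Fin n) => (q.1.1, (q.2, q.1.2)))
      ((ν.prod volume).prod volume) (ν.prod (volume.prod volume)) :=
    ((MeasurePreserving.id ν).prod Measure.measurePreserving_swap).comp
      (measurePreserving_prodAssoc ν volume volume)
  exact (hmp.integrable_comp_of_integrable (integrable_shift_pairing hA hV ν)).integral_prod_left

theorem integral_shift_pairing [P.HolderConjugate Q] (hA : MemLp A Q volume)
    (hV : MemLp V P volume) (ν : Measure ℝ) [IsFiniteMeasure ν] :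
    ∫ t, ∫ r, (∫ x, inner ℝ (A (x, t - r)) (V (x, t))) ∂ν
      = ∫ r, (∫ z : EuclideanSpace ℝ (Fin n) × ℝ, inner ℝ (A (z.1, z.2 - r)) (V z)) ∂ν := by
  rw [← integral_integral_swap (integrable_shift_pairing_space hA hV ν)]
  refine integral_congr_ae (Eventually.of_forall fun r => ?_)
  have h : Integrable (fun z : EuclideanSpace ℝ (Fin n) × ℝ => inner ℝ (A (z.1, z.2 - r)) (V z)) :=
    memLp_bilin (innerSL ℝ).flip hV (hA.comp_measurePreserving (measurePreserving_time_shift r))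
  rw [Measure.volume_eq_prod] at h ⊢
  exact (integral_prod_symm _ h).symm

/-- The shift acts on the factor in `L^Q`, where translations are continuous; the other factor is
fixed in the dual exponent. -/
theorem tendsto_shift_pairing [P.HolderConjugate Q] (hQ1 : 1 ≤ Q) (hQ : Q ≠ ⊤)
    (hA : MemLp A Q volume) (hV : MemLp V P volume) :
    Tendsto (fun r : ℝ => ∫ z : EuclideanSpace ℝ (Fin n) × ℝ, inner ℝ (A (z.1, z.2 - r)) (V z)) (𝓝 0)
      (𝓝 (∫ z, inner ℝ (A z) (V z))) := by
  have : Q.HolderConjugate P := inferInstance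
  have : (volume : Measure (EuclideanSpace ℝ (Fin n) × ℝ)).IsAddHaarMeasure :=
    inferInstanceAs ((volume.prod volume).IsAddHaarMeasure)
  have h1 := tendsto_eLpNorm_sub_translate (volume : Measure (EuclideanSpace ℝ (Fin n) × ℝ)) hQ1 hQ hA
  have h2 : Tendsto (fun r : ℝ => ((0 : EuclideanSpace ℝ (Fin n)), r)) (𝓝 0) (𝓝 0) :=
    (Continuous.prodMk_right (0 : EuclideanSpace ℝ (Fin n))).tendsto' _ _ rfl
  have h3 := h1.comp h2
  refine tendsto_integral_bilin (innerSL ℝ) (fun r => hA.comp_measurePreserving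
    (measurePreserving_time_shift r)) hA hV (h3.congr fun r => ?_)
  refine (eLpNorm_congr_norm_ae (Eventually.of_forall fun z => ?_))
  rw [← norm_neg]
  simp [Prod.sub_def]

theorem tendsto_average {J : ℝ → ℝ} {L : ℝ} (hJ : Tendsto J (𝓝 0) (𝓝 L))
    (hJi : ∀ s, IntervalIntegrable J volume 0 s) :
    Tendsto (fun s : ℝ => s⁻¹ * ∫ r in (0 : ℝ)..s, J r) (𝓝[>] 0) (𝓝 L) := by
  rw [Metric.tendsto_nhds]
  intro ε hε
  have h1 := (Metric.tendsto_nhds.1 hJ (ε / 2) (half_pos hε))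
  obtain ⟨ρ, hρ, h2⟩ := Metric.eventually_nhds_iff.1 h1
  filter_upwards [Ioo_mem_nhdsGT hρ] with s hs
  have h3 : ‖∫ r in (0 : ℝ)..s, (J r - L)‖ ≤ ε / 2 * |s - 0| :=
    intervalIntegral.norm_integral_le_of_norm_le_const fun r hr => by
      rw [uIoc_of_le hs.1.le] at hr
      have := h2 (y := r) (by
        rw [Real.dist_0_eq_abs, abs_of_pos hr.1]; exact hr.2.trans_lt hs.2)
      exact this.le
  rw [intervalIntegral.integral_sub (hJi s) (by simp), intervalIntegral.integral_const, sub_zero,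
    smul_eq_mul] at h3
  have e : s⁻¹ * (∫ r in (0 : ℝ)..s, J r) - L = s⁻¹ * ((∫ r in (0 : ℝ)..s, J r) - s * L) := by
    field_simp [hs.1.ne']
  rw [Real.dist_eq, e, abs_mul, abs_inv, abs_of_pos hs.1]
  rw [abs_of_pos hs.1, Real.norm_eq_abs] at h3
  calc s⁻¹ * |(∫ r in (0 : ℝ)..s, J r) - s * L| ≤ s⁻¹ * (ε / 2 * s) :=
        mul_le_mul_of_nonneg_left h3 (inv_nonneg.2 hs.1.le)
    _ = ε / 2 := by field_simp [hs.1.ne']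
    _ < ε := half_lt_self hε

end Shift

/-- The difference quotient falls on the smooth `κ`, so nothing beyond integrability of `e` is
needed: the mean value theorem supplies the majorant `sup |κ'| · |e|`. -/
theorem tendsto_integral_difference_quotient {U : Set ℝ} {κ e : ℝ → ℝ} (hκ : IsTestFunction U κ)
    (he : Integrable e) :
    Tendsto (fun s : ℝ => s⁻¹ * ∫ t, (κ (t + s) - κ t) * e t) (𝓝[>] 0)
      (𝓝 (∫ t, deriv κ t * e t)) := by
  have hd : Continuous (deriv κ) := hκ.contDiff.continuous_deriv (by simp)
  obtain ⟨C, hC⟩ := hκ.hasCompactSupport.deriv.exists_bound_of_continuous hd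
  have hcont := hκ.contDiff.continuous
  have key := tendsto_integral_filter_of_dominated_convergence (μ := volume) (l := 𝓝[>] (0 : ℝ))
    (F := fun s t => s⁻¹ * (κ (t + s) - κ t) * e t) (f := fun t => deriv κ t * e t)
    (fun t => C * |e t|)
    (Eventually.of_forall fun s => by
      have : Continuous fun t => s⁻¹ * (κ (t + s) - κ t) := by fun_prop
      exact this.aestronglyMeasurable.mul he.1)
    (by
      filter_upwards [self_mem_nhdsWithin] with s (hs : 0 < s)
      refine Eventually.of_forall fun t => ?_
      have h1 : ‖κ (t + s) - κ t‖ ≤ C * ‖t + s - t‖ :=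
        Convex.norm_image_sub_le_of_norm_deriv_le (fun x _ => hκ.differentiableAt x)
          (fun x _ => hC x) convex_univ (mem_univ _) (mem_univ _)
      rw [add_sub_cancel_left, Real.norm_of_nonneg hs.le] at h1
      rw [norm_mul, norm_mul, norm_inv, Real.norm_of_nonneg hs.le, Real.norm_eq_abs (e t)]
      refine mul_le_mul_of_nonneg_right ?_ (abs_nonneg _)
      rw [inv_mul_le_iff₀ hs]; linarith)
    (he.abs.const_mul C)
    (Eventually.of_forall fun t => by
      have h2 := ((hκ.differentiableAt t).hasDerivAt.tendsto_slope_zero_right)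
      simp only [smul_eq_mul] at h2
      exact h2.mul_const _)
  refine key.congr fun s => ?_
  rw [← integral_const_mul]
  simp only [mul_assoc]

end

/-! ### The entropy inequality against a function of space. -/

section

variable {n : ℕ} {Ω : Set (EuclideanSpace ℝ (Fin n))} {T p : ℝ}
  {u : EuclideanSpace ℝ (Fin n) × ℝ → ℝ}
  {Du : EuclideanSpace ℝ (Fin n) × ℝ → EuclideanSpace ℝ (Fin n)}

/-- Representatives whose time increments satisfy the equation, tested with `W_0^{1,p}(Ω)`. -/
structure IsIncremental (Ω : Set (EuclideanSpace ℝ (Fin n))) (T p : ℝ)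
    (u : EuclideanSpace ℝ (Fin n) × ℝ → ℝ)
    (Du : EuclideanSpace ℝ (Fin n) × ℝ → EuclideanSpace ℝ (Fin n)) : Prop
    extends IsRepresentative Ω T p u Du where
  ae_increment : ∀ s : ℝ, 0 < s → ∀ᵐ t, t ∈ Ioo 0 T → t - s ∈ Ioo 0 T → ∀ f g,
    HasSobolevGradientZero Ω p f g →
      (∫ x in Ω, (b p (u (x, t)) - b p (u (x, t - s))) * f x)
        + ∫ r in (0 : ℝ)..s, ∫ x in Ω, inner ℝ (flux p (Du (x, t - r))) (g x) = 0

/-- The nonlinearities are odd, so the equation is invariant under a change of sign. This lets the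
second solution, negated, play the role of the first in the entropy inequality. -/
theorem IsIncremental.neg (h : IsIncremental Ω T p u Du) :
    IsIncremental Ω T p (fun z => -u z) (fun z => -Du z) := by
  refine ⟨h.toIsRepresentative.neg, fun s hs => ?_⟩
  filter_upwards [h.ae_increment s hs] with t ht h1 h2 f g hfg
  have h3 := ht h1 h2 f g hfg
  simp only [b_neg, flux_neg, inner_neg_left, integral_neg, intervalIntegral.integral_neg]
  have e : ∀ x, (-b p (u (x, t)) - -b p (u (x, t - s))) * f x
      = -((b p (u (x, t)) - b p (u (x, t - s))) * f x) := fun x => by ring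
  simp only [e, integral_neg]
  linarith

/-- A function of the space variable, extended to the cylinder. -/
theorem isRepresentative_of_space {w : EuclideanSpace ℝ (Fin n) → ℝ}
    {Dw : EuclideanSpace ℝ (Fin n) → EuclideanSpace ℝ (Fin n)}
    (hw : Measurable w) (hDw : Measurable Dw) (hwp : MemLp w (ENNReal.ofReal p) volume)
    (hDwp : MemLp Dw (ENNReal.ofReal p) volume) (hw0 : ∀ x ∉ Ω, w x = 0)
    (hDw0 : ∀ x ∉ Ω, Dw x = 0) :
    IsRepresentative Ω T p (fun z => (Ioo 0 T).indicator (fun _ => w z.1) z.2)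
      (fun z => (Ioo 0 T).indicator (fun _ => Dw z.1) z.2) := by
  have hS : MeasurableSet {z : EuclideanSpace ℝ (Fin n) × ℝ | z.2 ∈ Ioo 0 T} :=
    measurable_snd measurableSet_Ioo
  have hr : (volume : Measure (EuclideanSpace ℝ (Fin n) × ℝ)).restrict {z | z.2 ∈ Ioo 0 T}
      = volume.prod (volume.restrict (Ioo 0 T)) := by
    have := Measure.prod_restrict (μ := (volume : Measure (EuclideanSpace ℝ (Fin n))))
      (ν := (volume : Measure ℝ)) univ (Ioo 0 T)
    rw [Measure.restrict_univ] at this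
    rw [this, Measure.volume_eq_prod]
    congr 1
    ext z; simp
  have h1 : MemLp ({z : EuclideanSpace ℝ (Fin n) × ℝ | z.2 ∈ Ioo 0 T}.indicator fun z => w z.1)
      (ENNReal.ofReal p) volume := by
    rw [memLp_indicator_iff_restrict hS, hr]
    exact hwp.comp_fst _
  have h2 : MemLp ({z : EuclideanSpace ℝ (Fin n) × ℝ | z.2 ∈ Ioo 0 T}.indicator fun z => Dw z.1)
      (ENNReal.ofReal p) volume := by
    rw [memLp_indicator_iff_restrict hS, hr]
    exact hDwp.comp_fst _
  refine ⟨(hw.comp measurable_fst).indicator hS, (hDw.comp measurable_fst).indicator hS,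
    h1, h2, fun z hz => ?_, fun z hz => ?_⟩
  · refine indicator_apply_eq_zero.2 fun h => hw0 _ fun h' => hz ⟨h', h⟩
  · refine indicator_apply_eq_zero.2 fun h => hDw0 _ fun h' => hz ⟨h', h⟩

theorem measurable_entropy {w : EuclideanSpace ℝ (Fin n) × ℝ → ℝ}
    (hp : 1 < p) (δ : ℝ) (hw : Measurable w) (hu : Measurable u) :
    Measurable fun z => entropy p δ (w z) (u z) :=
  (continuous_entropy hp).measurable.comp (f := fun z => ((δ, w z, u z) : ℝ × ℝ × ℝ))
    (measurable_const.prodMk (hw.prodMk hu))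

set_option maxHeartbeats 1000000 in
/-- Entropy inequality for a solution, compared with a function of the space variable. -/
theorem IsIncremental.entropy_inequality (hp : 1 < p) (hvol : volume Ω ≠ ⊤)
    (hT : 0 < T)
    (h : IsIncremental Ω T p u Du) {w : EuclideanSpace ℝ (Fin n) → ℝ}
    {Dw : EuclideanSpace ℝ (Fin n) → EuclideanSpace ℝ (Fin n)}
    (hw : Measurable w) (hDw : Measurable Dw) (hwp : MemLp w (ENNReal.ofReal p) volume)
    (hDwp : MemLp Dw (ENNReal.ofReal p) volume) (hw0 : ∀ x ∉ Ω, w x = 0)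
    (hDw0 : ∀ x ∉ Ω, Dw x = 0) {κ : ℝ → ℝ} (hκ : IsTestFunction (Ioo 0 T) κ)
    (hκ0 : ∀ t, 0 ≤ κ t) {δ : ℝ} (hδ : 0 < δ)
    (hzero : ∀ᵐ t, κ t ≠ 0 → HasSobolevGradientZero Ω p
      (fun x => smoothStep δ (u (x, t) - w x))
      (fun x => deriv (smoothStep δ) (u (x, t) - w x) • (Du (x, t) - Dw x))) :
    ∫ z, inner ℝ (flux p (Du z))
        (deriv (smoothStep δ) (u z - w z.1) • (Du z - Dw z.1)) * κ z.2
      ≤ ∫ z, entropy p δ (w z.1) (u z) * deriv κ z.2 := by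
  have := holderConjugate_ofReal hp
  have hW := isRepresentative_of_space (T := T) hw hDw hwp hDwp hw0 hDw0
  set W : EuclideanSpace ℝ (Fin n) × ℝ → ℝ :=
    fun z => (Ioo 0 T).indicator (fun _ => w z.1) z.2 with hWd
  set DW : EuclideanSpace ℝ (Fin n) × ℝ → EuclideanSpace ℝ (Fin n) :=
    fun z => (Ioo 0 T).indicator (fun _ => Dw z.1) z.2 with hDWd
  have hWt : ∀ x t, t ∈ Ioo 0 T → W (x, t) = w x := fun x t ht => indicator_of_mem ht _
  have hDWt : ∀ x t, t ∈ Ioo 0 T → DW (x, t) = Dw x := fun x t ht => indicator_of_mem ht _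
  have hκT : ∀ t, κ t ≠ 0 → t ∈ Ioo 0 T := fun t ht => hκ.tsupport_subset (subset_tsupport _ ht)
  have hκT' : ∀ t, deriv κ t ≠ 0 → t ∈ Ioo 0 T := fun t ht =>
    hκ.tsupport_subset (support_deriv_subset ht)
  obtain ⟨a, c, ha, hac, hc, hsupp⟩ := hκ.exists_Icc hT
  obtain ⟨M, hM⟩ := exists_deriv_smoothStep_le δ
  have hcd : Continuous (deriv (smoothStep δ)) :=
    (contDiff_smoothStep δ).continuous_deriv (by simp)
  obtain ⟨C, hC⟩ := hκ.hasCompactSupport.exists_bound_of_continuous hκ.contDiff.continuous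
  obtain ⟨C', hC'⟩ := hκ.hasCompactSupport.deriv.exists_bound_of_continuous
    (hκ.contDiff.continuous_deriv (by simp))
  -- the vector field paired with the flux
  set V : EuclideanSpace ℝ (Fin n) × ℝ → EuclideanSpace ℝ (Fin n) :=
    fun z => κ z.2 • (deriv (smoothStep δ) (u z - W z) • (Du z - DW z)) with hVd
  have hV : MemLp V (ENNReal.ofReal p) volume :=
    memLp_deriv_comp_smul (f := Prod.snd) hκ.contDiff.continuous hC
      measurable_snd.aestronglyMeasurable
      (memLp_deriv_comp_smul (f := fun z => u z - W z) hcd hM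
        (h.measurable.sub hW.measurable).aestronglyMeasurable
        (h.memLp_gradient.sub hW.memLp_gradient))
  have hA := memLp_flux hp h.memLp_gradient
  -- the entropy
  set e : EuclideanSpace ℝ (Fin n) × ℝ → ℝ := fun z => entropy p δ (W z) (u z) with hed
  have hem : Measurable e := measurable_entropy hp δ hW.measurable h.measurable
  have hei : Integrable e := by
    refine ((h.integrable_b hp hvol).abs.add (hW.integrable_b hp hvol).abs).mono'
      hem.aestronglyMeasurable (Eventually.of_forall fun z => abs_entropy_le hp hδ.le _ _)
  have hbi := h.integrable_b hp hvol
  rw [Measure.volume_eq_prod] at hei hbi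
  have hEi := hei.integral_prod_right
  have hes : ∀ᵐ t, Integrable fun x => e (x, t) := hei.prod_left_ae
  have hbs : ∀ᵐ t, Integrable fun x => b p (u (x, t)) := hbi.prod_left_ae
  -- the inequality for time increments
  have hineq : ∀ s : ℝ, 0 < s → s < a → ∀ᵐ t,
      κ t * ((∫ x, e (x, t)) - ∫ x, e (x, t - s))
        + ∫ r, (∫ x, inner ℝ (flux p (Du (x, t - r))) (V (x, t)))
            ∂(volume.restrict (Ioc 0 s)) ≤ 0 := by
    intro s hs hsa
    have hq := (measurePreserving_sub_right volume s).quasiMeasurePreserving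
    filter_upwards [h.ae_increment s hs, hzero, hes, hbs, hq.ae hes, hq.ae hbs]
      with t h1 h2 h3 h4 h5 h6
    by_cases hκt : κ t = 0
    · simp [hVd, hκt]
    have htI : t ∈ Icc a c := by
      by_contra hn
      exact hκt (hsupp t hn)
    have ht : t ∈ Ioo 0 T := hκT t hκt
    -- The support of `κ` starts at `a > s`, so the earlier time stays in the interval and `W`
    -- equals `w` at both times.
    have hts : t - s ∈ Ioo 0 T := ⟨by linarith [htI.1], by linarith [htI.2]⟩
    have h7 := h1 ht hts _ _ (h2 hκt)
    -- Convexity replaces a chain rule in time: the increment of the entropy is dominated by that of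
    -- `b(u)` times the step at the later time, which is the test function in `h7`.
    have h8 : (∫ x, e (x, t)) - ∫ x, e (x, t - s)
        ≤ ∫ x in Ω, (b p (u (x, t)) - b p (u (x, t - s))) * smoothStep δ (u (x, t) - w x) := by
      rw [← integral_sub h3 h5, setIntegral_eq_integral_of_forall_compl_eq_zero (fun x hx => by
        rw [h.eq_zero _ fun h' => hx h'.1, hw0 x hx, sub_zero,
          smoothStep_of_nonpos hδ le_rfl, mul_zero])]
      refine integral_mono (h3.sub h5) ((h4.sub h6).mul_bdd (c := 1) ?_ ?_) fun x => ?_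
      · exact ((contDiff_smoothStep δ).continuous.measurable.comp
          ((h.measurable.comp measurable_prodMk_right).sub hw)).aestronglyMeasurable
      · refine Eventually.of_forall fun x => ?_
        rw [Real.norm_of_nonneg (smoothStep_nonneg _ _)]
        exact smoothStep_le_one _ _
      · simp only [hed, hWt x t ht, hWt x _ hts]
        exact entropy_sub_le hp hδ _ _ _
    have h9 : ∫ r, (∫ x, inner ℝ (flux p (Du (x, t - r))) (V (x, t)))
            ∂(volume.restrict (Ioc 0 s))
        = κ t * ∫ r in (0 : ℝ)..s, ∫ x in Ω, inner ℝ (flux p (Du (x, t - r)))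
          (deriv (smoothStep δ) (u (x, t) - w x) • (Du (x, t) - Dw x)) := by
      rw [intervalIntegral.integral_of_le hs.le, ← integral_const_mul]
      congr 1
      ext r
      rw [setIntegral_eq_integral_of_forall_compl_eq_zero (fun x hx => by
        rw [h.gradient_eq_zero _ fun h' => hx h'.1, flux_zero, inner_zero_left]),
        ← integral_const_mul]
      congr 1
      ext x
      simp only [hVd, hWt x t ht, hDWt x t ht]
      rw [inner_smul_right]
    rw [h9]
    have := mul_le_mul_of_nonneg_left h8 (hκ0 t)
    nlinarith [hκ0 t]
  -- integration in time
  have hint : ∀ s : ℝ, 0 < s → s < a →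
      s⁻¹ * (∫ r in (0 : ℝ)..s, ∫ z : EuclideanSpace ℝ (Fin n) × ℝ,
        inner ℝ (flux p (Du (z.1, z.2 - r))) (V z))
        ≤ s⁻¹ * ∫ t, (κ (t + s) - κ t) * ∫ x, e (x, t) := by
    intro s hs hsa
    refine mul_le_mul_of_nonneg_left ?_ (inv_nonneg.2 hs.le)
    have i1 : Integrable fun t => κ t * ∫ x, e (x, t) :=
      hEi.bdd_mul (c := C) hκ.contDiff.continuous.aestronglyMeasurable
        (Eventually.of_forall hC)
    have i2 : Integrable fun t => κ t * ∫ x, e (x, t - s) :=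
      (hEi.comp_sub_right s).bdd_mul (c := C) hκ.contDiff.continuous.aestronglyMeasurable
        (Eventually.of_forall hC)
    have i3 : Integrable fun t => κ (t + s) * ∫ x, e (x, t) :=
      hEi.bdd_mul (c := C) (hκ.contDiff.continuous.comp
        (continuous_add_const s)).aestronglyMeasurable (Eventually.of_forall fun t => hC _)
    have i12 : Integrable fun t => κ t * (∫ x, e (x, t)) - κ t * ∫ x, e (x, t - s) := i1.sub i2
    have i4 : Integrable fun t => ∫ r, (∫ x, inner ℝ (flux p (Du (x, t - r))) (V (x, t)))
        ∂(volume.restrict (Ioc 0 s)) := (integrable_shift_pairing_space hA hV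
      (volume.restrict (Ioc 0 s))).integral_prod_right
    have h1 := integral_nonpos_of_ae (hineq s hs hsa)
    simp only [mul_sub] at h1
    rw [integral_add i12 i4, integral_sub i1 i2, integral_shift_pairing hA hV] at h1
    -- A discrete integration by parts: the shift moves from the entropy to `κ`.
    have h2 : ∫ t, κ t * ∫ x, e (x, t - s) = ∫ t, κ (t + s) * ∫ x, e (x, t) := by
      rw [← integral_sub_right_eq_self (fun t => κ (t + s) * ∫ x, e (x, t)) s]
      simp
    simp only [sub_mul]
    rw [integral_sub i3 i1, intervalIntegral.integral_of_le hs.le]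
    linarith
  have hJi : ∀ s, IntervalIntegrable (fun r => ∫ z : EuclideanSpace ℝ (Fin n) × ℝ,
        inner ℝ (flux p (Du (z.1, z.2 - r))) (V z)) volume 0 s := by
    intro s
    rw [intervalIntegrable_iff]
    have : IsFiniteMeasure (volume.restrict (uIoc 0 s)) := by rw [uIoc]; infer_instance
    exact (integrable_shift_pairing hA hV (volume.restrict (uIoc 0 s))).integral_prod_left
  -- After division by `s` the flux side is an average over `r ∈ (0, s)` of pairings with the
  -- shifted flux, and these converge to the unshifted one.
  have l1 := tendsto_average (tendsto_shift_pairing (one_le_conj hp) ENNReal.ofReal_ne_top hA hV) hJi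
  have l2 := tendsto_integral_difference_quotient hκ hEi
  have hfin := le_of_tendsto_of_tendsto l1 l2 (by
    filter_upwards [Ioo_mem_nhdsGT ha] with s hs using hint s hs.1 hs.2)
  have r1 : ∫ z, inner ℝ (flux p (Du z)) (V z) = ∫ z, inner ℝ (flux p (Du z))
        (deriv (smoothStep δ) (u z - w z.1) • (Du z - Dw z.1)) * κ z.2 := by
    congr 1
    ext ⟨x, t⟩
    simp only [hVd]
    by_cases hκt : κ t = 0
    · simp [hκt]
    · rw [hWt x t (hκT t hκt), hDWt x t (hκT t hκt), inner_smul_right, mul_comm]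
  have r2 : ∫ t, deriv κ t * ∫ x, e (x, t) = ∫ z, entropy p δ (w z.1) (u z) * deriv κ z.2 := by
    have i5 : Integrable (fun z : EuclideanSpace ℝ (Fin n) × ℝ => e z * deriv κ z.2)
        (volume.prod volume) :=
      hei.mul_bdd (c := C') ((hκ.contDiff.continuous_deriv (by simp)).comp
        continuous_snd).aestronglyMeasurable (Eventually.of_forall fun z => hC' z.2)
    have e1 : ∀ z : EuclideanSpace ℝ (Fin n) × ℝ,
        entropy p δ (w z.1) (u z) * deriv κ z.2 = e z * deriv κ z.2 := by
      rintro ⟨x, t⟩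
      by_cases hκt : deriv κ t = 0
      · simp [hκt]
      · simp only [hed]
        rw [hWt x t (hκT' t hκt)]
    simp only [e1]
    rw [Measure.volume_eq_prod, integral_prod_symm _ i5]
    simp only [integral_mul_const]
    congr 1
    ext t
    ring
  rw [← r1, ← r2]
  exact hfin

end

/-! ### Doubling the time variable. -/

section

section TripleProduct

variable {X : Type*} [MeasurableSpace X] {F : Type*} [NormedAddCommGroup F] {P : ENNReal}
  {m : Measure X} {ν : Measure ℝ}

theorem measurePreserving_assoc_swap [SFinite m] [SFinite ν] :
    MeasurePreserving (fun q : (X × ℝ) × ℝ => (q.1.1, (q.2, q.1.2))) ((m.prod ν).prod ν)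
      (m.prod (ν.prod ν)) :=
  ((MeasurePreserving.id m).prod Measure.measurePreserving_swap).comp
      (measurePreserving_prodAssoc m ν ν)

theorem memLp_triple_left [SFinite m] [IsFiniteMeasure ν] {f : X × ℝ → F} (hf : MemLp f P (m.prod ν)) :
    MemLp (fun q : X × (ℝ × ℝ) => f (q.1, q.2.1)) P (m.prod (ν.prod ν)) :=
  (hf.comp_fst ν).comp_measurePreserving
    (MeasurePreserving.symm _ (measurePreserving_prodAssoc m ν ν))

theorem memLp_triple_right [SFinite m] [IsFiniteMeasure ν] {f : X × ℝ → F} (hf : MemLp f P (m.prod ν)) :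
    MemLp (fun q : X × (ℝ × ℝ) => f (q.1, q.2.2)) P (m.prod (ν.prod ν)) :=
  (memLp_triple_left hf).comp_measurePreserving
    ((MeasurePreserving.id m).prod Measure.measurePreserving_swap)

variable {G : X × (ℝ × ℝ) → ℝ} [SFinite m] [SFinite ν]

/-- An inequality known for almost every frozen second time becomes one over `Ω × (0,T) × (0,T)`;
`integral_triple_right` does the same with the first time frozen. On the common space the two
inequalities can be added. -/
theorem integral_triple_left (hG : Integrable G (m.prod (ν.prod ν))) :
    ∫ q, G q ∂(m.prod (ν.prod ν)) = ∫ s, (∫ z, G (z.1, (z.2, s)) ∂(m.prod ν)) ∂ν := by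
  have hmp := measurePreserving_prodAssoc m ν ν
  have h := hmp.integrable_comp_of_integrable hG
  rw [← hmp.map_eq, integral_map hmp.measurable.aemeasurable (by rw [hmp.map_eq]; exact hG.1)]
  exact integral_prod_symm _ h

theorem integral_triple_right (hG : Integrable G (m.prod (ν.prod ν))) :
    ∫ q, G q ∂(m.prod (ν.prod ν)) = ∫ t, (∫ z, G (z.1, (t, z.2)) ∂(m.prod ν)) ∂ν := by
  have hmp := measurePreserving_assoc_swap (m := m) (ν := ν)
  have h := hmp.integrable_comp_of_integrable hG
  rw [← hmp.map_eq, integral_map hmp.measurable.aemeasurable (by rw [hmp.map_eq]; exact hG.1)]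
  exact integral_prod_symm _ h

theorem integrable_triple_left (hG : Integrable G (m.prod (ν.prod ν))) :
    Integrable (fun s => ∫ z, G (z.1, (z.2, s)) ∂(m.prod ν)) ν :=
  ((measurePreserving_prodAssoc m ν ν).integrable_comp_of_integrable hG).integral_prod_right

theorem integrable_triple_right (hG : Integrable G (m.prod (ν.prod ν))) :
    Integrable (fun t => ∫ z, G (z.1, (t, z.2)) ∂(m.prod ν)) ν :=
  ((measurePreserving_assoc_swap (m := m) (ν := ν)).integrable_comp_of_integrable
    hG).integral_prod_right

end TripleProduct

variable {n : ℕ} {Ω : Set (EuclideanSpace ℝ (Fin n))} {T p : ℝ}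
  {u v : EuclideanSpace ℝ (Fin n) × ℝ → ℝ}
  {Du Dv : EuclideanSpace ℝ (Fin n) × ℝ → EuclideanSpace ℝ (Fin n)}

theorem restrict_cylinder : (volume : Measure (EuclideanSpace ℝ (Fin n) × ℝ)).restrict
    (spaceTimeCylinder Ω T) = (volume.restrict Ω).prod (volume.restrict (Ioo 0 T)) := by
  rw [Measure.prod_restrict, Measure.volume_eq_prod, spaceTimeCylinder]

theorem entropy_zero_zero (hp : 1 < p) {δ : ℝ} (hδ : 0 ≤ δ) : entropy p δ 0 0 = 0 :=
  le_antisymm ((entropy_le hp hδ 0 0).trans (by simp)) (entropy_nonneg _ _ _)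

/-- `entropy_inequality` with the space function a time slice. -/
theorem IsIncremental.entropy_inequality_slice (hp : 1 < p) (hvol : volume Ω ≠ ⊤) (hT : 0 < T)
    (hu : IsIncremental Ω T p u Du) (hv : IsRepresentative Ω T p v Dv) {δ : ℝ} (hδ : 0 < δ)
    {κ : ℝ → ℝ → ℝ} (hκ : ∀ s, IsTestFunction (Ioo 0 T) (κ s)) (hκ0 : ∀ s t, 0 ≤ κ s t)
    {S₁ S₂ : Set ℝ} (hS₁ : ∀ᵐ t, t ∈ S₁) (hS₂ : ∀ᵐ s, s ∈ S₂)
    (hzero : ∀ t ∈ S₁, ∀ s ∈ S₂, κ s t ≠ 0 → HasSobolevGradientZero Ω p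
      (fun x => smoothStep δ (u (x, t) - v (x, s)))
      (fun x => deriv (smoothStep δ) (u (x, t) - v (x, s)) • (Du (x, t) - Dv (x, s)))) :
    ∀ᵐ s, ∫ z in spaceTimeCylinder Ω T, inner ℝ (flux p (Du z))
        (deriv (smoothStep δ) (u z - v (z.1, s)) • (Du z - Dv (z.1, s))) * κ s z.2
      ≤ ∫ z in spaceTimeCylinder Ω T, entropy p δ (v (z.1, s)) (u z) * deriv (κ s) z.2 := by
  have hP0 : ENNReal.ofReal p ≠ 0 := (zero_lt_one.trans_le (one_le_ofReal hp)).ne'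
  have hsv : ∀ᵐ s : ℝ, MemLp (fun x => v (x, s)) (ENNReal.ofReal p) volume :=
    ae_memLp_slice hP0 ENNReal.ofReal_ne_top hv.measurable.stronglyMeasurable hv.memLp
  have hsD : ∀ᵐ s : ℝ, MemLp (fun x => Dv (x, s)) (ENNReal.ofReal p) volume :=
    ae_memLp_slice hP0 ENNReal.ofReal_ne_top hv.measurable_gradient.stronglyMeasurable
      hv.memLp_gradient
  filter_upwards [hsv, hsD, hS₂] with s h1 h2 h3
  have h4 := hu.entropy_inequality hp hvol hT (w := fun x => v (x, s)) (Dw := fun x => Dv (x, s))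
    (hv.measurable.comp measurable_prodMk_right)
    (hv.measurable_gradient.comp measurable_prodMk_right) h1 h2
    (fun x hx => hv.eq_zero _ fun h' => hx h'.1)
    (fun x hx => hv.gradient_eq_zero _ fun h' => hx h'.1) (hκ s) (hκ0 s) hδ
    (by filter_upwards [hS₁] with t ht hne using hzero t ht s h3 hne)
  rw [setIntegral_eq_integral_of_forall_compl_eq_zero,
    setIntegral_eq_integral_of_forall_compl_eq_zero]
  · exact h4
  · intro z hz
    by_cases hx : z.1 ∈ Ω
    · have : deriv (κ s) z.2 = 0 := by
        by_contra hne
        exact hz ⟨hx, (hκ s).tsupport_subset (support_deriv_subset hne)⟩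
      rw [this, mul_zero]
    · rw [hu.eq_zero z hz, hv.eq_zero (z.1, s) fun h' => hx h'.1, entropy_zero_zero hp hδ.le, zero_mul]
  · intro z hz
    rw [hu.gradient_eq_zero z hz, flux_zero, inner_zero_left, zero_mul]

theorem IsRepresentative.memLp_left (h : IsRepresentative Ω T p u Du) :
    MemLp (fun q : EuclideanSpace ℝ (Fin n) × (ℝ × ℝ) => u (q.1, q.2.1)) (ENNReal.ofReal p)
      ((volume.restrict Ω).prod ((volume.restrict (Ioo 0 T)).prod (volume.restrict (Ioo 0 T)))) :=
  memLp_triple_left (by rw [← restrict_cylinder]; exact h.memLp.restrict _)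

theorem IsRepresentative.memLp_right (h : IsRepresentative Ω T p u Du) :
    MemLp (fun q : EuclideanSpace ℝ (Fin n) × (ℝ × ℝ) => u (q.1, q.2.2)) (ENNReal.ofReal p)
      ((volume.restrict Ω).prod ((volume.restrict (Ioo 0 T)).prod (volume.restrict (Ioo 0 T)))) :=
  memLp_triple_right (by rw [← restrict_cylinder]; exact h.memLp.restrict _)

theorem IsRepresentative.memLp_gradient_left (h : IsRepresentative Ω T p u Du) :
    MemLp (fun q : EuclideanSpace ℝ (Fin n) × (ℝ × ℝ) => Du (q.1, q.2.1)) (ENNReal.ofReal p)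
      ((volume.restrict Ω).prod ((volume.restrict (Ioo 0 T)).prod (volume.restrict (Ioo 0 T)))) :=
  memLp_triple_left (by rw [← restrict_cylinder]; exact h.memLp_gradient.restrict _)

theorem IsRepresentative.memLp_gradient_right (h : IsRepresentative Ω T p u Du) :
    MemLp (fun q : EuclideanSpace ℝ (Fin n) × (ℝ × ℝ) => Du (q.1, q.2.2)) (ENNReal.ofReal p)
      ((volume.restrict Ω).prod ((volume.restrict (Ioo 0 T)).prod (volume.restrict (Ioo 0 T)))) :=
  memLp_triple_right (by rw [← restrict_cylinder]; exact h.memLp_gradient.restrict _)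

theorem integrable_b_of_memLp {α : Type*} [MeasurableSpace α] {μ : Measure α} [IsFiniteMeasure μ]
    (hp : 1 < p) {f : α → ℝ} (hf : MemLp f (ENNReal.ofReal p) μ) :
    Integrable (fun x => b p (f x)) μ :=
  (memLp_b hp hf).integrable (one_le_conj hp)

/-- Integrability of the entropy of two functions. -/
theorem integrable_entropy {α : Type*} [MeasurableSpace α] {μ : Measure α} [IsFiniteMeasure μ]
    (hp : 1 < p) {δ : ℝ} (hδ : 0 ≤ δ) {f g : α → ℝ} (hf : MemLp f (ENNReal.ofReal p) μ)
    (hg : MemLp g (ENNReal.ofReal p) μ) : Integrable (fun x => entropy p δ (f x) (g x)) μ := by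
  refine ((integrable_b_of_memLp hp hg).abs.add (integrable_b_of_memLp hp hf).abs).mono'
    ?_ (Eventually.of_forall fun z => abs_entropy_le hp hδ _ _)
  exact (continuous_entropy hp).comp_aestronglyMeasurable
    (f := fun x => ((δ, f x, g x) : ℝ × ℝ × ℝ))
    (aestronglyMeasurable_const.prodMk (hf.1.prodMk hg.1))

theorem integrable_flux_pairing {α : Type*} [MeasurableSpace α] {μ : Measure α}
    (hp : 1 < p) (δ : ℝ) {D₀ D : α → EuclideanSpace ℝ (Fin n)} {f : α → ℝ}
    (hD₀ : MemLp D₀ (ENNReal.ofReal p) μ) (hD : MemLp D (ENNReal.ofReal p) μ)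
    (hf : AEStronglyMeasurable f μ) :
    Integrable (fun x => inner ℝ (flux p (D₀ x)) (deriv (smoothStep δ) (f x) • D x)) μ := by
  have := holderConjugate_ofReal hp
  obtain ⟨M, hM⟩ := exists_deriv_smoothStep_le δ
  exact memLp_bilin (innerSL ℝ).flip (memLp_deriv_comp_smul
    ((contDiff_smoothStep δ).continuous_deriv (by simp)) hM hf hD) (memLp_flux hp hD₀)

set_option maxHeartbeats 1000000 in
/-- The entropy inequality for two solutions with separate time variables. -/
theorem IsIncremental.doubled_entropy_inequality (hp : 1 < p) (hvol : volume Ω ≠ ⊤) (hT : 0 < T)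
    (hu : IsIncremental Ω T p u Du) (hv : IsIncremental Ω T p v Dv) {δ : ℝ} (hδ : 0 < δ)
    {η η₁ η₂ : ℝ → ℝ → ℝ} (hη₁ : ∀ s, IsTestFunction (Ioo 0 T) fun t => η t s)
    (hη₂ : ∀ t, IsTestFunction (Ioo 0 T) (η t)) (hη0 : ∀ t s, 0 ≤ η t s)
    (hηc : Continuous fun q : ℝ × ℝ => η q.1 q.2)
    (hηc₁ : Continuous fun q : ℝ × ℝ => η₁ q.1 q.2)
    (hηc₂ : Continuous fun q : ℝ × ℝ => η₂ q.1 q.2)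
    {C : ℝ} (hηC : ∀ t s, |η t s| ≤ C) (hηC₁ : ∀ t s, |η₁ t s| ≤ C) (hηC₂ : ∀ t s, |η₂ t s| ≤ C)
    (hd₁ : ∀ t s, deriv (fun t => η t s) t = η₁ t s) (hd₂ : ∀ t s, deriv (η t) s = η₂ t s)
    {S₁ S₂ : Set ℝ} (hS₁ : ∀ᵐ t, t ∈ S₁) (hS₂ : ∀ᵐ s, s ∈ S₂)
    (hzero : ∀ t ∈ S₁, ∀ s ∈ S₂, η t s ≠ 0 → HasSobolevGradientZero Ω p
      (fun x => smoothStep δ (u (x, t) - v (x, s)))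
      (fun x => deriv (smoothStep δ) (u (x, t) - v (x, s)) • (Du (x, t) - Dv (x, s)))) :
    0 ≤ ∫ q : EuclideanSpace ℝ (Fin n) × (ℝ × ℝ),
      (entropy p δ (v (q.1, q.2.2)) (u (q.1, q.2.1)) * η₁ q.2.1 q.2.2
        + entropy p δ (-u (q.1, q.2.1)) (-v (q.1, q.2.2)) * η₂ q.2.1 q.2.2)
      ∂((volume.restrict Ω).prod ((volume.restrict (Ioo 0 T)).prod (volume.restrict (Ioo 0 T)))) := by
  have hfin : IsFiniteMeasure (volume.restrict Ω) := ⟨by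
    rw [Measure.restrict_apply_univ]; exact hvol.lt_top⟩
  have k1 := hu.entropy_inequality_slice hp hvol hT hv.toIsRepresentative hδ hη₁
    (fun s t => hη0 t s) hS₁ hS₂ hzero
  -- Here `-v` evolves in `s` and `-u` is frozen at `t`. Since `-v - (-u) = u - v`, the test
  -- function is the same as in `k1`.
  have k2 := hv.neg.entropy_inequality_slice hp hvol hT hu.neg.toIsRepresentative hδ hη₂
    hη0 hS₂ hS₁ (fun s hs t ht hne => by
      simp only [neg_sub_neg]
      exact hzero t ht s hs hne)
  rw [restrict_cylinder] at k1 k2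
  simp only [hd₁, hd₂, neg_sub_neg] at k1 k2
  have j1 := ae_restrict_of_ae (s := Ioo 0 T) k1
  have j2 := ae_restrict_of_ae (s := Ioo 0 T) k2
  clear k1 k2
  set m := volume.restrict Ω
  set ν := (volume : Measure ℝ).restrict (Ioo 0 T)
  have hbd : ∀ {ζ : ℝ → ℝ → ℝ}, (Continuous fun q : ℝ × ℝ => ζ q.1 q.2) → (∀ t s, |ζ t s| ≤ C) →
      ∀ {G : EuclideanSpace ℝ (Fin n) × (ℝ × ℝ) → ℝ}, Integrable G (m.prod (ν.prod ν)) →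
      Integrable (fun q => G q * ζ q.2.1 q.2.2) (m.prod (ν.prod ν)) := by
    intro ζ h1 h2 G hG
    exact hG.mul_bdd (c := C) (h1.comp continuous_snd).aestronglyMeasurable
      (Eventually.of_forall fun q => h2 _ _)
  have mu := hu.memLp_left
  have mv := hv.memLp_right
  have mDu := hu.memLp_gradient_left
  have mDv := hv.memLp_gradient_right
  have i1 := hbd hηc hηC (integrable_flux_pairing hp δ mDu (mDu.sub mDv) (mu.sub mv).1)
  have i2 := hbd hηc hηC (integrable_flux_pairing hp δ mDv.neg (mDu.sub mDv) (mu.sub mv).1)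
  have i3 := hbd hηc₁ hηC₁ (integrable_entropy hp hδ.le mv mu)
  have i4 := hbd hηc₂ hηC₂ (integrable_entropy hp hδ.le mu.neg mv.neg)
  simp only [Pi.sub_apply, Pi.neg_apply] at i1 i2 i3 i4
  have l1 := integral_mono_ae (integrable_triple_left i1) (integrable_triple_left i3) j1
  have l2 := integral_mono_ae (integrable_triple_right i2) (integrable_triple_right i4) j2
  rw [← integral_triple_left i1, ← integral_triple_left i3] at l1
  rw [← integral_triple_right i2, ← integral_triple_right i4] at l2
  rw [integral_add i3 i4]
  refine le_trans ?_ (add_le_add l1 l2)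
  -- The two flux terms combine to `H_δ'(u - v) η ⟨flux Du - flux Dv, Du - Dv⟩`, a product of
  -- nonnegative factors.
  rw [← integral_add i1 i2]
  refine integral_nonneg fun q => ?_
  have := inner_flux_sub_nonneg hp (Du (q.1, q.2.1)) (Dv (q.1, q.2.2))
  simp only [inner_smul_right, flux_neg, inner_neg_left, inner_sub_left] at this ⊢
  have h0 := mul_nonneg (mul_nonneg (deriv_smoothStep_nonneg hδ (u (q.1, q.2.1) - v (q.1, q.2.2)))
    (hη0 q.2.1 q.2.2)) this
  simp only [Pi.zero_apply]
  nlinarith [h0]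

end

/-! ### The limit `δ → 0`. -/

section

theorem isTestFunction_of_compact {F : Type*} [NormedAddCommGroup F] [NormedSpace ℝ F]
    {U K : Set F} {φ : F → ℝ} (hφ : ContDiff ℝ ∞ φ) (hK : IsCompact K) (hKU : K ⊆ U)
    (h : ∀ x ∉ K, φ x = 0) : IsTestFunction U φ :=
  ⟨hφ, HasCompactSupport.intro hK h, (closure_minimal (fun x hx => by
    by_contra hn
    exact hx (h x hn)) hK.isClosed).trans hKU⟩

variable {n : ℕ} {Ω : Set (EuclideanSpace ℝ (Fin n))} {T p : ℝ}
  {u v : EuclideanSpace ℝ (Fin n) × ℝ → ℝ}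
  {Du Dv : EuclideanSpace ℝ (Fin n) × ℝ → EuclideanSpace ℝ (Fin n)}

set_option maxHeartbeats 1000000 in
/-- The doubled entropy inequality in the limit `δ → 0`. -/
theorem IsIncremental.doubled_inequality (hp : 1 < p) (hvol : volume Ω ≠ ⊤) (hT : 0 < T)
    (hu : IsIncremental Ω T p u Du) (hv : IsIncremental Ω T p v Dv)
    {S₁ S₂ : Set ℝ} (hS₁ : ∀ᵐ t, t ∈ S₁) (hS₂ : ∀ᵐ s, s ∈ S₂) {ρ₀ : ℝ}
    (hzero : ∀ t ∈ S₁, ∀ s ∈ S₂, t ∈ Ioo 0 T → s ∈ Ioo 0 T → |t - s| < ρ₀ → ∀ δ : ℝ, 0 < δ →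
      HasSobolevGradientZero Ω p
      (fun x => smoothStep δ (u (x, t) - v (x, s)))
      (fun x => deriv (smoothStep δ) (u (x, t) - v (x, s)) • (Du (x, t) - Dv (x, s))))
    {χ : ℝ → ℝ} (hχ : IsTestFunction (Ioo 0 T) χ) (hχ0 : ∀ t, 0 ≤ χ t) {a c : ℝ}
    (hsupp : ∀ t ∉ Icc a c, χ t = 0) {ϖ : ℝ → ℝ} (hϖ : ContDiff ℝ ∞ ϖ) (hϖ0 : ∀ r, 0 ≤ ϖ r)
    {ρ : ℝ} (hϖρ : ∀ r, ρ ≤ |r| → ϖ r = 0) (hρ₀ : ρ ≤ ρ₀) (hρa : ρ < a) (hρc : c + ρ < T) :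
    0 ≤ ∫ q : EuclideanSpace ℝ (Fin n) × (ℝ × ℝ),
      max (b p (u (q.1, q.2.1)) - b p (v (q.1, q.2.2))) 0
        * (deriv χ q.2.1 * ϖ (q.2.1 - q.2.2))
      ∂((volume.restrict Ω).prod ((volume.restrict (Ioo 0 T)).prod (volume.restrict (Ioo 0 T)))) := by
  have hfin : IsFiniteMeasure (volume.restrict Ω) := ⟨by
    rw [Measure.restrict_apply_univ]; exact hvol.lt_top⟩
  have hϖc : HasCompactSupport ϖ := HasCompactSupport.intro (isCompact_Icc (a := -ρ) (b := ρ))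
    fun r hr => hϖρ r (by
      by_contra hn
      exact hr (abs_le.1 (not_le.1 hn).le))
  have hχ' : Continuous (deriv χ) := hχ.contDiff.continuous_deriv (by simp)
  have hϖ' : Continuous (deriv ϖ) := hϖ.continuous_deriv (by simp)
  have hχc := hχ.contDiff.continuous
  have hϖcont := hϖ.continuous
  obtain ⟨C₁, hC₁⟩ := hχ.hasCompactSupport.exists_bound_of_continuous hχ.contDiff.continuous
  obtain ⟨C₂, hC₂⟩ := hχ.hasCompactSupport.deriv.exists_bound_of_continuous hχ'
  obtain ⟨C₃, hC₃⟩ := hϖc.exists_bound_of_continuous hϖ.continuous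
  obtain ⟨C₄, hC₄⟩ := hϖc.deriv.exists_bound_of_continuous hϖ'
  simp only [Real.norm_eq_abs] at hC₁ hC₂ hC₃ hC₄
  have p1 : 0 ≤ C₁ := (abs_nonneg _).trans (hC₁ 0)
  have p2 : 0 ≤ C₂ := (abs_nonneg _).trans (hC₂ 0)
  have p3 : 0 ≤ C₃ := (abs_nonneg _).trans (hC₃ 0)
  have p4 : 0 ≤ C₄ := (abs_nonneg _).trans (hC₄ 0)
  set C : ℝ := C₁ * C₃ + C₂ * C₃ + C₁ * C₄ with hC
  have hbd : ∀ {x y A B : ℝ}, |x| ≤ A → |y| ≤ B → 0 ≤ A → |x * y| ≤ A * B := by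
    intro x y A B h1 h2 h3
    rw [abs_mul]
    exact mul_le_mul h1 h2 (abs_nonneg _) h3
  -- With a factor depending only on `t - s`, the sum `∂_t η + ∂_s η` contains no derivative of `ϖ`.
  -- This matters since `ϖ` will be concentrated at `0`.
  set η : ℝ → ℝ → ℝ := fun t s => χ t * ϖ (t - s) with hη
  set η₁ : ℝ → ℝ → ℝ := fun t s => deriv χ t * ϖ (t - s) + χ t * deriv ϖ (t - s) with hη₁
  set η₂ : ℝ → ℝ → ℝ := fun t s => -(χ t * deriv ϖ (t - s)) with hη₂
  have b13 := mul_nonneg p1 p3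
  have b23 := mul_nonneg p2 p3
  have b14 := mul_nonneg p1 p4
  have hηC : ∀ t s, |η t s| ≤ C := fun t s =>
    (hbd (hC₁ t) (hC₃ (t - s)) p1).trans (by linarith)
  have hηC₁ : ∀ t s, |η₁ t s| ≤ C := fun t s =>
    (abs_add_le _ _).trans ((add_le_add (hbd (hC₂ t) (hC₃ (t - s)) p2)
      (hbd (hC₁ t) (hC₄ (t - s)) p1)).trans (by linarith))
  have hηC₂ : ∀ t s, |η₂ t s| ≤ C := fun t s => by
    rw [hη₂, abs_neg]
    exact (hbd (hC₁ t) (hC₄ (t - s)) p1).trans (by linarith)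
  have hϖ₁ : ∀ r, HasDerivAt ϖ (deriv ϖ r) r := fun r =>
    ((hϖ.differentiable (by simp)) r).hasDerivAt
  have hd₁ : ∀ t s, deriv (fun t => η t s) t = η₁ t s := fun t s => by
    have := (hχ.differentiableAt t).hasDerivAt.mul
      ((hϖ₁ (t - s)).comp t ((hasDerivAt_id t).sub_const s))
    simp only [mul_one] at this
    exact this.deriv
  have hd₂ : ∀ t s, deriv (η t) s = η₂ t s := fun t s => by
    have := ((hϖ₁ (t - s)).comp s ((hasDerivAt_id s).const_sub t)).const_mul (χ t)
    simp only [mul_neg, mul_one] at this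
    exact this.deriv
  have ht₁ : ∀ s, IsTestFunction (Ioo 0 T) fun t => η t s := fun s =>
    isTestFunction_of_compact (hχ.contDiff.mul (hϖ.comp (contDiff_id.sub contDiff_const)))
      hχ.hasCompactSupport.isCompact hχ.tsupport_subset fun t ht => by
        rw [hη]; simp only; rw [image_eq_zero_of_notMem_tsupport ht, zero_mul]
  have hclose : ∀ t s, η t s ≠ 0 → t ∈ Icc a c ∧ |t - s| < ρ := fun t s hne =>
    ⟨by by_contra hn; exact left_ne_zero_of_mul hne (hsupp t hn),
      by by_contra hn; exact right_ne_zero_of_mul hne (hϖρ _ (not_lt.1 hn))⟩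
  -- The margins `ρ < a` and `c + ρ < T` keep the second time inside the interval.
  have ht₂ : ∀ t, IsTestFunction (Ioo 0 T) (η t) := fun t =>
    isTestFunction_of_compact (contDiff_const.mul (hϖ.comp (contDiff_const.sub contDiff_id)))
      (isCompact_Icc (a := a - ρ) (b := c + ρ))
      (fun s hs => ⟨by linarith [hs.1], by linarith [hs.2]⟩) fun s hs => by
        by_contra hne
        obtain ⟨h1, h2⟩ := hclose t s hne
        rw [abs_lt] at h2
        exact hs ⟨by linarith [h1.1], by linarith [h1.2]⟩
  have hineq : ∀ δ : ℝ, 0 < δ → _ := fun δ hδ =>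
    hu.doubled_entropy_inequality hp hvol hT hv hδ ht₁ ht₂
    (fun t s => mul_nonneg (hχ0 t) (hϖ0 _)) (by fun_prop) (by fun_prop) (by fun_prop)
    hηC hηC₁ hηC₂ hd₁ hd₂ hS₁ hS₂ fun t ht s hs hne => by
      obtain ⟨h1, h2⟩ := hclose t s hne
      have h3 := abs_lt.1 h2
      have : 0 ≤ ρ := (abs_nonneg _).trans h2.le
      exact hzero t ht s hs ⟨by linarith [h1.1], by linarith [h1.2]⟩
        ⟨by linarith [h1.1], by linarith [h1.2]⟩ (h2.trans_le hρ₀) δ hδ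
  set μ := (volume.restrict Ω).prod
    (((volume : Measure ℝ).restrict (Ioo 0 T)).prod ((volume : Measure ℝ).restrict (Ioo 0 T)))
  have mu := hu.memLp_left
  have mv := hv.memLp_right
  have hcu := integrable_b_of_memLp hp mu
  have hcv := integrable_b_of_memLp hp mv
  have hη₁c : Continuous fun q : ℝ × ℝ => η₁ q.1 q.2 := by fun_prop
  have hη₂c : Continuous fun q : ℝ × ℝ => η₂ q.1 q.2 := by fun_prop
  have hlim := tendsto_integral_filter_of_dominated_convergence (μ := μ) (l := 𝓝[>] (0 : ℝ))
    (F := fun δ q => entropy p δ (v (q.1, q.2.2)) (u (q.1, q.2.1)) * η₁ q.2.1 q.2.2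
        + entropy p δ (-u (q.1, q.2.1)) (-v (q.1, q.2.2)) * η₂ q.2.1 q.2.2)
    (f := fun q => max (b p (u (q.1, q.2.1)) - b p (v (q.1, q.2.2))) 0
        * (deriv χ q.2.1 * ϖ (q.2.1 - q.2.2)))
    (fun q => (|b p (u (q.1, q.2.1))| + |b p (v (q.1, q.2.2))|) * C
      + (|b p (u (q.1, q.2.1))| + |b p (v (q.1, q.2.2))|) * C)
    (by
      filter_upwards [self_mem_nhdsWithin] with δ (hδ : 0 < δ)
      exact ((integrable_entropy hp hδ.le mv mu).1.mul
        (hη₁c.comp continuous_snd).aestronglyMeasurable).add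
        ((integrable_entropy hp hδ.le mu.neg mv.neg).1.mul
        (hη₂c.comp continuous_snd).aestronglyMeasurable))
    (by
      filter_upwards [self_mem_nhdsWithin] with δ (hδ : 0 < δ)
      refine Eventually.of_forall fun q => (abs_add_le _ _).trans (add_le_add ?_ ?_)
      · exact hbd (abs_entropy_le hp hδ.le _ _) (hηC₁ _ _) (by positivity)
      · refine hbd ((abs_entropy_le hp hδ.le _ _).trans ?_) (hηC₂ _ _) (by positivity)
        rw [b_neg, b_neg, abs_neg, abs_neg, add_comm])
    (((hcu.abs.add hcv.abs).mul_const C).add ((hcu.abs.add hcv.abs).mul_const C))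
    (Eventually.of_forall fun q => by
      have hc : ∀ w z, Tendsto (fun δ => entropy p δ w z) (𝓝[>] 0)
          (𝓝 (max (b p z - b p w) 0)) := fun w z => by
        have h1 : Continuous fun δ : ℝ => entropy p δ w z :=
          (continuous_entropy hp).comp (g := fun a : ℝ × ℝ × ℝ => entropy p a.1 a.2.1 a.2.2)
            (f := fun δ => (δ, w, z)) (by fun_prop)
        rw [← entropy_zero_left]
        exact (h1.tendsto 0).mono_left nhdsWithin_le_nhds
      have h2 := ((hc (v (q.1, q.2.2)) (u (q.1, q.2.1))).mul_const (η₁ q.2.1 q.2.2)).add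
        ((hc (-u (q.1, q.2.1)) (-v (q.1, q.2.2))).mul_const (η₂ q.2.1 q.2.2))
      -- By oddness of `b` the second entropy has the same limit as the first, so the common factor
      -- can be taken out and the derivatives of `ϖ` cancel.
      rw [b_neg, b_neg, neg_sub_neg, ← mul_add] at h2
      convert h2 using 3
      simp only [hη₁, hη₂]
      ring)
  refine ge_of_tendsto hlim ?_
  filter_upwards [self_mem_nhdsWithin] with δ hδ using hineq δ hδ

end

/-! ### Return to the diagonal and the `L¹` contraction. -/

section

variable {n : ℕ} {Ω : Set (EuclideanSpace ℝ (Fin n))} {T p : ℝ}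
  {u v : EuclideanSpace ℝ (Fin n) × ℝ → ℝ}
  {Du Dv : EuclideanSpace ℝ (Fin n) × ℝ → EuclideanSpace ℝ (Fin n)}

/-- The coordinates are the time difference `r = t - s`, the point `x` and the time `t`; in them the
weight `ϖ(t - s)` depends on `r` alone. -/
theorem measurePreserving_time_difference :
    MeasurePreserving (fun q : ℝ × (EuclideanSpace ℝ (Fin n) × ℝ) => (q.2.1, (q.2.2, q.2.2 - q.1)))
      (volume.prod volume) (volume.prod (volume.prod volume)) := by
  have h1 : MeasurePreserving (fun q : ℝ × ℝ => (q.1, q.1 - q.2)) (volume.prod volume)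
      (volume.prod volume) :=
    (MeasurePreserving.id volume).skew_product (g := fun t r : ℝ => t - r)
      (measurable_fst.sub measurable_snd) (Eventually.of_forall fun t =>
        (Measure.measurePreserving_sub_left volume t).map_eq)
  exact (((MeasurePreserving.id volume).prod h1).comp
    (measurePreserving_prodAssoc volume volume volume)).comp Measure.measurePreserving_swap

theorem integral_time_difference {g : EuclideanSpace ℝ (Fin n) × (ℝ × ℝ) → ℝ}
    (hg : Integrable g (volume.prod (volume.prod volume))) :
    Integrable (fun r : ℝ => ∫ z : EuclideanSpace ℝ (Fin n) × ℝ, g (z.1, (z.2, z.2 - r))) ∧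
    ∫ q, g q ∂(volume.prod (volume.prod volume))
      = ∫ r : ℝ, ∫ z : EuclideanSpace ℝ (Fin n) × ℝ, g (z.1, (z.2, z.2 - r)) := by
  have hmp := measurePreserving_time_difference (n := n)
  have h := hmp.integrable_comp_of_integrable hg
  refine ⟨h.integral_prod_left, ?_⟩
  rw [← hmp.map_eq, integral_map hmp.measurable.aemeasurable (by rw [hmp.map_eq]; exact hg.1)]
  exact integral_prod _ h

theorem abs_max_sub_max_le (x y z : ℝ) : |max (x - y) 0 - max (x - z) 0| ≤ |y - z| :=
  (abs_max_sub_max_le_abs _ _ _).trans (by rw [sub_sub_sub_cancel_left, abs_sub_comm])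

set_option maxHeartbeats 1000000 in
/-- The `L¹` contraction property, in the weak form. -/
theorem IsIncremental.integral_max_nonneg (hp : 1 < p) (hvol : volume Ω ≠ ⊤)
    (hT : 0 < T) (hu : IsIncremental Ω T p u Du) (hv : IsIncremental Ω T p v Dv)
    {S₁ S₂ : Set ℝ} (hS₁ : ∀ᵐ t, t ∈ S₁) (hS₂ : ∀ᵐ s, s ∈ S₂) {ρ₀ : ℝ} (hρ₀ : 0 < ρ₀)
    (hzero : ∀ t ∈ S₁, ∀ s ∈ S₂, t ∈ Ioo 0 T → s ∈ Ioo 0 T → |t - s| < ρ₀ → ∀ δ : ℝ, 0 < δ →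
      HasSobolevGradientZero Ω p
      (fun x => smoothStep δ (u (x, t) - v (x, s)))
      (fun x => deriv (smoothStep δ) (u (x, t) - v (x, s)) • (Du (x, t) - Dv (x, s))))
    {χ : ℝ → ℝ} (hχ : IsTestFunction (Ioo 0 T) χ) (hχ0 : ∀ t, 0 ≤ χ t) :
    0 ≤ ∫ z, max (b p (u z) - b p (v z)) 0 * deriv χ z.2 := by
  have hfin : IsFiniteMeasure (volume.restrict Ω) := ⟨by
    rw [Measure.restrict_apply_univ]; exact hvol.lt_top⟩
  obtain ⟨a, c, ha, hac, hc, hsupp⟩ := hχ.exists_Icc hT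
  have hχ' : Continuous (deriv χ) := hχ.contDiff.continuous_deriv (by simp)
  obtain ⟨C, hC⟩ := hχ.hasCompactSupport.deriv.exists_bound_of_continuous hχ'
  have hbu := hu.integrable_b hp hvol
  have hbv := hv.integrable_b hp hvol
  set J : ℝ → ℝ := fun r => ∫ z : EuclideanSpace ℝ (Fin n) × ℝ,
    max (b p (u z) - b p (v (z.1, z.2 - r))) 0 * deriv χ z.2 with hJ
  have hJ0 : J 0 = ∫ z, max (b p (u z) - b p (v z)) 0 * deriv χ z.2 := by
    simp only [hJ, sub_zero]
  have hshift : ∀ r : ℝ, Integrable fun z : EuclideanSpace ℝ (Fin n) × ℝ =>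
      b p (v (z.1, z.2 - r)) := fun r =>
    (measurePreserving_time_shift r).integrable_comp_of_integrable hbv
  have hJi : ∀ r : ℝ, Integrable fun z : EuclideanSpace ℝ (Fin n) × ℝ =>
      max (b p (u z) - b p (v (z.1, z.2 - r))) 0 * deriv χ z.2 := fun r =>
    ((hbu.sub (hshift r)).pos_part).mul_bdd (c := C)
      (hχ'.comp continuous_snd).aestronglyMeasurable (Eventually.of_forall fun z => hC z.2)
  -- The positive part is 1-Lipschitz, so `|J r - J 0|` is at most `sup |χ'|` times the `L¹`
  -- distance between `b(v)` and its time shift.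
  have hJlim : Tendsto J (𝓝 0) (𝓝 (J 0)) := by
    have : (volume : Measure (EuclideanSpace ℝ (Fin n) × ℝ)).IsAddHaarMeasure :=
      inferInstanceAs ((volume.prod volume).IsAddHaarMeasure)
    have h1 := tendsto_eLpNorm_sub_translate (volume : Measure (EuclideanSpace ℝ (Fin n) × ℝ))
      le_rfl ENNReal.one_ne_top (memLp_one_iff_integrable.2 hbv)
    have h2 : Tendsto (fun r : ℝ => ((0 : EuclideanSpace ℝ (Fin n)), r)) (𝓝 0) (𝓝 0) :=
      (Continuous.prodMk_right (0 : EuclideanSpace ℝ (Fin n))).tendsto' _ _ rfl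
    have h3 := (ENNReal.tendsto_toReal ENNReal.zero_ne_top).comp (h1.comp h2)
    have h4 : ∀ r : ℝ, (eLpNorm (fun z => b p (v (z - ((0 : EuclideanSpace ℝ (Fin n)), r)))
        - b p (v z)) 1 volume).toReal = ∫ z : EuclideanSpace ℝ (Fin n) × ℝ,
          |b p (v (z.1, z.2 - r)) - b p (v z)| := by
      intro r
      have h5 : (fun z => b p (v (z - ((0 : EuclideanSpace ℝ (Fin n)), r))) - b p (v z))
          = fun z => b p (v (z.1, z.2 - r)) - b p (v z) := by
        ext z; simp [Prod.sub_def]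
      rw [h5, eLpNorm_one_eq_lintegral_enorm]
      exact (integral_norm_eq_lintegral_enorm ((hshift r).sub hbv).1).symm
    have h6 : Tendsto (fun r : ℝ => (∫ z : EuclideanSpace ℝ (Fin n) × ℝ,
          |b p (v (z.1, z.2 - r)) - b p (v z)|) * C) (𝓝 0) (𝓝 0) := by
      have h7 := h3.mul_const C
      simp only [ENNReal.toReal_zero, zero_mul] at h7
      exact h7.congr fun r => by simp only [Function.comp]; rw [h4]
    refine tendsto_iff_norm_sub_tendsto_zero.2 (squeeze_zero (fun _ => norm_nonneg _)
      (fun r => ?_) h6)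
    rw [hJ0, hJ, ← integral_sub (hJi r) (by simpa using hJi 0), ← integral_mul_const]
    refine norm_integral_le_of_norm_le (((hshift r).sub hbv).abs.mul_const C)
      (Eventually.of_forall fun z => ?_)
    rw [← sub_mul, norm_mul]
    exact mul_le_mul (abs_max_sub_max_le _ _ _) (hC _) (norm_nonneg _) (abs_nonneg _)
  rw [← hJ0]
  -- If `J 0 < 0`, then `J < J 0 / 2` near `0`, and a bump concentrated there makes the integral of
  -- `J` against it negative, contrary to `key`.
  by_contra! hneg
  have hev := hJlim.eventually (gt_mem_nhds (show J 0 < J 0 / 2 by linarith))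
  obtain ⟨ρ₁, hρ₁, hev⟩ := Metric.eventually_nhds_iff.1 hev
  -- The four bounds ensure, in order: `J < J 0 / 2`, admissibility of the truncated difference, and
  -- room at the two ends of the time interval.
  set ρ := min (min ρ₁ ρ₀) (min (a / 2) ((T - c) / 2)) with hρ
  have hρpos : 0 < ρ := by
    refine lt_min (lt_min hρ₁ hρ₀) (lt_min (by linarith) (by linarith))
  have hρle₁ : ρ ≤ ρ₁ := (min_le_left _ _).trans (min_le_left _ _)
  have hρle₀ : ρ ≤ ρ₀ := (min_le_left _ _).trans (min_le_right _ _)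
  have hρlea : ρ ≤ a / 2 := (min_le_right _ _).trans (min_le_left _ _)
  have hρlec : ρ ≤ (T - c) / 2 := (min_le_right _ _).trans (min_le_right _ _)
  let β : ContDiffBump (0 : ℝ) := ⟨ρ / 2, ρ, by linarith, by linarith⟩
  have hβρ : ∀ r, ρ ≤ |r| → β r = 0 := fun r hr =>
    β.zero_of_le_dist (by rw [Real.dist_0_eq_abs]; exact hr)
  have hβcont : Continuous fun r => β r := β.continuous
  have key := hu.doubled_inequality hp hvol hT hv hS₁ hS₂ hzero hχ hχ0 hsupp (ϖ := fun r => β r)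
    β.contDiff (fun r => β.nonneg) hβρ hρle₀ (by linarith) (by linarith)
  set g : EuclideanSpace ℝ (Fin n) × (ℝ × ℝ) → ℝ := fun q =>
    max (b p (u (q.1, q.2.1)) - b p (v (q.1, q.2.2))) 0
        * (deriv χ q.2.1 * β (q.2.1 - q.2.2)) with hg
  have hgi : Integrable g ((volume.restrict Ω).prod
      ((volume.restrict (Ioo 0 T)).prod (volume.restrict (Ioo 0 T)))) := by
    refine (((integrable_b_of_memLp hp hu.memLp_left).sub
      (integrable_b_of_memLp hp hv.memLp_right)).pos_part).mul_bdd (c := C * 1) ?_ ?_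
    · have : Continuous fun q : EuclideanSpace ℝ (Fin n) × (ℝ × ℝ) =>
        deriv χ q.2.1 * β (q.2.1 - q.2.2) := by fun_prop
      exact this.aestronglyMeasurable
    · refine Eventually.of_forall fun q => ?_
      rw [norm_mul]
      refine mul_le_mul (hC _) ?_ (norm_nonneg _) ((norm_nonneg _).trans (hC 0))
      rw [Real.norm_of_nonneg β.nonneg]
      exact β.le_one
  -- Vanishing off the product domain allows integration over the whole space, where the change to
  -- time differences is available.
  have hg0 : ∀ q ∉ Ω ×ˢ (Ioo 0 T ×ˢ Ioo 0 T), g q = 0 := by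
    intro q hq
    by_contra hne
    have h1 := left_ne_zero_of_mul hne
    have h2 := left_ne_zero_of_mul (right_ne_zero_of_mul hne)
    have h3 := right_ne_zero_of_mul (right_ne_zero_of_mul hne)
    have h4 : q.2.1 ∈ Ioo 0 T := hχ.tsupport_subset (support_deriv_subset h2)
    have h5 : q.2.1 ∈ Icc a c := by
      have h6 : tsupport χ ⊆ Icc a c := closure_minimal (fun t ht => by
        by_contra hn
        exact ht (hsupp t hn)) isClosed_Icc
      exact h6 (support_deriv_subset h2)
    have h7 : |q.2.1 - q.2.2| < ρ := by
      by_contra hn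
      exact h3 (hβρ _ (not_lt.1 hn))
    rw [abs_lt] at h7
    have h8 : q.2.2 ∈ Ioo 0 T := ⟨by linarith [h5.1], by linarith [h5.2]⟩
    have h9 : q.1 ∉ Ω := fun h => hq ⟨h, h4, h8⟩
    rw [hu.eq_zero _ fun h => h9 h.1, hv.eq_zero _ fun h => h9 h.1] at h1
    simp at h1
  rw [Measure.prod_restrict, Measure.prod_restrict] at hgi key
  have hgi' : Integrable g (volume.prod (volume.prod volume)) :=
    (integrableOn_iff_integrable_of_support_subset fun q hq => by
      by_contra hn
      exact hq (hg0 q hn)).1 hgi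
  rw [setIntegral_eq_integral_of_forall_compl_eq_zero hg0] at key
  obtain ⟨hI, hE⟩ := integral_time_difference hgi'
  have hin : ∀ r : ℝ, ∫ z : EuclideanSpace ℝ (Fin n) × ℝ, g (z.1, (z.2, z.2 - r)) = J r * β r := by
    intro r
    simp only [hg, hJ, sub_sub_cancel]
    rw [← integral_mul_const]
    simp only [mul_assoc]
  rw [hE] at key
  simp only [hin] at key hI
  have h1 : ∫ r, J r * β r ≤ ∫ r, J 0 / 2 * β r := by
    refine integral_mono hI ((hβcont.integrable_of_hasCompactSupport
      β.hasCompactSupport).const_mul _) fun r => ?_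
    simp only
    by_cases hr : |r| < ρ
    · exact mul_le_mul_of_nonneg_right
        (hev (by rw [Real.dist_0_eq_abs]; exact hr.trans_le hρle₁)).le β.nonneg
    · rw [hβρ r (not_lt.1 hr), mul_zero, mul_zero]
  rw [integral_const_mul] at h1
  have h2 : 0 < ∫ r, β r := β.integral_pos
  nlinarith

end

/-! ### Weakly nonincreasing functions with zero initial limit. -/

section

/-- The mass `M` of `κ` is compared with an equal mass placed near time `0`, before the support of
`κ`. The primitive of `M B - κ` is nonnegative and compactly supported, so the hypothesis gives `∫ F
κ ≤ M ∫ F B`, and the right side is small because `F` is small near `0`. -/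
theorem integral_mul_le_of_tendsto_zero {F : ℝ → ℝ} {T : ℝ} (hFi : Integrable F)
    (hF : ∀ χ : ℝ → ℝ, IsTestFunction (Ioo 0 T) χ → (∀ t, 0 ≤ χ t) → 0 ≤ ∫ t, F t * deriv χ t)
    (hF0 : Tendsto F (𝓝[>] 0 ⊓ ae volume) (𝓝 0)) {κ : ℝ → ℝ} (hκ : ContDiff ℝ ∞ κ)
    (hκ0 : ∀ t, 0 ≤ κ t) {θ c : ℝ} (hθ : 0 < θ) (hθc : θ ≤ c) (hc : c < T)
    (hκs : ∀ t ∉ Icc θ c, κ t = 0) : ∫ t, F t * κ t ≤ 0 := by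
  have hκc : HasCompactSupport κ := HasCompactSupport.intro isCompact_Icc hκs
  have hκi : Integrable κ := hκ.continuous.integrable_of_hasCompactSupport hκc
  set M := ∫ t, κ t with hM
  have hM0 : 0 ≤ M := integral_nonneg hκ0
  refine le_of_forall_pos_le_add fun η₀ hη₀ => ?_
  -- The summand `1` covers the case `M = 0` and still gives `M η ≤ η₀`.
  set η := η₀ / (M + 1) with hη
  have hηpos : 0 < η := by positivity
  have hev : ∀ᶠ t in 𝓝[>] (0 : ℝ) ⊓ ae volume, F t < η := hF0.eventually (gt_mem_nhds hηpos)
  -- Membership in the infimum of filters splits into a right neighbourhood of `0` and a set of full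
  -- measure, which together force `F < η`.
  obtain ⟨s₁, hs₁, s₂, hs₂, hss⟩ := mem_inf_iff_superset.1 hev
  obtain ⟨τ₀, hτ₀, hsub⟩ := mem_nhdsGT_iff_exists_Ioo_subset.1 hs₁
  rw [mem_Ioi] at hτ₀
  set τ := min τ₀ θ with hτ
  have hτpos : 0 < τ := lt_min hτ₀ hθ
  have hττ₀ : τ ≤ τ₀ := min_le_left _ _
  have hτθ : τ ≤ θ := min_le_right _ _
  let β : ContDiffBump (τ / 2) := ⟨τ / 8, τ / 4, by linarith, by linarith⟩
  set B : ℝ → ℝ := β.normed volume with hB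
  have hBc : ContDiff ℝ ∞ B := β.contDiff_normed
  have hB0 : ∀ t, 0 ≤ B t := fun t => β.nonneg_normed t
  have hBs : ∀ t ∉ Ioo (τ / 4) (3 * τ / 4), B t = 0 := by
    intro t ht
    by_contra hne
    have h1 : t ∈ Function.support B := hne
    rw [hB, β.support_normed_eq, Real.ball_eq_Ioo] at h1
    exact ht ⟨by have := h1.1; simp only [β] at this; linarith,
      by have := h1.2; simp only [β] at this; linarith⟩
  have hB1 : ∫ t, B t = 1 := β.integral_normed
  have hBi : Integrable B := hBc.continuous.integrable_of_hasCompactSupport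
    (β.hasCompactSupport_normed)
  set φ : ℝ → ℝ := fun t => M * B t - κ t with hφ
  have hφc : ContDiff ℝ ∞ φ := (contDiff_const.mul hBc).sub hκ
  have hφi : Integrable φ := (hBi.const_mul M).sub hκi
  have hac : τ / 4 ≤ c := by linarith
  have hleft : ∀ t ≤ τ / 4, φ t = 0 := fun t ht => by
    simp only [hφ]
    rw [hBs t (fun h => by linarith [h.1]), hκs t (fun h => by linarith [h.1])]; ring
  have hright : ∀ t, c < t → φ t = 0 := fun t ht => by
    simp only [hφ]
    rw [hBs t (fun h => by linarith [h.2]), hκs t (fun h => by linarith [h.2])]; ring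
  have hsupp : ∀ t ∉ Icc (τ / 4) c, φ t = 0 := fun t ht => by
    rcases lt_or_ge t (τ / 4) with h | h
    · exact hleft t h.le
    · exact hright t (not_le.1 fun h' => ht ⟨h, h'⟩)
  have htot : ∫ t in (τ / 4)..c, φ t = 0 := by
    rw [intervalIntegral.integral_of_le hac, setIntegral_eq_integral_of_forall_compl_eq_zero]
    · rw [hφ, integral_sub (hBi.const_mul M) hκi, integral_const_mul, hB1, mul_one, sub_self]
    · intro t ht
      rcases le_or_gt t (τ / 4) with h | h
      · exact hleft t h
      · exact hright t (not_le.1 fun h' => ht ⟨h, h'⟩)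
  have hχ := isTestFunction_primitive (U := Ioo 0 T) hac
    (fun t ht => ⟨by linarith [ht.1], by linarith [ht.2]⟩) hφc hsupp htot
  have hint : ∀ x y, IntervalIntegrable φ volume x y := fun x y => hφi.intervalIntegrable
  -- Up to `θ` only the nonnegative bump contributes, apart from one point. Beyond `θ` the total
  -- integral being zero, the primitive equals the remaining integral of `κ`.
  have hχ0 : ∀ t, 0 ≤ ∫ s in (τ / 4)..t, φ s := by
    intro t
    rcases le_total t (τ / 4) with h | h
    · rw [intervalIntegral.integral_symm, intervalIntegral.integral_of_le h,
        setIntegral_eq_zero_of_forall_eq_zero (fun s hs => hleft s hs.2), neg_zero]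
    rcases le_total t θ with h' | h'
    · refine intervalIntegral.integral_nonneg_of_ae_restrict h ?_
      filter_upwards [ae_restrict_mem measurableSet_Icc,
        ae_restrict_of_ae (compl_mem_ae_iff.2 (measure_singleton θ))] with s hs hs'
      simp only [hφ, Pi.zero_apply]
      rw [hκs s fun hh => hs' (le_antisymm (hs.2.trans h') hh.1), sub_zero]
      exact mul_nonneg hM0 (hB0 s)
    · have h1 := intervalIntegral.integral_add_adjacent_intervals (hint (τ / 4) t) (hint t c)
      rw [htot] at h1
      have h2 : ∫ s in t..c, φ s ≤ 0 := by
        rcases le_total t c with h3 | h3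
        · have h4 : 0 ≤ ∫ s in t..c, -φ s := intervalIntegral.integral_nonneg h3 fun s hs => by
            simp only [hφ]
            rw [hBs s (fun hh => by linarith [hh.2, hs.1]), mul_zero, zero_sub, neg_neg]
            exact hκ0 s
          rw [intervalIntegral.integral_neg] at h4
          linarith
        · rw [intervalIntegral.integral_symm, intervalIntegral.integral_of_le h3,
            setIntegral_eq_zero_of_forall_eq_zero (fun s hs => hright s hs.1), neg_zero]
      linarith
  have h1 := hF _ hχ hχ0
  have hder : ∀ t, deriv (fun t => ∫ s in (τ / 4)..t, φ s) t = M * B t - κ t := fun t =>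
    hφc.continuous.deriv_integral φ (τ / 4) t
  simp only [hder] at h1
  obtain ⟨C₁, hC₁⟩ := hκc.exists_bound_of_continuous hκ.continuous
  obtain ⟨C₂, hC₂⟩ := (β.hasCompactSupport_normed (μ := volume)).exists_bound_of_continuous
    hBc.continuous
  have i1 : Integrable fun t => F t * κ t := hFi.mul_bdd (c := C₁)
    hκ.continuous.aestronglyMeasurable (Eventually.of_forall hC₁)
  have i2 : Integrable fun t => F t * B t := hFi.mul_bdd (c := C₂)
    hBc.continuous.aestronglyMeasurable (Eventually.of_forall hC₂)
  have e1 : ∀ t, F t * (M * B t - κ t) = M * (F t * B t) - F t * κ t := fun t => by ring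
  simp only [e1] at h1
  rw [integral_sub (i2.const_mul M) i1, integral_const_mul] at h1
  have h2 : ∫ t, F t * B t ≤ ∫ t, η * B t := by
    refine integral_mono_ae i2 (hBi.const_mul η) ?_
    filter_upwards [hs₂] with t ht
    by_cases htI : t ∈ Ioo (τ / 4) (3 * τ / 4)
    · refine mul_le_mul_of_nonneg_right (le_of_lt ?_) (hB0 t)
      exact hss ⟨hsub ⟨by linarith [htI.1], by linarith [htI.2]⟩, ht⟩
    · rw [hBs t htI, mul_zero, mul_zero]
  rw [integral_const_mul, hB1, mul_one] at h2
  have h3 : M * η ≤ η₀ := by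
    rw [hη, ← mul_div_assoc, div_le_iff₀ (by linarith)]
    nlinarith
  have h4 := mul_le_mul_of_nonneg_left h2 hM0
  linarith

theorem ae_eq_zero_of_tendsto_zero {F : ℝ → ℝ} {T : ℝ} (hT : 0 < T) (hFi : Integrable F)
    (hFn : ∀ t, 0 ≤ F t)
    (hF : ∀ χ : ℝ → ℝ, IsTestFunction (Ioo 0 T) χ → (∀ t, 0 ≤ χ t) → 0 ≤ ∫ t, F t * deriv χ t)
    (hF0 : Tendsto F (𝓝[>] 0 ⊓ ae volume) (𝓝 0)) : ∀ᵐ t, t ∈ Ioo 0 T → F t = 0 := by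
  have key : ∀ k : ℕ, ∀ᵐ t, t ∈ Icc (T / (k + 3)) (T - T / (k + 3)) → F t = 0 := by
    intro k
    set θ := T / ((k : ℝ) + 3) with hθ
    have hθ0 : 0 < θ := by positivity
    have hθ2 : θ < T / 2 := div_lt_div_of_pos_left hT (by norm_num)
      (by linarith [Nat.cast_nonneg (α := ℝ) k])
    -- The bump equals one on `[θ, T - θ]` and is supported in `[θ/2, T - θ/2]`; the denominators `k
    -- + 3` ensure `θ < T / 2`.
    let β : ContDiffBump (T / 2) := ⟨T / 2 - θ, T / 2 - θ / 2, by linarith, by linarith⟩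
    have hβs : ∀ t ∉ Icc (θ / 2) (T - θ / 2), β t = 0 := fun t ht =>
      β.zero_of_le_dist (by
        by_contra hn
        rw [not_le, Real.dist_eq, abs_lt] at hn
        simp only [β] at hn
        exact ht ⟨by linarith [hn.1], by linarith [hn.2]⟩)
    have h1 := integral_mul_le_of_tendsto_zero hFi hF hF0 β.contDiff (fun t => β.nonneg)
      (by linarith : 0 < θ / 2) (by linarith) (by linarith) hβs
    have i1 : Integrable fun t => F t * β t := hFi.mul_bdd (c := 1)
      β.continuous.aestronglyMeasurable (Eventually.of_forall fun t => by
        rw [Real.norm_of_nonneg β.nonneg]; exact β.le_one)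
    have h2 : ∀ t, 0 ≤ F t * β t := fun t => mul_nonneg (hFn t) β.nonneg
    have h3 := (integral_eq_zero_iff_of_nonneg h2 i1).1 (le_antisymm h1 (integral_nonneg h2))
    filter_upwards [h3] with t ht htI
    have h4 : β t = 1 := β.one_of_mem_closedBall (by
      rw [Real.closedBall_eq_Icc]
      exact ⟨by simp only [β]; linarith [htI.1], by simp only [β]; linarith [htI.2]⟩)
    simpa [h4] using ht
  filter_upwards [ae_all_iff.2 key] with t ht htI
  have hmin : 0 < min t (T - t) := lt_min htI.1 (by linarith [htI.2])
  obtain ⟨k, hk⟩ := exists_nat_gt (T / min t (T - t))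
  have h1 : T / ((k : ℝ) + 3) ≤ min t (T - t) := by
    rw [div_lt_iff₀ hmin] at hk
    rw [div_le_iff₀ (by positivity)]
    nlinarith
  exact ht k ⟨h1.trans (min_le_left _ _), by linarith [h1.trans (min_le_right _ _)]⟩

end

/-! ### Application to weak solutions and conclusion. -/

section

variable {n : ℕ} {Ω : Set (EuclideanSpace ℝ (Fin n))} {T p : ℝ}
  {ψ ψ₁ ψ₂ u u₁ u₂ : EuclideanSpace ℝ (Fin n) × ℝ → ℝ}

theorem ae_ae_slice {P : EuclideanSpace ℝ (Fin n) × ℝ → Prop}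
    (h : ∀ᵐ z ∂(volume.restrict (spaceTimeCylinder Ω T)), P z) :
    ∀ᵐ t ∂(volume.restrict (Ioo 0 T)), ∀ᵐ x ∂(volume.restrict Ω), P (x, t) := by
  rw [restrict_cylinder] at h
  exact Measure.ae_ae_of_ae_prod (Measure.measurePreserving_swap.quasiMeasurePreserving.ae h)

/-- A weak solution has a representative satisfying the incremental form of the equation. -/
theorem IsWeakSolution.exists_incremental (hΩ : IsOpen Ω) (hvol : volume Ω ≠ ⊤) (hT : 0 < T)
    (hp : 1 < p) (h : IsWeakSolution Ω T p ψ u) :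
    ∃ U DU, IsIncremental Ω T p U DU ∧ (U =ᵐ[volume.restrict (spaceTimeCylinder Ω T)] u) ∧
      (∀ᵐ t, t ∈ Ioo 0 T → ∃ g, HasSobolevGradient Ω p (fun x => ψ (x, t)) g ∧
        HasSobolevGradientZero Ω p (fun x => U (x, t) - ψ (x, t)) (fun x => DU (x, t) - g x)) ∧
      Tendsto (fun t : ℝ => ∫⁻ x in Ω, ‖b p (U (x, t)) - b p (ψ (x, t))‖ₑ)
        (𝓝[>] 0 ⊓ ae volume) (𝓝 0) := by
  obtain ⟨Du, hDu, heq⟩ := h.equation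
  obtain ⟨D₀, hD₀, hD₀z⟩ := h.lateral
  obtain ⟨Dψ, hDψ⟩ := h.boundaryDatum.memParabolicSobolev
  have hmS : MeasurableSet (spaceTimeCylinder Ω T) := measurableSet_cylinder hΩ
  set S := spaceTimeCylinder Ω T with hS
  have hu1 := hDu.memLp.1
  have hu2 := hDu.memLp_gradient.1
  set U : EuclideanSpace ℝ (Fin n) × ℝ → ℝ := S.indicator (hu1.mk u) with hU
  set DU : EuclideanSpace ℝ (Fin n) × ℝ → EuclideanSpace ℝ (Fin n) :=
    S.indicator (hu2.mk Du) with hDU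
  have hUu : U =ᵐ[volume.restrict S] u :=
    (indicator_ae_eq_restrict hmS).trans hu1.ae_eq_mk.symm
  have hDUu : DU =ᵐ[volume.restrict S] Du :=
    (indicator_ae_eq_restrict hmS).trans hu2.ae_eq_mk.symm
  have hrep : IsRepresentative Ω T p U DU := by
    refine ⟨hu1.stronglyMeasurable_mk.measurable.indicator hmS,
      hu2.stronglyMeasurable_mk.measurable.indicator hmS, ?_, ?_,
      fun z hz => indicator_of_notMem hz _, fun z hz => indicator_of_notMem hz _⟩
    · exact (memLp_indicator_iff_restrict hmS).2 ((memLp_congr_ae hu1.ae_eq_mk).1 hDu.memLp)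
    · exact (memLp_indicator_iff_restrict hmS).2
        ((memLp_congr_ae hu2.ae_eq_mk).1 hDu.memLp_gradient)
  have heq' : ∀ γ : EuclideanSpace ℝ (Fin n) × ℝ → ℝ, IsTestFunction (spaceTimeCylinder Ω T) γ →
      ∫ z in spaceTimeCylinder Ω T,
        (-(b p (U z)) * deriv (fun t => γ (z.1, t)) z.2
          + inner ℝ (flux p (DU z)) (gradient (fun x => γ (x, z.2)) z.1)) = 0 := by
    intro γ hγ
    rw [← heq γ hγ]
    refine integral_congr_ae ?_
    filter_upwards [hUu, hDUu] with z h1 h2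
    rw [h1, h2]
  have hsl := ae_ae_slice hUu
  have hslD := ae_ae_slice hDUu
  refine ⟨U, DU, ⟨hrep, fun s hs => hrep.ae_increment hT hp hvol heq' hs⟩, hUu, ?_, ?_⟩
  · rw [← ae_restrict_iff' measurableSet_Ioo]
    filter_upwards [hsl, hslD, hDu.slice, hD₀z, hDψ.slice] with t h1 h2 h3 h4 h5
    refine ⟨fun x => Dψ (x, t), h5, ?_⟩
    -- The gradient in the lateral condition and the one in the equation are given separately;
    -- uniqueness identifies the former with `Du - Dψ` on almost every slice.
    have h6 := (h3.sub hp h5).ae_unique hΩ hp h4.toHasSobolevGradient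
    refine h4.congr_ae ?_ ?_
    · filter_upwards [h1] with x hx
      rw [hx]
    · filter_upwards [h2, h6] with x hx hx'
      rw [hx, hx']
  · refine h.initial.congr' ?_
    have e1 : ∀ᶠ t in 𝓝[>] (0 : ℝ) ⊓ ae volume, t ∈ Ioo 0 T :=
      Filter.Eventually.filter_mono inf_le_left (Ioo_mem_nhdsGT hT)
    have e2 := ((ae_restrict_iff' measurableSet_Ioo).1 hsl).filter_mono
      (inf_le_right (a := 𝓝[>] (0 : ℝ)))
    filter_upwards [e1, e2] with t ht ht'
    refine lintegral_congr_ae ?_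
    filter_upwards [ht' ht] with x hx
    rw [hx]

theorem closure_cylinder (hT : 0 < T) :
    closure (spaceTimeCylinder Ω T) = closure Ω ×ˢ Icc 0 T := by
  rw [spaceTimeCylinder, closure_prod_eq, closure_Ioo hT.ne]

/-- Ordered boundary data are ordered near the parabolic boundary, also at different times. -/
theorem exists_order_near_boundary (hΩ : IsOpen Ω) (hb : Bornology.IsBounded Ω) (hT : 0 < T)
    (h₁ : ContinuousOn ψ₁ (closure (spaceTimeCylinder Ω T)))
    (h₂ : ContinuousOn ψ₂ (closure (spaceTimeCylinder Ω T))) {ε : ℝ} (hε : 0 < ε)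
    (hψ : ∀ z ∈ parabolicBoundary Ω T, ψ₁ z ≤ ψ₂ z - ε) :
    ∃ ρ : ℝ, 0 < ρ ∧ (∀ x ∈ Ω, ∀ t ∈ Ioo 0 T, t < ρ → ψ₁ (x, t) ≤ ψ₂ (x, t)) ∧
      ∃ K, IsCompact K ∧ K ⊆ Ω ∧ ∀ x ∈ Ω \ K, ∀ t ∈ Ioo 0 T, ∀ s ∈ Ioo 0 T, |t - s| < ρ →
        ψ₁ (x, t) ≤ ψ₂ (x, s) := by
  rw [closure_cylinder hT] at h₁ h₂
  have hcl : IsCompact (closure Ω) := hb.isCompact_closure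
  have hc : IsCompact (closure Ω ×ˢ Icc 0 T) := hcl.prod isCompact_Icc
  -- Each datum may vary by `ε / 2`; the two losses together use up the gap `ε`.
  obtain ⟨ρ₁, hρ₁, h₁⟩ := Metric.uniformContinuousOn_iff.1
    (hc.uniformContinuousOn_of_continuous h₁) (ε / 2) (half_pos hε)
  obtain ⟨ρ₂, hρ₂, h₂⟩ := Metric.uniformContinuousOn_iff.1
    (hc.uniformContinuousOn_of_continuous h₂) (ε / 2) (half_pos hε)
  simp only [Real.dist_eq, abs_lt] at h₁ h₂
  have hmem : ∀ x ∈ Ω, ∀ t ∈ Ioo 0 T, (x, t) ∈ closure Ω ×ˢ Icc 0 T := fun x hx t ht =>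
    ⟨subset_closure hx, Ioo_subset_Icc_self ht⟩
  refine ⟨min ρ₁ ρ₂, lt_min hρ₁ hρ₂, fun x hx t ht htρ => ?_, ?_⟩
  · have hm : (x, (0 : ℝ)) ∈ closure Ω ×ˢ Icc 0 T := ⟨subset_closure hx, by simp [hT.le]⟩
    have hd : dist (x, t) (x, (0 : ℝ)) < min ρ₁ ρ₂ := by
      rw [Prod.dist_eq, dist_self, Real.dist_0_eq_abs, abs_of_pos ht.1]
      exact max_lt (lt_min hρ₁ hρ₂) htρ
    have e1 := h₁ _ (hmem x hx t ht) _ hm (hd.trans_le (min_le_left _ _))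
    have e2 := h₂ _ (hmem x hx t ht) _ hm (hd.trans_le (min_le_right _ _))
    have e3 := hψ (x, 0) (Or.inl ⟨subset_closure hx, rfl⟩)
    linarith [e1.2, e2.1]
  -- The points at distance at least `min ρ₁ ρ₂` from the boundary. A point of `Ω` outside this set
  -- has a nearby boundary point, through which the data are compared.
  · refine ⟨closure Ω ∩ ⋂ y ∈ frontier Ω, {x | min ρ₁ ρ₂ ≤ dist x y},
      hcl.inter_right (isClosed_biInter fun y _ =>
        isClosed_le continuous_const (continuous_id.dist continuous_const)), ?_, ?_⟩
    · rintro x ⟨hx1, hx2⟩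
      by_contra hn
      have hf : x ∈ frontier Ω := by rw [hΩ.frontier_eq]; exact ⟨hx1, hn⟩
      have := mem_iInter₂.1 hx2 x hf
      rw [mem_ofPred_eq, dist_self] at this
      exact absurd this (not_le.2 (lt_min hρ₁ hρ₂))
    · rintro x ⟨hx, hxK⟩ t ht s hs hts
      have : ∃ y ∈ frontier Ω, dist x y < min ρ₁ ρ₂ := by
        by_contra! hn
        exact hxK ⟨subset_closure hx, mem_iInter₂.2 hn⟩
      obtain ⟨y, hy, hxy⟩ := this
      have hm : (y, t) ∈ closure Ω ×ˢ Icc 0 T :=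
        ⟨frontier_subset_closure hy, Ioo_subset_Icc_self ht⟩
      have hd1 : dist (x, t) (y, t) < min ρ₁ ρ₂ := by
        rw [Prod.dist_eq, dist_self]
        exact max_lt hxy (lt_min hρ₁ hρ₂)
      have hd2 : dist (x, s) (y, t) < min ρ₁ ρ₂ := by
        rw [Prod.dist_eq, Real.dist_eq, abs_sub_comm]
        exact max_lt hxy hts
      have e1 := h₁ _ (hmem x hx t ht) _ hm (hd1.trans_le (min_le_left _ _))
      have e2 := h₂ _ (hmem x hx s hs) _ hm (hd2.trans_le (min_le_right _ _))
      have e3 := hψ (y, t) (Or.inr ⟨hy, Ioo_subset_Icc_self ht⟩)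
      linarith [e1.2, e2.1]

/-- The difference splits as `(w₁ - f₁) - (w₂ - f₂)`, in `W_0^{1,p}(Ω)`, plus `f₁ - f₂`, nonpositive
off `K`: the situation of `HasSobolevGradientZero.comp_add`. -/
theorem hasSobolevGradientZero_smoothStep_sub (hΩ : IsOpen Ω) (hp : 1 < p)
    {w₁ w₂ f₁ f₂ : EuclideanSpace ℝ (Fin n) → ℝ}
    {D₁ D₂ g₁ g₂ : EuclideanSpace ℝ (Fin n) → EuclideanSpace ℝ (Fin n)}
    (hf₁ : HasSobolevGradient Ω p f₁ g₁) (hf₂ : HasSobolevGradient Ω p f₂ g₂)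
    (h₁ : HasSobolevGradientZero Ω p (fun x => w₁ x - f₁ x) fun x => D₁ x - g₁ x)
    (h₂ : HasSobolevGradientZero Ω p (fun x => w₂ x - f₂ x) fun x => D₂ x - g₂ x)
    {K : Set (EuclideanSpace ℝ (Fin n))} (hK : IsCompact K) (hKΩ : K ⊆ Ω)
    (hle : ∀ x ∈ Ω \ K, f₁ x ≤ f₂ x) {δ : ℝ} (hδ : 0 < δ) :
    HasSobolevGradientZero Ω p (fun x => smoothStep δ (w₁ x - w₂ x))
      (fun x => deriv (smoothStep δ) (w₁ x - w₂ x) • (D₁ x - D₂ x)) := by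
  obtain ⟨M, hM⟩ := exists_deriv_smoothStep_le δ
  have h := (h₁.sub hp h₂).comp_add hΩ hp (contDiff_smoothStep δ)
    (fun z hz => smoothStep_of_nonpos hδ hz) (fun z hz => deriv_smoothStep_of_nonpos hδ hz) hM
    (hf₁.sub hp hf₂) hK hKΩ (fun x hx => sub_nonpos.2 (hle x hx))
  have e1 : ∀ x, w₁ x - f₁ x - (w₂ x - f₂ x) + (f₁ x - f₂ x) = w₁ x - w₂ x := fun x => by ring
  have e2 : ∀ x, D₁ x - g₁ x - (D₂ x - g₂ x) + (g₁ x - g₂ x) = D₁ x - D₂ x := fun x => by abel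
  simpa only [e1, e2] using h

/-- Where `ψ₁ ≤ ψ₂`, monotonicity of `b` bounds `(b(U₁) - b(U₂))⁺` by `|b(U₁) - b(ψ₁)| + |b(U₂) -
b(ψ₂)|`, and both integrals tend to zero. -/
theorem tendsto_integral_max_of_initial (hp : 1 < p) {U₁ U₂ : EuclideanSpace ℝ (Fin n) × ℝ → ℝ}
    (hU₁ : Measurable U₁) (hU₂ : Measurable U₂)
    (hz₁ : ∀ z ∉ spaceTimeCylinder Ω T, U₁ z = 0) (hz₂ : ∀ z ∉ spaceTimeCylinder Ω T, U₂ z = 0)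
    (hm : ∀ᵐ t, t ∈ Ioo 0 T → AEStronglyMeasurable (fun x => ψ₁ (x, t)) (volume.restrict Ω))
    (hΩ : IsOpen Ω) (hT : 0 < T) {ρ : ℝ} (hρ : 0 < ρ)
    (hψ : ∀ x ∈ Ω, ∀ t ∈ Ioo 0 T, t < ρ → ψ₁ (x, t) ≤ ψ₂ (x, t))
    (h₁ : Tendsto (fun t : ℝ => ∫⁻ x in Ω, ‖b p (U₁ (x, t)) - b p (ψ₁ (x, t))‖ₑ)
        (𝓝[>] 0 ⊓ ae volume) (𝓝 0))
    (h₂ : Tendsto (fun t : ℝ => ∫⁻ x in Ω, ‖b p (U₂ (x, t)) - b p (ψ₂ (x, t))‖ₑ)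
        (𝓝[>] 0 ⊓ ae volume) (𝓝 0)) :
    Tendsto (fun t => ∫ x, max (b p (U₁ (x, t)) - b p (U₂ (x, t))) 0)
      (𝓝[>] 0 ⊓ ae volume) (𝓝 0) := by
  have hbc := continuous_b hp
  have hl : Tendsto (fun t => ∫⁻ x in Ω, ENNReal.ofReal (max (b p (U₁ (x, t)) - b p (U₂ (x, t))) 0))
      (𝓝[>] 0 ⊓ ae volume) (𝓝 0) := by
    have h3 := h₁.add h₂
    rw [add_zero] at h3
    refine tendsto_of_tendsto_of_tendsto_of_le_of_le' tendsto_const_nhds h3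
      (Eventually.of_forall fun _ => zero_le) ?_
    have e1 : ∀ᶠ t in 𝓝[>] (0 : ℝ) ⊓ ae volume, t ∈ Ioo 0 (min T ρ) :=
      Filter.Eventually.filter_mono inf_le_left (Ioo_mem_nhdsGT (lt_min hT hρ))
    filter_upwards [e1, hm.filter_mono (inf_le_right (a := 𝓝[>] (0 : ℝ)))] with t ht hmt
    have htT : t ∈ Ioo 0 T := ⟨ht.1, ht.2.trans_le (min_le_left _ _)⟩
    have hmeas : AEMeasurable (fun x => ‖b p (U₁ (x, t)) - b p (ψ₁ (x, t))‖ₑ)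
        (volume.restrict Ω) :=
      (((hbc.measurable.comp (hU₁.comp measurable_prodMk_right)).aestronglyMeasurable.sub
        (hbc.comp_aestronglyMeasurable (hmt htT)))).enorm
    rw [← lintegral_add_left' hmeas]
    refine setLIntegral_mono' hΩ.measurableSet fun x hx => ?_
    have hle := (b_strictMono hp).monotone (hψ x hx t htT (ht.2.trans_le (min_le_right _ _)))
    rw [← ofReal_norm, ← ofReal_norm, ← ENNReal.ofReal_add (norm_nonneg _)
      (norm_nonneg _)]
    refine ENNReal.ofReal_le_ofReal (max_le ?_ (by positivity))
    have a1 := le_abs_self (b p (U₁ (x, t)) - b p (ψ₁ (x, t)))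
    have a2 := neg_le_abs (b p (U₂ (x, t)) - b p (ψ₂ (x, t)))
    rw [Real.norm_eq_abs, Real.norm_eq_abs]
    linarith
  have h4 := (ENNReal.tendsto_toReal ENNReal.zero_ne_top).comp hl
  rw [ENNReal.toReal_zero] at h4
  refine h4.congr fun t => ?_
  have e : ∫ x, max (b p (U₁ (x, t)) - b p (U₂ (x, t))) 0
      = ∫ x in Ω, max (b p (U₁ (x, t)) - b p (U₂ (x, t))) 0 :=
    (setIntegral_eq_integral_of_forall_compl_eq_zero fun x hx => by
      rw [hz₁ _ fun h => hx h.1, hz₂ _ fun h => hx h.1, sub_self, max_self]).symm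
  rw [e]
  refine (integral_eq_lintegral_of_nonneg_ae (Eventually.of_forall fun x => le_max_right _ _)
    ?_).symm
  exact (((hbc.measurable.comp (hU₁.comp measurable_prodMk_right)).sub
      (hbc.measurable.comp (hU₂.comp measurable_prodMk_right))).max
        measurable_const).aestronglyMeasurable

theorem comparison_principle (hΩ : IsOpen Ω) (hb : Bornology.IsBounded Ω) (hT : 0 < T)
    (hp : 1 < p) (hu₁ : IsWeakSolution Ω T p ψ₁ u₁) (hu₂ : IsWeakSolution Ω T p ψ₂ u₂)
    {ε : ℝ} (hε : 0 < ε) (hψ : ∀ z ∈ parabolicBoundary Ω T, ψ₁ z ≤ ψ₂ z - ε) :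
    ∀ᵐ z ∂(volume.restrict (spaceTimeCylinder Ω T)), u₁ z ≤ u₂ z := by
  have hvol : volume Ω ≠ ⊤ := hb.measure_lt_top.ne
  obtain ⟨U, DU, hU, hUu, hU0, hUi⟩ := hu₁.exists_incremental hΩ hvol hT hp
  obtain ⟨V, DV, hV, hVu, hV0, hVi⟩ := hu₂.exists_incremental hΩ hvol hT hp
  obtain ⟨ρ, hρ, hini, K, hK, hKΩ, hlat⟩ := exists_order_near_boundary hΩ hb hT
    hu₁.boundaryDatum.continuousOn hu₂.boundaryDatum.continuousOn hε hψ
  have hG : Integrable fun z => max (b p (U z) - b p (V z)) 0 :=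
    ((hU.integrable_b hp hvol).sub (hV.integrable_b hp hvol)).pos_part
  have hG' := hG
  rw [Measure.volume_eq_prod] at hG'
  have hFi := hG'.integral_prod_right
  have hF : ∀ χ : ℝ → ℝ, IsTestFunction (Ioo 0 T) χ → (∀ t, 0 ≤ χ t) →
      0 ≤ ∫ t, (∫ x, max (b p (U (x, t)) - b p (V (x, t))) 0) * deriv χ t := by
    intro χ hχ hχ0
    have h := hU.integral_max_nonneg hp hvol hT hV hU0 hV0 hρ
      (fun t ht s hs htT hsT hts δ hδ => by
        obtain ⟨g₁, a1, a2⟩ := ht htT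
        obtain ⟨g₂, a3, a4⟩ := hs hsT
        exact hasSobolevGradientZero_smoothStep_sub hΩ hp a1 a3 a2 a4 hK hKΩ
          (fun x hx => hlat x hx t htT s hsT hts) hδ) hχ hχ0
    obtain ⟨C, hC⟩ := hχ.hasCompactSupport.deriv.exists_bound_of_continuous
      (hχ.contDiff.continuous_deriv (by simp))
    have i1 : Integrable (fun z : EuclideanSpace ℝ (Fin n) × ℝ =>
        max (b p (U z) - b p (V z)) 0 * deriv χ z.2) (volume.prod volume) :=
      hG'.mul_bdd (c := C) ((hχ.contDiff.continuous_deriv (by simp)).comp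
        continuous_snd).aestronglyMeasurable (Eventually.of_forall fun z => hC z.2)
    rw [Measure.volume_eq_prod, integral_prod_symm _ i1] at h
    simpa only [integral_mul_const] using h
  have hm : ∀ᵐ t, t ∈ Ioo 0 T →
      AEStronglyMeasurable (fun x => ψ₁ (x, t)) (volume.restrict Ω) := by
    filter_upwards [hU0] with t h ht
    obtain ⟨g, hg, -⟩ := h ht
    exact hg.memLp.1
  have hzero := ae_eq_zero_of_tendsto_zero hT hFi
    (fun t => integral_nonneg fun x => le_max_right _ _) hF
    (tendsto_integral_max_of_initial hp hU.measurable hV.measurable hU.eq_zero hV.eq_zero hm hΩ hT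
      hρ hini hUi hVi)
  have hint : ∫ z, max (b p (U z) - b p (V z)) 0 = 0 := by
    rw [Measure.volume_eq_prod, integral_prod_symm _ hG']
    refine integral_eq_zero_of_ae ?_
    filter_upwards [hzero] with t ht
    by_cases htI : t ∈ Ioo 0 T
    · exact ht htI
    · have e : ∀ x, max (b p (U (x, t)) - b p (V (x, t))) 0 = 0 := fun x => by
        rw [hU.eq_zero _ fun h => htI h.2, hV.eq_zero _ fun h => htI h.2, sub_self, max_self]
      simp [e]
  have hae := (integral_eq_zero_iff_of_nonneg (fun z => le_max_right _ _) hG).1 hint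
  filter_upwards [ae_restrict_of_ae hae, hUu, hVu] with z h1 h2 h3
  rw [← h2, ← h3]
  have h4 : b p (U z) - b p (V z) ≤ 0 := (le_max_left _ _).trans h1.le
  exact (b_strictMono hp).le_iff_le.1 (sub_nonpos.1 h4)

end

end Trudinger

end

theorem theorem3p1 (n : ℕ) (Ω : Set (EuclideanSpace ℝ (Fin n)))
    (hΩ : Trudinger.IsBoundedLipschitzDomain Ω) (T : ℝ) (hT : 0 < T) (p : ℝ) (hp : 1 < p)
    (ψ₁ ψ₂ u₁ u₂ : EuclideanSpace ℝ (Fin n) × ℝ → ℝ)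
    (hu₁ : Trudinger.IsWeakSolution Ω T p ψ₁ u₁)
    (hu₂ : Trudinger.IsWeakSolution Ω T p ψ₂ u₂)
    (ε : ℝ) (hε : 0 < ε)
    (hψ : ∀ z ∈ Trudinger.parabolicBoundary Ω T, ψ₁ z ≤ ψ₂ z - ε) :
    ∀ᵐ z ∂(volume.restrict (Trudinger.spaceTimeCylinder Ω T)), u₁ z ≤ u₂ z :=
  Trudinger.comparison_principle hΩ.isOpen hΩ.isBounded hT hp hu₁ hu₂ hε hψ
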